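/- Theorem 2. An instance of Tree Augmentation with unit costs consists of a finite tree $T=(V,F)$ and a finite set $E$ of additional (undirected) edges on $V$ (loops and parallel edges are allowed); the goal is to find a set $J\subseteq E$ of minimum size such that the multigraph $T\cup J$ is $2$-edge-connected (an edge of $J$ joining two nodes that are adjacent in $T$ is regarded as parallel to the corresponding edge of $T$). For $u,v\in V$ let $T_{uv}$ be the unique $uv$-path in $T$, and for $f\in F$ let $\psi(f)$ be the set of edges $uv\in E$ such that $f\in T_{uv}$. The Cut-LP of the instance is $$\min\Big\{\sum_{e\in E}x_e \;:\; x\in\mathbb{R}^E,\ \sum_{e\in\psi(f)}x_e\ge 1\ \ \forall f\in F,\ x\ge 0\Big\}.$$ Then, for unit costs, the integrality gap of the Cut-LP is at most $28/15=2-2/15$: the supremum, over all instances for which a solution exists, of the ratio between the minimum size of a solution $J$ and the optimal value of the Cut-LP is at most $28/15$ (the trivial ratio $0/0$, which arises only when $T$ has a single node, is counted as $0$). -/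

import Mathlib

open scoped ENNReal

namespace TreeAugmentation

universe u v w

/-! Multigraphs on a vertex set `V` are given by a type `B` of edges together with the map sending
each edge to its unordered pair of end nodes; parallel edges and loops are allowed. -/

/-- A multigraph is `2`-edge-connected if it remains connected after the deletion of any set
of fewer than two edges (that is, of no edge or of a single edge). Parallel edges are counted
separately: deleting one of them does not delete the other ones. -/
def TwoEdgeConnected {V : Type u} {B : Type w} (ends : B → Sym2 V) : Prop :=
  ∀ D : Set B, D.encard < 2 → (SimpleGraph.fromEdgeSet (ends '' Dᶜ)).Connected

section Instance

variable {V : Type u} {E : Type v} (T : SimpleGraph V) (ends : E → Sym2 V)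

/-- The end nodes of the edges of the multigraph `T ∪ J`, where `J` is a set of additional edges:
its edges are the disjoint union of the edges of `T` and of `J`, so an edge of `J` whose end nodes
are adjacent in `T` is parallel to an edge of `T`. -/
def unionEnds (J : Finset E) : T.edgeSet ⊕ {e : E // e ∈ J} → Sym2 V :=
  Sum.elim (fun f => (f : Sym2 V)) (fun e => ends (e : E))

/-- `J` is a solution of the Tree Augmentation instance: `T ∪ J` is `2`-edge-connected. -/
def IsSolution (J : Finset E) : Prop :=
  TwoEdgeConnected (unionEnds T ends J)

/-- The additional edge `e` covers the `T`-edge `f`: `f` lies on the path of `T` between the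
end nodes of `e`. -/
def Covers (e : E) (f : T.edgeSet) : Prop :=
  ∃ (a b : V) (p : T.Walk a b), ends e = s(a, b) ∧ p.IsPath ∧ (f : Sym2 V) ∈ p.edges

variable [Fintype E]

open Classical in
/-- `ψ(f)`, the set of additional edges that cover the `T`-edge `f`. -/
noncomputable def psi (f : T.edgeSet) : Finset E :=
  Finset.univ.filter fun e => Covers T ends e f

/-- The Cut-Polyhedron: all `x ∈ ℝ^E` with `x ≥ 0` and `x(ψ(f)) ≥ 1` for every `T`-edge `f`. -/
def cutPolyhedron : Set (E → ℝ) :=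
  {x | (∀ f : T.edgeSet, 1 ≤ ∑ e ∈ psi T ends f, x e) ∧ ∀ e, 0 ≤ x e}

/-- The optimal value of the unit cost Cut-LP (an infimum in `[0, ∞]`). -/
noncomputable def cutLPOpt : ℝ≥0∞ :=
  ⨅ x ∈ cutPolyhedron T ends, ENNReal.ofReal (∑ e, x e)

end Instance

/-- The optimal value of the unit cost Tree Augmentation instance: the minimum number of
edges in a solution (`∞` if there is no solution). -/
noncomputable def integralOpt {V : Type u} {E : Type v} (T : SimpleGraph V) (ends : E → Sym2 V) :
    ℝ≥0∞ :=
  ⨅ (J : Finset E) (_ : IsSolution T ends J), (J.card : ℝ≥0∞)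

/-- The integrality gap of the Cut-LP for unit costs: the supremum, over all instances with a
finite tree `T` and a finite family `E` of additional edges such that a solution exists, of the
ratio between the optimal value of the instance and the optimal value of its Cut-LP.
In `[0, ∞]` one has `0 / 0 = 0` and `a / 0 = ∞` for `a ≠ 0`. -/
noncomputable def cutLPIntegralityGap : ℝ≥0∞ :=
  ⨆ (V : Type u) (E : Type v) (_ : Fintype V) (_ : Fintype E) (T : SimpleGraph V)
    (ends : E → Sym2 V) (_ : T.IsTree) (_ : ∃ J : Finset E, IsSolution T ends J),
    integralOpt T ends / cutLPOpt T ends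

end TreeAugmentation

/-!
Rooting the tree `T` at a node `r`, every edge `f` of `T` cuts off a node set, its `treeCut`. These
sets form a laminar family, and an additional edge (a *link*) covers `f` exactly when it crosses the
cut of `f`. So it suffices to show `Laminar.exists_cover`: if `x ≥ 0` puts weight at least `1` on
the links crossing each member of a laminar family `C`, then at most `28 / 15 * ∑ e, x e` links
cross all members.

*Combinatorial part.* The leaves of `C` are its minimal members. Let `M` be a matching of links that
join leaves, none of which joins the two leaves of a two-leaf member. Then
`MatchedFamily.exists_cover` covers `C` with at most `|leaves| - 3/10 |M| + 3/5 * surplus` links;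
the surplus is the weight of link ends outside the leaves plus the excess over `1` of the cuts of
matched leaves. The proof is by induction: find a member `S` whose strict subsets can be covered
while one credit of `S` remains, and contract `S` to a leaf that owns this credit. To find `S`,
extend `M` to a maximal matching `N` on the leaves. A member is semi-closed if no link of `N` leaves
it and no link at an `N`-unmatched leaf inside it leaves it. If no member is semi-closed, `N`
together with one farthest reaching link per unmatched leaf covers everything
(`exists_basic_cover`). A minimal semi-closed `S` can be covered in the same way, and counting the
constraints of its unmatched leaves against the links that can serve them (`card_add_one_le`)
provides the surplus to pay for it. The only exception is a deficient `S`: one link of `M`, one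
unmatched leaf and little surplus. In a deficient set the matched link can be exchanged so that one
of its ends `c` becomes unmatched and has a link leaving `S` (`exists_dangerous_labelling`). If all
minimal semi-closed sets are deficient, treat all of them as leaves with the links of `c` and repeat
the argument; a second failure is impossible, because the labelling was chosen so that the links at
`c` reach as far as possible (`Blocked.contractible`).

*Linear programming part.* `exists_matchedFamily` finds such an `M` with
`12 |leaves| ≤ 20 * ∑ e, x e + 9 |M|`: take `M` maximum. Absence of augmenting paths of length three turns `M` into a
fractional vertex cover of weight `3/2 |M|` (`exists_fractional_vertex_cover`). Testing `x` against
it bounds the weight of the non-twin links between leaves (`totalWeight_add_sum_le`), and the cut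
constraints of the two-leaf members bound the weight of the twin links by that of the others
(`sum_twin_weight_le`).

The surplus of the whole node set is at most `2 * ∑ e, x e - |leaves|`, as links have two ends. The
two parts together give `|J| ≤ 2/5 |leaves| - 3/10 |M| + 6/5 ∑ e, x e ≤ (2/3 + 6/5) ∑ e, x e`.
-/

namespace TreeAugmentation

open scoped Classical

section

open Finset

variable {V : Type*} {E : Type*}

/-! ### Links, cuts and laminar families -/

/-- The link `e`, with end nodes `(l e).1` and `(l e).2`, crosses the node set `D`: exactly one of
its two ends lies in `D`. -/
def Crosses (l : E → V × V) (e : E) (D : Finset V) : Prop :=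
  ¬((l e).1 ∈ D ↔ (l e).2 ∈ D)

/-- A laminar family of nonempty node sets: any two members are nested or disjoint. -/
structure Laminar (C : Finset (Finset V)) : Prop where
  nonempty : ∀ D ∈ C, D.Nonempty
  nested : ∀ D ∈ C, ∀ D' ∈ C, D ⊆ D' ∨ D' ⊆ D ∨ Disjoint D D'

/-- The leaves of a laminar family are its inclusion-minimal members. -/
noncomputable def leaves (C : Finset (Finset V)) : Finset (Finset V) :=
  C.filter fun p => ∀ D ∈ C, D ⊆ p → D = p

/-- The leaves of `C` contained in `D`. -/
noncomputable def leavesIn (C : Finset (Finset V)) (D : Finset V) : Finset (Finset V) :=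
  (leaves C).filter fun p => p ⊆ D

variable {l : E → V × V} {C : Finset (Finset V)} {e : E}

theorem Laminar.mono (hC : Laminar C) {C' : Finset (Finset V)} (h : C' ⊆ C) : Laminar C' :=
  ⟨fun D hD => hC.nonempty D (h hD), fun D hD D' hD' => hC.nested D (h hD) D' (h hD')⟩

theorem mem_leaves {p : Finset V} : p ∈ leaves C ↔ p ∈ C ∧ ∀ D ∈ C, D ⊆ p → D = p := by
  simp [leaves]

theorem mem_leavesIn {p D : Finset V} : p ∈ leavesIn C D ↔ p ∈ leaves C ∧ p ⊆ D := by
  simp [leavesIn]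

theorem leaves_subset : leaves C ⊆ C := Finset.filter_subset _ _

theorem exists_minimal_subset {P : Finset V → Prop} {D : Finset V} (hD : P D) :
    ∃ S ⊆ D, P S ∧ ∀ S' ⊂ S, ¬P S' := by
  induction D using Finset.strongInduction with
  | H D ih =>
    by_cases h : ∃ S' ⊂ D, P S'
    · obtain ⟨S', hS', hP⟩ := h
      obtain ⟨S, hS, h1, h2⟩ := ih S' hS' hP
      exact ⟨S, hS.trans hS'.subset, h1, h2⟩
    · push Not at h
      exact ⟨D, subset_rfl, hD, h⟩

theorem exists_leaf_subset {D : Finset V} (hD : D ∈ C) : ∃ p ∈ leaves C, p ⊆ D := by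
  obtain ⟨S, hS, h1, h2⟩ := exists_minimal_subset (P := (· ∈ C)) hD
  refine ⟨S, mem_leaves.2 ⟨h1, fun D' hD' hs => ?_⟩, hS⟩
  by_contra hne
  exact h2 D' (hs.ssubset_of_ne hne) hD'

theorem Laminar.leaf_subset_or_disjoint (hC : Laminar C) {p D : Finset V} (hp : p ∈ leaves C)
    (hD : D ∈ C) : p ⊆ D ∨ Disjoint p D := by
  obtain ⟨hpC, hmin⟩ := mem_leaves.1 hp
  rcases hC.nested p hpC D hD with h | h | h
  · exact Or.inl h
  · exact Or.inl (hmin D hD h).ge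
  · exact Or.inr h

theorem Laminar.leaf_disjoint (hC : Laminar C) {p q : Finset V} (hp : p ∈ leaves C)
    (hq : q ∈ leaves C) (hne : p ≠ q) : Disjoint p q := by
  rcases hC.leaf_subset_or_disjoint hp (leaves_subset hq) with h | h
  · exact absurd ((mem_leaves.1 hq).2 p (leaves_subset hp) h) hne
  · exact h

theorem Laminar.leaf_pairwise (hC : Laminar C) : (leaves C : Set (Finset V)).Pairwise Disjoint :=
  fun _ hp _ hq hne => hC.leaf_disjoint hp hq hne

/-- Two members of a laminar family that share a nonempty subset are nested. -/
theorem Laminar.nested_of_common (hC : Laminar C) {D D' p : Finset V} (hD : D ∈ C) (hD' : D' ∈ C)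
    (hp : p.Nonempty) (h : p ⊆ D) (h' : p ⊆ D') : D ⊆ D' ∨ D' ⊆ D := by
  rcases hC.nested D hD D' hD' with h1 | h1 | h1
  · exact Or.inl h1
  · exact Or.inr h1
  · obtain ⟨v, hv⟩ := hp
    exact absurd (h' hv) (Finset.disjoint_left.1 h1 (h hv))

theorem Crosses.cases {D : Finset V} (h : Crosses l e D) :
    ((l e).1 ∈ D ∧ (l e).2 ∉ D) ∨ ((l e).2 ∈ D ∧ (l e).1 ∉ D) := by
  unfold Crosses at h
  tauto

theorem Crosses.of_nested {p D D' : Finset V} (h : Crosses l e p) (h' : Crosses l e D')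
    (hpD : p ⊆ D) (hDD : D ⊆ D') : Crosses l e D := by
  unfold Crosses at *
  have h1 := @hpD (l e).1
  have h2 := @hpD (l e).2
  have h3 := @hDD (l e).1
  have h4 := @hDD (l e).2
  tauto

theorem Crosses.of_disjoint {A B D : Finset V} (h : Crosses l e A) (h' : Crosses l e B)
    (hAD : A ⊆ D) (hBD : Disjoint B D) : Crosses l e D := by
  unfold Crosses at *
  have h1 := @hAD (l e).1
  have h2 := @hAD (l e).2
  have h3 : (l e).1 ∈ B → (l e).1 ∉ D := fun h => Finset.disjoint_left.1 hBD h
  have h4 : (l e).2 ∈ B → (l e).2 ∉ D := fun h => Finset.disjoint_left.1 hBD h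
  tauto

/-- A link has only two ends, so it crosses at most two of any pairwise disjoint sets. -/
theorem Crosses.eq_or_eq {L : Finset (Finset V)} (hL : (L : Set (Finset V)).Pairwise Disjoint)
    {p q r : Finset V} (hp : p ∈ L) (hq : q ∈ L) (hr : r ∈ L) (hpq : p ≠ q)
    (h1 : Crosses l e p) (h2 : Crosses l e q) (h3 : Crosses l e r) : r = p ∨ r = q := by
  by_contra! hne
  have key : ∀ a b, a ∈ L → b ∈ L → a ≠ b → ∀ v, v ∈ a → v ∉ b := fun a b ha hb hab v h =>
    Finset.disjoint_left.1 (hL ha hb hab) h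
  rcases h1.cases with a | a <;> rcases h2.cases with b | b <;> rcases h3.cases with c | c
  · exact key p q hp hq hpq _ a.1 b.1
  · exact key p q hp hq hpq _ a.1 b.1
  · exact key r p hr hp hne.1 _ c.1 a.1
  · exact key r q hr hq hne.2 _ c.1 b.1
  · exact key r q hr hq hne.2 _ c.1 b.1
  · exact key r p hr hp hne.1 _ c.1 a.1
  · exact key p q hp hq hpq _ a.1 b.1
  · exact key p q hp hq hpq _ a.1 b.1

/-- Properties that are inherited by smaller members of a chain have initial segments as their
extents; hence among finitely many of them one is weakest. -/
theorem exists_weakest_on_chain {ι : Type*} {s : Finset ι} (hs : s.Nonempty)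
    {K : Finset (Finset V)} (hK : ∀ D ∈ K, ∀ D' ∈ K, D ⊆ D' ∨ D' ⊆ D)
    {P : ι → Finset V → Prop}
    (hP : ∀ i ∈ s, ∀ D ∈ K, ∀ D' ∈ K, D ⊆ D' → P i D' → P i D) :
    ∃ i ∈ s, ∀ j ∈ s, ∀ D ∈ K, P j D → P i D := by
  obtain ⟨i, hi, hmax⟩ := s.exists_max_image (fun i => (K.filter (P i)).card) hs
  refine ⟨i, hi, fun j hj D hD hjD => ?_⟩
  by_contra hiD
  refine absurd (hmax j hj) (not_le.2 (Finset.card_lt_card ?_))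
  refine (Finset.ssubset_iff_of_subset fun D' hD' => ?_).2 ⟨D, by simp [hD, hjD], by simp [hiD]⟩
  simp only [Finset.mem_filter] at hD' ⊢
  refine ⟨hD'.1, ?_⟩
  rcases hK D hD D' hD'.1 with h | h
  · exact absurd (hP i hi D hD D' hD'.1 h hD'.2) hiD
  · exact hP j hj D' hD'.1 D hD h hjD

/-! ### Matchings and covers by semi-closedness -/

/-- `N` is a matching on the node sets `L` with respect to the incidence relation `inc` between
node sets and links: every link of `N` joins two different members of `L`, and no member of `L` is
incident to two links of `N`. -/
structure IsMatching (L : Finset (Finset V)) (inc : Finset V → E → Prop) (N : Finset E) : Prop where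
  two : ∀ e ∈ N, ∃ p ∈ L, ∃ q ∈ L, p ≠ q ∧ inc p e ∧ inc q e
  unique : ∀ p ∈ L, ∀ e ∈ N, ∀ e' ∈ N, inc p e → inc p e' → e = e'

/-- `p` is matched by `N`. -/
def Touched (inc : Finset V → E → Prop) (N : Finset E) (p : Finset V) : Prop :=
  ∃ e ∈ N, inc p e

/-- `D` is semi-closed with respect to `N`: no link of `N` joins a member of `L` inside `D` to one
that is not inside, and no link at an unmatched member of `L` inside `D` crosses `D`. -/
def SemiClosed (l : E → V × V) (L : Finset (Finset V)) (inc : Finset V → E → Prop) (N : Finset E)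
    (D : Finset V) : Prop :=
  (∀ e ∈ N, ∀ p ∈ L, ∀ q ∈ L, inc p e → inc q e → p ⊆ D → q ⊆ D) ∧
    ∀ p ∈ L, p ⊆ D → ¬Touched inc N p → ∀ e, inc p e → ¬Crosses l e D

/-- The links of `N` that are incident to a member of `X`. -/
noncomputable def linksAt (inc : Finset V → E → Prop) (N : Finset E) (X : Finset (Finset V)) :
    Finset E :=
  N.filter fun e => ∃ p ∈ X, inc p e

variable {L X : Finset (Finset V)} {inc : Finset V → E → Prop} {N : Finset E}

theorem mem_linksAt : e ∈ linksAt inc N X ↔ e ∈ N ∧ ∃ p ∈ X, inc p e := by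
  simp [linksAt]

theorem IsMatching.insert (hL : (L : Set (Finset V)).Pairwise Disjoint)
    (hinc : ∀ p ∈ L, ∀ e, inc p e → Crosses l e p) (hN : IsMatching L inc N)
    {p q : Finset V} (hp : p ∈ L) (hq : q ∈ L) (hpq : p ≠ q) (hpe : inc p e) (hqe : inc q e)
    (hpt : ¬Touched inc N p) (hqt : ¬Touched inc N q) : IsMatching L inc (insert e N) := by
  have key : ∀ r ∈ L, inc r e → ∀ e' ∈ N, ¬inc r e' := by
    intro r hr hre e' he' hre'
    rcases Crosses.eq_or_eq hL hp hq hr hpq (hinc p hp e hpe) (hinc q hq e hqe)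
      (hinc r hr e hre) with rfl | rfl
    · exact hpt ⟨e', he', hre'⟩
    · exact hqt ⟨e', he', hre'⟩
  refine ⟨fun e' he' => ?_, fun r hr e₁ h₁ e₂ h₂ i₁ i₂ => ?_⟩
  · rcases Finset.mem_insert.1 he' with rfl | he'
    · exact ⟨p, hp, q, hq, hpq, hpe, hqe⟩
    · exact hN.two e' he'
  · rcases Finset.mem_insert.1 h₁ with rfl | h₁ <;> rcases Finset.mem_insert.1 h₂ with rfl | h₂
    · rfl
    · exact absurd i₂ (key r hr i₁ e₂ h₂)
    · exact absurd i₁ (key r hr i₂ e₁ ‹_›)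
    · exact hN.unique r hr e₁ h₁ e₂ h₂ i₁ i₂

theorem IsMatching.exists_maximal [Fintype E]
    (hL : (L : Set (Finset V)).Pairwise Disjoint)
    (hinc : ∀ p ∈ L, ∀ e, inc p e → Crosses l e p)
    {N₀ : Finset E} (h₀ : IsMatching L inc N₀) :
    ∃ N, N₀ ⊆ N ∧ IsMatching L inc N ∧ ∀ e, ∀ p ∈ L, ∀ q ∈ L, p ≠ q → inc p e → inc q e →
      Touched inc N p ∨ Touched inc N q := by
  obtain ⟨N, hN, hmax⟩ := (Finset.univ.filter fun N => N₀ ⊆ N ∧ IsMatching L inc N).exists_max_image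
    Finset.card ⟨N₀, by simp [h₀]⟩
  simp only [Finset.mem_filter, Finset.mem_univ, true_and] at hN hmax
  refine ⟨N, hN.1, hN.2, fun e p hp q hq hpq hpe hqe => ?_⟩
  by_contra! hu
  have heN : e ∉ N := fun he => hu.1 ⟨e, he, hpe⟩
  have h2 := hmax _ ⟨hN.1.trans (Finset.subset_insert _ _),
    hN.2.insert hL hinc hp hq hpq hpe hqe hu.1 hu.2⟩
  rw [Finset.card_insert_of_notMem heN] at h2
  omega

/-- Counting members of `X`: the matched ones come in pairs. -/
theorem IsMatching.card_le (hN : IsMatching L inc N) (hX : X ⊆ L)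
    (hcl : ∀ e ∈ N, ∀ p ∈ X, ∀ q ∈ L, inc p e → inc q e → q ∈ X) :
    2 * (linksAt inc N X).card + (X.filter fun p => ¬Touched inc N p).card ≤ X.card := by
  have hb : ((linksAt inc N X).biUnion fun e => X.filter fun p => inc p e) ⊆
      X.filter fun p => Touched inc N p := by
    intro p hp
    simp only [Finset.mem_biUnion, Finset.mem_filter, mem_linksAt] at hp ⊢
    obtain ⟨e, ⟨he, -⟩, hp, hpe⟩ := hp
    exact ⟨hp, e, he, hpe⟩
  have h1 : 2 * (linksAt inc N X).card ≤
      ((linksAt inc N X).biUnion fun e => X.filter fun p => inc p e).card := by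
    rw [Finset.card_biUnion, mul_comm, ← smul_eq_mul]
    · refine Finset.card_nsmul_le_sum _ _ _ fun e he => ?_
      obtain ⟨heN, r, hr, hre⟩ := mem_linksAt.1 he
      obtain ⟨p, hp, q, hq, hpq, hpe, hqe⟩ := hN.two e heN
      have hp' := hcl e heN r hr p hp hre hpe
      have hq' := hcl e heN r hr q hq hre hqe
      rw [← Finset.card_pair hpq]
      refine Finset.card_le_card fun z hz => ?_
      simp only [Finset.mem_insert, Finset.mem_singleton] at hz
      rcases hz with rfl | rfl <;> simp [*]
    · intro e he e' he' hne
      refine Finset.disjoint_left.2 fun p hp hp' => hne ?_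
      simp only [Finset.mem_filter] at hp hp'
      exact hN.unique p (hX hp.1) e (mem_linksAt.1 he).1 e' (mem_linksAt.1 he').1 hp.2 hp'.2
  have h2 := Finset.card_le_card hb
  have h3 := Finset.card_filter_add_card_filter_not (s := X) (fun p => Touched inc N p)
  omega

/-- The basic cover: if no member of `𝓓` is semi-closed, then the links of the matching `N`,
together with one link for each unmatched leaf that crosses as many sets as possible, cover `𝓓`.
Only leaves of a closed part `X` that contains all leaves below `𝓓` are needed. -/
theorem exists_basic_cover [Fintype E] (hC : Laminar C)
    (hLne : ∀ p ∈ L, p.Nonempty)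
    (hinc : ∀ p ∈ L, ∀ e, inc p e → Crosses l e p)
    (hex : ∀ p ∈ L, ∃ e, inc p e)
    (hN : IsMatching L inc N) (hX : X ⊆ L)
    (hcl : ∀ e ∈ N, ∀ p ∈ X, ∀ q ∈ L, inc p e → inc q e → q ∈ X)
    {𝓓 : Finset (Finset V)} (h𝓓 : 𝓓 ⊆ C)
    (hLD : ∀ p ∈ L, ∀ D ∈ 𝓓, p ⊆ D ∨ Disjoint p D)
    (hXD : ∀ p ∈ L, ∀ D ∈ 𝓓, p ⊆ D → p ∈ X)
    (hsc : ∀ D ∈ 𝓓, ¬SemiClosed l L inc N D) :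
    ∃ J : Finset E, (∀ D ∈ 𝓓, ∃ e ∈ J, Crosses l e D) ∧ (∀ p ∈ X, ∃ e ∈ J, inc p e) ∧
      J.card + (linksAt inc N X).card ≤ X.card := by
  -- the members of `𝓓` around `p` form a chain, so one link at `p` crosses as many as possible
  have hup : ∀ p ∈ L, ∃ e, inc p e ∧
      ∀ e', inc p e' → ∀ D ∈ 𝓓, p ⊆ D → Crosses l e' D → Crosses l e D := by
    intro p hp
    obtain ⟨e, he, h⟩ := exists_weakest_on_chain (s := Finset.univ.filter fun e => inc p e)
      (K := 𝓓.filter fun D => p ⊆ D) (P := fun e D => Crosses l e D)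
      (by obtain ⟨e, he⟩ := hex p hp; exact ⟨e, by simp [he]⟩)
      (by
        intro D hD D' hD'
        simp only [Finset.mem_filter] at hD hD'
        exact hC.nested_of_common (h𝓓 hD.1) (h𝓓 hD'.1) (hLne p hp) hD.2 hD'.2)
      (by
        intro e he D hD D' hD' hDD hc
        simp only [Finset.mem_filter, Finset.mem_univ, true_and] at he hD hD'
        exact (hinc p hp e he).of_nested hc hD.2 hDD)
    simp only [Finset.mem_filter, Finset.mem_univ, true_and] at he h
    exact ⟨e, he, fun e' he' D hD hpD hc => h e' he' D ⟨hD, hpD⟩ hc⟩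
  choose up hupi hupm using hup
  set U := X.filter fun p => ¬Touched inc N p with hU
  have hUL : ∀ p ∈ U, p ∈ L := fun p hp => hX (Finset.mem_filter.1 hp).1
  set J := linksAt inc N X ∪ U.attach.image fun p => up p.1 (hUL p.1 p.2) with hJ
  have hupJ : ∀ p (hp : p ∈ U), up p (hUL p hp) ∈ J := fun p hp =>
    Finset.mem_union_right _ (Finset.mem_image.2 ⟨⟨p, hp⟩, Finset.mem_attach _ _, rfl⟩)
  refine ⟨J, fun D hD => ?_, fun p hp => ?_, ?_⟩
  -- each of the two ways in which `D` fails to be semi-closed provides a link crossing `D`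
  · have h := hsc D hD
    unfold SemiClosed at h
    rw [not_and_or] at h
    push Not at h
    rcases h with ⟨e, he, p, hp, q, hq, hpe, hqe, hpD, hqD⟩ | ⟨p, hp, hpD, hu, e, hpe, hc⟩
    · refine ⟨e, Finset.mem_union_left _ (mem_linksAt.2 ⟨he, p, hXD p hp D hD hpD, hpe⟩), ?_⟩
      exact (hinc p hp e hpe).of_disjoint (hinc q hq e hqe) hpD
        ((hLD q hq D hD).resolve_left hqD)
    · have hpU : p ∈ U := Finset.mem_filter.2 ⟨hXD p hp D hD hpD, hu⟩
      exact ⟨_, hupJ p hpU, hupm p _ e hpe D hD hpD hc⟩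
  · by_cases ht : Touched inc N p
    · obtain ⟨e, he, hpe⟩ := ht
      exact ⟨e, Finset.mem_union_left _ (mem_linksAt.2 ⟨he, p, hp, hpe⟩), hpe⟩
    · have hpU : p ∈ U := Finset.mem_filter.2 ⟨hp, ht⟩
      exact ⟨_, hupJ p hpU, hupi p _⟩
  · have h1 : 2 * (linksAt inc N X).card + U.card ≤ X.card := hN.card_le hX hcl
    have h2 : J.card ≤ (linksAt inc N X).card + U.card :=
      (Finset.card_union_le _ _).trans
        (Nat.add_le_add_left (Finset.card_image_le.trans Finset.card_attach.le) _)
    omega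

end

section

open Finset

variable {V : Type*} {E : Type*}

/-! ### Weights of cuts and demand counting -/

/-- The indicator of the link `e` crossing `D`. -/
noncomputable def crossInd (l : E → V × V) (e : E) (D : Finset V) : ℝ :=
  if Crosses l e D then 1 else 0

/-- The number of ends of the link `e` in `A`. -/
noncomputable def endCount (l : E → V × V) (e : E) (A : Finset V) : ℝ :=
  (if (l e).1 ∈ A then 1 else 0) + (if (l e).2 ∈ A then 1 else 0)

/-- The total weight of the links crossing `D`. -/
noncomputable def cutWeight [Fintype E] (l : E → V × V) (x : E → ℝ) (D : Finset V) : ℝ :=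
  ∑ e, x e * crossInd l e D

/-- The total weight of link ends in `A`; a link with both ends in `A` counts twice. -/
noncomputable def vol [Fintype E] (l : E → V × V) (x : E → ℝ) (A : Finset V) : ℝ :=
  ∑ e, x e * endCount l e A

/-- The nodes of `D` that lie in no leaf. -/
noncomputable def inner (C : Finset (Finset V)) (D : Finset V) : Finset V :=
  D.filter fun v => ∀ p ∈ leaves C, v ∉ p

variable {l : E → V × V} {C : Finset (Finset V)} {e : E}

theorem mem_inner {D : Finset V} {v : V} : v ∈ inner C D ↔ v ∈ D ∧ ∀ p ∈ leaves C, v ∉ p := by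
  simp [inner]

theorem crossInd_nonneg (D : Finset V) : 0 ≤ crossInd l e D := by
  unfold crossInd; split_ifs <;> norm_num

theorem crossInd_of_crosses {D : Finset V} (h : Crosses l e D) : crossInd l e D = 1 := if_pos h

theorem crossInd_of_not {D : Finset V} (h : ¬Crosses l e D) : crossInd l e D = 0 := if_neg h

theorem endCount_nonneg (A : Finset V) : 0 ≤ endCount l e A := by
  unfold endCount; split_ifs <;> norm_num

theorem one_le_endCount_of_fst {A : Finset V} (h : (l e).1 ∈ A) : 1 ≤ endCount l e A := by
  unfold endCount; rw [if_pos h]; split_ifs <;> norm_num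

theorem one_le_endCount_of_snd {A : Finset V} (h : (l e).2 ∈ A) : 1 ≤ endCount l e A := by
  unfold endCount; rw [if_pos h]; split_ifs <;> norm_num

/-- The end of a link inside a set it crosses lies in a leaf, which it then crosses too, or is an
inner node. -/
theorem Crosses.leaf_or_inner {S : Finset V} (hC : Laminar C) (hS : S ∈ C) (h : Crosses l e S) :
    (∃ p ∈ leavesIn C S, Crosses l e p) ∨ 1 ≤ endCount l e (inner C S) := by
  have key : ∀ v ∈ S, (∃ p ∈ leavesIn C S, v ∈ p) ∨ v ∈ inner C S := by
    intro v hv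
    by_cases h : ∃ p ∈ leaves C, v ∈ p
    · obtain ⟨p, hp, hvp⟩ := h
      rcases hC.leaf_subset_or_disjoint hp hS with hs | hd
      · exact Or.inl ⟨p, mem_leavesIn.2 ⟨hp, hs⟩, hvp⟩
      · exact absurd hv (Finset.disjoint_left.1 hd hvp)
    · push Not at h
      exact Or.inr (mem_inner.2 ⟨hv, h⟩)
  rcases h.cases with ⟨h1, h2⟩ | ⟨h1, h2⟩
  · rcases key _ h1 with ⟨p, hp, hv⟩ | hv
    · refine Or.inl ⟨p, hp, ?_⟩
      have : (l e).2 ∉ p := fun h => h2 ((mem_leavesIn.1 hp).2 h)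
      unfold Crosses; tauto
    · exact Or.inr (one_le_endCount_of_fst hv)
  · rcases key _ h1 with ⟨p, hp, hv⟩ | hv
    · refine Or.inl ⟨p, hp, ?_⟩
      have : (l e).1 ∉ p := fun h => h2 ((mem_leavesIn.1 hp).2 h)
      unfold Crosses; tauto
    · exact Or.inr (one_le_endCount_of_snd hv)

/-- A link inside `S` at a leaf `a` has its other end in another leaf or at an inner node. -/
theorem Crosses.other_end {S a : Finset V} (hC : Laminar C) (hS : S ∈ C) (ha : a ∈ leavesIn C S)
    (h : Crosses l e a) (hn : ¬Crosses l e S) :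
    (∃ p ∈ leavesIn C S, p ≠ a ∧ Crosses l e p) ∨ 1 ≤ endCount l e (inner C S) := by
  obtain ⟨haL, haS⟩ := mem_leavesIn.1 ha
  have key : ∀ v ∈ S, v ∉ a → (∃ p ∈ leavesIn C S, p ≠ a ∧ v ∈ p) ∨ v ∈ inner C S := by
    intro v hv hva
    by_cases h : ∃ p ∈ leaves C, v ∈ p
    · obtain ⟨p, hp, hvp⟩ := h
      rcases hC.leaf_subset_or_disjoint hp hS with hs | hd
      · exact Or.inl ⟨p, mem_leavesIn.2 ⟨hp, hs⟩, fun h => hva (h ▸ hvp), hvp⟩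
      · exact absurd hv (Finset.disjoint_left.1 hd hvp)
    · push Not at h
      exact Or.inr (mem_inner.2 ⟨hv, h⟩)
  have dis : ∀ p ∈ leavesIn C S, p ≠ a → ∀ v ∈ a, v ∉ p := fun p hp hne v hv =>
    Finset.disjoint_left.1 (hC.leaf_disjoint haL (mem_leavesIn.1 hp).1 hne.symm) hv
  unfold Crosses at hn
  rw [not_not] at hn
  rcases h.cases with ⟨h1, h2⟩ | ⟨h1, h2⟩
  · rcases key _ (hn.1 (haS h1)) h2 with ⟨p, hp, hne, hv⟩ | hv
    · refine Or.inl ⟨p, hp, hne, ?_⟩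
      have := dis p hp hne _ h1
      unfold Crosses; tauto
    · exact Or.inr (one_le_endCount_of_snd hv)
  · rcases key _ (hn.2 (haS h1)) h2 with ⟨p, hp, hne, hv⟩ | hv
    · refine Or.inl ⟨p, hp, hne, ?_⟩
      have := dis p hp hne _ h1
      unfold Crosses; tauto
    · exact Or.inr (one_le_endCount_of_fst hv)

/-- The position of a node relative to a set with exactly three leaves. -/
theorem mem_or_notMem_of_three_leaves {S u b b' : Finset V} (hC : Laminar C) (hS : S ∈ C)
    (hu : u ∈ leaves C) (hb : b ∈ leaves C) (hb' : b' ∈ leaves C)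
    (hub : u ≠ b) (hub' : u ≠ b') (hbb : b ≠ b')
    (hmem : ∀ p, p ∈ leavesIn C S ↔ p = u ∨ p = b ∨ p = b') (v : V) :
    (v ∈ u ∧ v ∉ b ∧ v ∉ b' ∧ v ∉ inner C S ∧ v ∈ S) ∨
    (v ∉ u ∧ v ∈ b ∧ v ∉ b' ∧ v ∉ inner C S ∧ v ∈ S) ∨
    (v ∉ u ∧ v ∉ b ∧ v ∈ b' ∧ v ∉ inner C S ∧ v ∈ S) ∨
    (v ∉ u ∧ v ∉ b ∧ v ∉ b' ∧ v ∈ inner C S ∧ v ∈ S) ∨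
    (v ∉ u ∧ v ∉ b ∧ v ∉ b' ∧ v ∉ inner C S ∧ v ∉ S) := by
  have d1 : v ∈ u → v ∉ b := fun h => Finset.disjoint_left.1 (hC.leaf_disjoint hu hb hub) h
  have d2 : v ∈ u → v ∉ b' := fun h => Finset.disjoint_left.1 (hC.leaf_disjoint hu hb' hub') h
  have d3 : v ∈ b → v ∉ b' := fun h => Finset.disjoint_left.1 (hC.leaf_disjoint hb hb' hbb) h
  have s1 : v ∈ u → v ∈ S := fun h => (mem_leavesIn.1 ((hmem u).2 (by simp))).2 h
  have s2 : v ∈ b → v ∈ S := fun h => (mem_leavesIn.1 ((hmem b).2 (by simp))).2 h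
  have s3 : v ∈ b' → v ∈ S := fun h => (mem_leavesIn.1 ((hmem b').2 (by simp))).2 h
  have i1 : v ∈ inner C S → v ∈ S ∧ v ∉ u ∧ v ∉ b ∧ v ∉ b' := fun h =>
    ⟨(mem_inner.1 h).1, (mem_inner.1 h).2 u hu, (mem_inner.1 h).2 b hb, (mem_inner.1 h).2 b' hb'⟩
  by_cases c1 : v ∈ u
  · exact Or.inl ⟨c1, d1 c1, d2 c1, fun h => (i1 h).2.1 c1, s1 c1⟩
  by_cases c2 : v ∈ b
  · exact Or.inr (Or.inl ⟨c1, c2, d3 c2, fun h => (i1 h).2.2.1 c2, s2 c2⟩)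
  by_cases c3 : v ∈ b'
  · exact Or.inr (Or.inr (Or.inl ⟨c1, c2, c3, fun h => (i1 h).2.2.2 c3, s3 c3⟩))
  by_cases c4 : v ∈ inner C S
  · exact Or.inr (Or.inr (Or.inr (Or.inl ⟨c1, c2, c3, c4, (i1 c4).1⟩)))
  refine Or.inr (Or.inr (Or.inr (Or.inr ⟨c1, c2, c3, c4, fun h => ?_⟩)))
  have i2 : v ∈ S → v ∉ inner C S → v ∈ u ∨ v ∈ b ∨ v ∈ b' := by
    intro h hn
    by_contra! hne
    refine hn (mem_inner.2 ⟨h, fun p hp hvp => ?_⟩)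
    rcases hC.leaf_subset_or_disjoint hp hS with hs | hd
    · rcases (hmem p).1 (mem_leavesIn.2 ⟨hp, hs⟩) with rfl | rfl | rfl <;> tauto
    · exact Finset.disjoint_left.1 hd hvp h
  rcases i2 h c4 with h | h | h <;> contradiction

variable [Fintype E] {x : E → ℝ}

theorem vol_nonneg (hx : ∀ e, 0 ≤ x e) (A : Finset V) : 0 ≤ vol l x A :=
  Finset.sum_nonneg fun e _ => mul_nonneg (hx e) (endCount_nonneg A)

theorem exists_crosses_of_one_le {D : Finset V} (h : 1 ≤ cutWeight l x D) : ∃ e, Crosses l e D := by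
  by_contra! hne
  have : cutWeight l x D = 0 :=
    Finset.sum_eq_zero fun e _ => by rw [crossInd_of_not (hne e), mul_zero]
  linarith

theorem sum_mul_le_sum_mul (hx : ∀ e, 0 ≤ x e) {f g : E → ℝ} (h : ∀ e, f e ≤ g e) :
    ∑ e, x e * f e ≤ ∑ e, x e * g e :=
  Finset.sum_le_sum fun e _ => mul_le_mul_of_nonneg_left (h e) (hx e)

theorem sum_cutWeight (A : Finset (Finset V)) :
    ∑ p ∈ A, cutWeight l x p = ∑ e, x e * ∑ p ∈ A, crossInd l e p := by
  simp only [cutWeight, Finset.mul_sum]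
  exact Finset.sum_comm

/-- Demand counting: the cut constraints of the leaves `A` and of `S` are served by different links,
and each of these has an end at an inner node of `S` or in a leaf of `S` outside `Q ⊇ A`, provided
that no link joins a leaf of `A` to one of `Q` and no link at a leaf of `Q` leaves `S`. -/
theorem card_add_one_le (hC : Laminar C) (hx : ∀ e, 0 ≤ x e) (hcut : ∀ D ∈ C, 1 ≤ cutWeight l x D)
    {S : Finset V} (hS : S ∈ C) {A Q : Finset (Finset V)} (hAQ : A ⊆ Q) (hQ : Q ⊆ leavesIn C S)
    (hind : ∀ a ∈ A, ∀ q ∈ Q, a ≠ q → ∀ e, Crosses l e a → ¬Crosses l e q)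
    (hcl : ∀ q ∈ Q, ∀ e, Crosses l e q → ¬Crosses l e S) :
    (A.card : ℝ) + 1 ≤ ∑ b ∈ leavesIn C S \ Q, cutWeight l x b + vol l x (inner C S) := by
  -- link by link: a link crosses at most one of the sets of `A` and `S`, and is then seen on the
  -- right
  have hpt : ∀ e, ∑ a ∈ A, crossInd l e a + crossInd l e S ≤
      ∑ b ∈ leavesIn C S \ Q, crossInd l e b + endCount l e (inner C S) := by
    intro e
    have hB0 : 0 ≤ ∑ b ∈ leavesIn C S \ Q, crossInd l e b :=
      Finset.sum_nonneg fun _ _ => crossInd_nonneg _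
    have hB1 : ∀ p ∈ leavesIn C S, p ∉ Q → Crosses l e p →
        1 ≤ ∑ b ∈ leavesIn C S \ Q, crossInd l e b := by
      intro p hp hpQ hc
      rw [← crossInd_of_crosses hc]
      exact Finset.single_le_sum (f := fun b => crossInd l e b) (fun _ _ => crossInd_nonneg _)
        (Finset.mem_sdiff.2 ⟨hp, hpQ⟩)
    have hI0 := endCount_nonneg (l := l) (e := e) (inner C S)
    by_cases hA : ∃ a ∈ A, Crosses l e a
    · obtain ⟨a, ha, hc⟩ := hA
      have hnS := hcl a (hAQ ha) e hc
      rw [Finset.sum_eq_single_of_mem a ha fun b hb hba =>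
        crossInd_of_not (hind a ha b (hAQ hb) hba.symm e hc), crossInd_of_crosses hc,
        crossInd_of_not hnS]
      rcases hc.other_end hC hS (hQ (hAQ ha)) hnS with ⟨p, hp, hne, hcp⟩ | h
      · have := hB1 p hp (fun h => hind a ha p h hne.symm e hc hcp) hcp
        linarith
      · linarith
    · push Not at hA
      rw [Finset.sum_eq_zero fun a ha => crossInd_of_not (hA a ha)]
      by_cases hc : Crosses l e S
      · rw [crossInd_of_crosses hc]
        rcases hc.leaf_or_inner hC hS with ⟨p, hp, hcp⟩ | h
        · have := hB1 p hp (fun h => hcl p h e hcp hc) hcp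
          linarith
        · linarith
      · rw [crossInd_of_not hc]
        linarith
  have h1 := sum_mul_le_sum_mul hx hpt
  simp only [mul_add, Finset.sum_add_distrib] at h1
  rw [← sum_cutWeight, ← sum_cutWeight] at h1
  have h2 : (A.card : ℝ) ≤ ∑ a ∈ A, cutWeight l x a := by
    have := Finset.card_nsmul_le_sum A (fun a => cutWeight l x a) 1 fun a ha =>
      hcut a (leaves_subset (mem_leavesIn.1 (hQ (hAQ ha))).1)
    simpa using this
  have h3 := hcut S hS
  unfold vol
  unfold cutWeight at h3
  linarith

theorem sum_add_le_sum_add (hx : ∀ e, 0 ≤ x e) {D₁ D₂ D₃ A : Finset V}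
    (h : ∀ e, crossInd l e D₁ + crossInd l e D₂ ≤ crossInd l e D₃ + 2 * endCount l e A) :
    cutWeight l x D₁ + cutWeight l x D₂ ≤ cutWeight l x D₃ + 2 * vol l x A := by
  have := sum_mul_le_sum_mul hx h
  simp only [mul_add, Finset.sum_add_distrib, mul_left_comm _ (2 : ℝ), ← Finset.mul_sum] at this
  exact this

/-- If `S` has exactly the leaves `u`, `b`, `b'`, has surplus less than `1/2`, and some set `D` of
the family contains `u` and `b` but not `b'`, then a link joins `u` to `b'` and a link at `b` leaves
`S`. Otherwise the constraints of `D` and of `u`, or of `D` and of `S`, would compete for the links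
at a single leaf. -/
theorem links_of_separating_set (hC : Laminar C) (hx : ∀ e, 0 ≤ x e)
    (hcut : ∀ D ∈ C, 1 ≤ cutWeight l x D) {S u b b' D : Finset V} (hS : S ∈ C)
    (hmem : ∀ p, p ∈ leavesIn C S ↔ p = u ∨ p = b ∨ p = b') (hub : u ≠ b) (hub' : u ≠ b')
    (hbb : b ≠ b') (hu : ∀ e, Crosses l e u → ¬Crosses l e S)
    (hy : cutWeight l x b - 1 + (cutWeight l x b' - 1) + vol l x (inner C S) < 1 / 2)
    (hD : D ∈ C) (huD : u ⊆ D) (hbD : b ⊆ D) (hb'D : ¬b' ⊆ D) :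
    (∃ e, Crosses l e u ∧ Crosses l e b') ∧ ∃ e, Crosses l e b ∧ Crosses l e S := by
  have hLu := mem_leavesIn.1 ((hmem u).2 (by simp))
  have hLb := mem_leavesIn.1 ((hmem b).2 (by simp))
  have hLb' := mem_leavesIn.1 ((hmem b').2 (by simp))
  have hDS : D ⊆ S := by
    rcases hC.nested_of_common hD hS (hC.nonempty u (leaves_subset hLu.1)) huD hLu.2 with h | h
    · exact h
    · exact absurd (hLb'.2.trans h) hb'D
  have hd : Disjoint b' D := (hC.leaf_subset_or_disjoint hLb'.1 hD).resolve_left hb'D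
  have hvol0 : 0 ≤ vol l x (inner C S) := vol_nonneg hx _
  have hdu := hcut u (leaves_subset hLu.1)
  have hdb := hcut b (leaves_subset hLb.1)
  have hdb' := hcut b' (leaves_subset hLb'.1)
  have hdS := hcut S hS
  have hdD := hcut D hD
  have hloc := mem_or_notMem_of_three_leaves hC hS hLu.1 hLb.1 hLb'.1 hub hub' hbb hmem
  -- the six possible positions of a node; the inequalities below are checked on the `36` kinds of
  -- links
  have hD1 : ∀ v,
      (v ∈ u ∧ v ∉ b ∧ v ∉ b' ∧ v ∉ inner C S ∧ v ∈ S ∧ v ∈ D) ∨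
      (v ∉ u ∧ v ∈ b ∧ v ∉ b' ∧ v ∉ inner C S ∧ v ∈ S ∧ v ∈ D) ∨
      (v ∉ u ∧ v ∉ b ∧ v ∈ b' ∧ v ∉ inner C S ∧ v ∈ S ∧ v ∉ D) ∨
      (v ∉ u ∧ v ∉ b ∧ v ∉ b' ∧ v ∈ inner C S ∧ v ∈ S ∧ v ∈ D) ∨
      (v ∉ u ∧ v ∉ b ∧ v ∉ b' ∧ v ∈ inner C S ∧ v ∈ S ∧ v ∉ D) ∨
      (v ∉ u ∧ v ∉ b ∧ v ∉ b' ∧ v ∉ inner C S ∧ v ∉ S ∧ v ∉ D) := by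
    intro v
    rcases hloc v with ⟨h1, h2, h3, h4, h5⟩ | ⟨h1, h2, h3, h4, h5⟩ | ⟨h1, h2, h3, h4, h5⟩ |
      ⟨h1, h2, h3, h4, h5⟩ | ⟨h1, h2, h3, h4, h5⟩
    · exact Or.inl ⟨h1, h2, h3, h4, h5, huD h1⟩
    · exact Or.inr (Or.inl ⟨h1, h2, h3, h4, h5, hbD h2⟩)
    · exact Or.inr (Or.inr (Or.inl ⟨h1, h2, h3, h4, h5, Finset.disjoint_left.1 hd h3⟩))
    · by_cases hv : v ∈ D
      · exact Or.inr (Or.inr (Or.inr (Or.inl ⟨h1, h2, h3, h4, h5, hv⟩)))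
      · exact Or.inr (Or.inr (Or.inr (Or.inr (Or.inl ⟨h1, h2, h3, h4, h5, hv⟩))))
    · exact Or.inr (Or.inr (Or.inr (Or.inr (Or.inr ⟨h1, h2, h3, h4, h5, fun h => h5 (hDS h)⟩))))
  -- the left side is at least `2`, while `cutWeight l x b` plus twice the inner volume is below `2`
  constructor
  · by_contra! hA
    have : cutWeight l x u + cutWeight l x D ≤ cutWeight l x b + 2 * vol l x (inner C S) := by
      refine sum_add_le_sum_add hx fun e => ?_
      have k0 := hu e
      have k1 := hA e
      revert k0 k1
      unfold crossInd endCount Crosses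
      rcases hD1 (l e).1 with ⟨h1, h2, h3, h4, h5, h6⟩ | ⟨h1, h2, h3, h4, h5, h6⟩ |
          ⟨h1, h2, h3, h4, h5, h6⟩ |
        ⟨h1, h2, h3, h4, h5, h6⟩ | ⟨h1, h2, h3, h4, h5, h6⟩ | ⟨h1, h2, h3, h4, h5, h6⟩ <;>
      rcases hD1 (l e).2 with ⟨g1, g2, g3, g4, g5, g6⟩ | ⟨g1, g2, g3, g4, g5, g6⟩ |
          ⟨g1, g2, g3, g4, g5, g6⟩ |
        ⟨g1, g2, g3, g4, g5, g6⟩ | ⟨g1, g2, g3, g4, g5, g6⟩ | ⟨g1, g2, g3, g4, g5, g6⟩ <;>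
      norm_num [h1, h2, h3, h4, h5, h6, g1, g2, g3, g4, g5, g6]
    linarith
  · by_contra! hA
    have : cutWeight l x S + cutWeight l x D ≤ cutWeight l x b' + 2 * vol l x (inner C S) := by
      refine sum_add_le_sum_add hx fun e => ?_
      have k0 := hu e
      have k1 := hA e
      revert k0 k1
      unfold crossInd endCount Crosses
      rcases hD1 (l e).1 with ⟨h1, h2, h3, h4, h5, h6⟩ | ⟨h1, h2, h3, h4, h5, h6⟩ |
          ⟨h1, h2, h3, h4, h5, h6⟩ |
        ⟨h1, h2, h3, h4, h5, h6⟩ | ⟨h1, h2, h3, h4, h5, h6⟩ | ⟨h1, h2, h3, h4, h5, h6⟩ <;>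
      rcases hD1 (l e).2 with ⟨g1, g2, g3, g4, g5, g6⟩ | ⟨g1, g2, g3, g4, g5, g6⟩ |
          ⟨g1, g2, g3, g4, g5, g6⟩ |
        ⟨g1, g2, g3, g4, g5, g6⟩ | ⟨g1, g2, g3, g4, g5, g6⟩ | ⟨g1, g2, g3, g4, g5, g6⟩ <;>
      norm_num [h1, h2, h3, h4, h5, h6, g1, g2, g3, g4, g5, g6]
    linarith

/-- The three-leaf analysis. If `S` has exactly the leaves `u`, `b`, `b'`, no link at `u` leaves `S`
and the surplus at `b`, `b'` and the inner nodes is less than `1/2`, then, up to exchanging `b` and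
`b'`, there is a link joining `u` to `b'`, a link at `b` leaving `S`, and no member of the family
separates `b` from both `u` and `b'`. -/
theorem exists_dangerous_labelling (hC : Laminar C) (hx : ∀ e, 0 ≤ x e)
    (hcut : ∀ D ∈ C, 1 ≤ cutWeight l x D) {S u b b' : Finset V} (hS : S ∈ C)
    (hleaves : leavesIn C S = {u, b, b'}) (hub : u ≠ b) (hub' : u ≠ b') (hbb : b ≠ b')
    (hu : ∀ e, Crosses l e u → ¬Crosses l e S)
    (hy : cutWeight l x b - 1 + (cutWeight l x b' - 1) + vol l x (inner C S) < 1 / 2) :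
    ∃ c c', ((c = b ∧ c' = b') ∨ (c = b' ∧ c' = b)) ∧ (∃ e, Crosses l e u ∧ Crosses l e c') ∧
      (∃ e, Crosses l e c ∧ Crosses l e S) ∧ ∀ D ∈ C, u ⊆ D → c' ⊆ D → c ⊆ D := by
  have hmem : ∀ p, p ∈ leavesIn C S ↔ p = u ∨ p = b ∨ p = b' := by simp [hleaves]
  have hLu := mem_leavesIn.1 ((hmem u).2 (by simp))
  have hLb := mem_leavesIn.1 ((hmem b).2 (by simp))
  have hLb' := mem_leavesIn.1 ((hmem b').2 (by simp))
  have hvol0 : 0 ≤ vol l x (inner C S) := vol_nonneg hx _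
  have hdu := hcut u (leaves_subset hLu.1)
  have hdb := hcut b (leaves_subset hLb.1)
  have hdb' := hcut b' (leaves_subset hLb'.1)
  have hdS := hcut S hS
  have hloc := mem_or_notMem_of_three_leaves hC hS hLu.1 hLb.1 hLb'.1 hub hub' hbb hmem
  -- a member separating one of `b`, `b'` from the other two leaves determines the labelling; the
  -- members around `u` form a chain, so it cannot be violated by another member
  by_cases h1 : ∃ D ∈ C, u ⊆ D ∧ b ⊆ D ∧ ¬b' ⊆ D
  · obtain ⟨D, hD, huD, hbD, hb'D⟩ := h1
    obtain ⟨he1, he2⟩ := links_of_separating_set hC hx hcut hS hmem hub hub' hbb hu hy hD huD hbD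
        hb'D
    refine ⟨b, b', Or.inl ⟨rfl, rfl⟩, he1, he2, fun D' hD' hu' hb' => ?_⟩
    rcases hC.nested_of_common hD hD' (hC.nonempty u (leaves_subset hLu.1)) huD hu' with h | h
    · exact hbD.trans h
    · exact absurd (hb'.trans h) hb'D
  by_cases h2 : ∃ D ∈ C, u ⊆ D ∧ b' ⊆ D ∧ ¬b ⊆ D
  · obtain ⟨D, hD, huD, hbD, hb'D⟩ := h2
    obtain ⟨he1, he2⟩ := links_of_separating_set hC hx hcut hS (by intro p; rw [hmem]; tauto)
      hub' hub hbb.symm hu (by linarith) hD huD hbD hb'D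
    refine ⟨b', b, Or.inr ⟨rfl, rfl⟩, he1, he2, fun D' hD' hu' hb' => ?_⟩
    rcases hC.nested_of_common hD hD' (hC.nonempty u (leaves_subset hLu.1)) huD hu' with h | h
    · exact hbD.trans h
    · exact absurd (hb'.trans h) hb'D
  -- no member separates, so only the two links are in question; if neither labelling has both of
  -- them, the constraints of `u` and `S` are starved in each of the four cases
  push Not at h1 h2
  by_contra hcon
  have hA : ¬((∃ e, Crosses l e u ∧ Crosses l e b') ∧ ∃ e, Crosses l e b ∧ Crosses l e S) :=
    fun h => hcon ⟨b, b', Or.inl ⟨rfl, rfl⟩, h.1, h.2, h2⟩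
  have hB : ¬((∃ e, Crosses l e u ∧ Crosses l e b) ∧ ∃ e, Crosses l e b' ∧ Crosses l e S) :=
    fun h => hcon ⟨b', b, Or.inr ⟨rfl, rfl⟩, h.1, h.2, h1⟩
  rw [not_and_or] at hA hB
  push Not at hA hB
  rcases hA with hA | hA <;> rcases hB with hB | hB
  · have : cutWeight l x u ≤ vol l x (inner C S) := by
      refine sum_mul_le_sum_mul hx fun e => ?_
      have k0 := hu e
      have k1 := hA e
      have k2 := hB e
      revert k0 k1 k2
      unfold crossInd endCount Crosses
      rcases hloc (l e).1 with ⟨h1, h2, h3, h4, h5⟩ | ⟨h1, h2, h3, h4, h5⟩ | ⟨h1, h2, h3, h4, h5⟩ |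
        ⟨h1, h2, h3, h4, h5⟩ | ⟨h1, h2, h3, h4, h5⟩ <;>
      rcases hloc (l e).2 with ⟨g1, g2, g3, g4, g5⟩ | ⟨g1, g2, g3, g4, g5⟩ | ⟨g1, g2, g3, g4, g5⟩ |
        ⟨g1, g2, g3, g4, g5⟩ | ⟨g1, g2, g3, g4, g5⟩ <;>
      norm_num [h1, h2, h3, h4, h5, g1, g2, g3, g4, g5]
    linarith
  · have : cutWeight l x u + cutWeight l x S ≤ cutWeight l x b + 2 * vol l x (inner C S) := by
      refine sum_add_le_sum_add hx fun e => ?_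
      have k0 := hu e
      have k1 := hA e
      have k2 := hB e
      revert k0 k1 k2
      unfold crossInd endCount Crosses
      rcases hloc (l e).1 with ⟨h1, h2, h3, h4, h5⟩ | ⟨h1, h2, h3, h4, h5⟩ | ⟨h1, h2, h3, h4, h5⟩ |
        ⟨h1, h2, h3, h4, h5⟩ | ⟨h1, h2, h3, h4, h5⟩ <;>
      rcases hloc (l e).2 with ⟨g1, g2, g3, g4, g5⟩ | ⟨g1, g2, g3, g4, g5⟩ | ⟨g1, g2, g3, g4, g5⟩ |
        ⟨g1, g2, g3, g4, g5⟩ | ⟨g1, g2, g3, g4, g5⟩ <;>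
      norm_num [h1, h2, h3, h4, h5, g1, g2, g3, g4, g5]
    linarith
  · have : cutWeight l x u + cutWeight l x S ≤ cutWeight l x b' + 2 * vol l x (inner C S) := by
      refine sum_add_le_sum_add hx fun e => ?_
      have k0 := hu e
      have k1 := hA e
      have k2 := hB e
      revert k0 k1 k2
      unfold crossInd endCount Crosses
      rcases hloc (l e).1 with ⟨h1, h2, h3, h4, h5⟩ | ⟨h1, h2, h3, h4, h5⟩ | ⟨h1, h2, h3, h4, h5⟩ |
        ⟨h1, h2, h3, h4, h5⟩ | ⟨h1, h2, h3, h4, h5⟩ <;>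
      rcases hloc (l e).2 with ⟨g1, g2, g3, g4, g5⟩ | ⟨g1, g2, g3, g4, g5⟩ | ⟨g1, g2, g3, g4, g5⟩ |
        ⟨g1, g2, g3, g4, g5⟩ | ⟨g1, g2, g3, g4, g5⟩ <;>
      norm_num [h1, h2, h3, h4, h5, g1, g2, g3, g4, g5]
    linarith
  · have : cutWeight l x S ≤ vol l x (inner C S) := by
      refine sum_mul_le_sum_mul hx fun e => ?_
      have k0 := hu e
      have k1 := hA e
      have k2 := hB e
      revert k0 k1 k2
      unfold crossInd endCount Crosses
      rcases hloc (l e).1 with ⟨h1, h2, h3, h4, h5⟩ | ⟨h1, h2, h3, h4, h5⟩ | ⟨h1, h2, h3, h4, h5⟩ |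
        ⟨h1, h2, h3, h4, h5⟩ | ⟨h1, h2, h3, h4, h5⟩ <;>
      rcases hloc (l e).2 with ⟨g1, g2, g3, g4, g5⟩ | ⟨g1, g2, g3, g4, g5⟩ | ⟨g1, g2, g3, g4, g5⟩ |
        ⟨g1, g2, g3, g4, g5⟩ | ⟨g1, g2, g3, g4, g5⟩ <;>
      norm_num [h1, h2, h3, h4, h5, g1, g2, g3, g4, g5]
    linarith

end

section

open Finset

variable {V : Type*} {E : Type*}

/-! ### Minimal semi-closed sets -/

/-- The incidence relation between leaves and links. -/
def LeafInc (l : E → V × V) (p : Finset V) (e : E) : Prop := Crosses l e p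

/-- A feasible fractional cover `x` of a laminar family `C` together with a matching `M` of links
between leaves, such that no member of the family has exactly the two leaves of a link of `M`. -/
structure MatchedFamily [Fintype E] (l : E → V × V) (x : E → ℝ) (C : Finset (Finset V))
    (M : Finset E) : Prop where
  laminar : Laminar C
  nonneg : ∀ e, 0 ≤ x e
  cut : ∀ D ∈ C, 1 ≤ cutWeight l x D
  matching : IsMatching (leaves C) (LeafInc l) M
  twinFree : ∀ e ∈ M, ∀ p q, p ≠ q → Crosses l e p → Crosses l e q → ∀ D ∈ C, leavesIn C D ≠ {p, q}

/-- The surplus of the fractional cover inside `D`: the weight of link ends at inner nodes, plus the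
excess of the cut weight over `1` at the matched leaves. -/
noncomputable def surplus [Fintype E] (l : E → V × V) (x : E → ℝ) (C : Finset (Finset V))
    (M : Finset E) (D : Finset V) : ℝ :=
  vol l x (inner C D) + ∑ p ∈ (leavesIn C D).filter (Touched (LeafInc l) M), (cutWeight l x p - 1)

variable [Fintype E] {l : E → V × V} {x : E → ℝ} {C : Finset (Finset V)} {M N : Finset E}

/-- `S` can be contracted to a leaf: `S` is not a leaf, no link of `M` leaves it, and the members of
the family strictly inside `S` are covered by the set `J`, whose size leaves one credit unused. The
credits in `S` are `1` per leaf minus `3/10` per link of `M`, plus `3/5` of the surplus. -/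
structure Contractible (l : E → V × V) (x : E → ℝ) (C : Finset (Finset V)) (M : Finset E)
    (S : Finset V) (J : Finset E) : Prop where
  mem : S ∈ C
  notMem_leaves : S ∉ leaves C
  closed : ∀ e ∈ M, ∀ p ∈ leaves C, ∀ q ∈ leaves C, Crosses l e p → Crosses l e q → p ⊆ S → q ⊆ S
  cover : ∀ D ∈ C, D ⊂ S → ∃ e ∈ J, Crosses l e D
  card_add_one_le : (J.card : ℝ) + 1 ≤ (leavesIn C S).card
    - 3 / 10 * (linksAt (LeafInc l) M (leavesIn C S)).card + 3 / 5 * surplus l x C M S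

theorem MatchedFamily.surplus_nonneg (h : MatchedFamily l x C M) (D : Finset V) :
    0 ≤ surplus l x C M D := by
  refine add_nonneg (vol_nonneg h.nonneg _) (Finset.sum_nonneg fun p hp => ?_)
  have := h.cut p (leaves_subset (mem_leavesIn.1 (Finset.mem_filter.1 hp).1).1)
  linarith

theorem MatchedFamily.vol_add_le_surplus (h : MatchedFamily l x C M) {D : Finset V}
    {Q : Finset (Finset V)} (hQ : Q ⊆ leavesIn C D)
    (ht : ∀ p ∈ Q, Touched (LeafInc l) M p) :
    vol l x (inner C D) + ∑ p ∈ Q, (cutWeight l x p - 1) ≤ surplus l x C M D := by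
  refine add_le_add le_rfl (Finset.sum_le_sum_of_subset_of_nonneg
    (fun p hp => Finset.mem_filter.2 ⟨hQ hp, ht p hp⟩) fun p hp _ => ?_)
  have := h.cut p (leaves_subset (mem_leavesIn.1 (Finset.mem_filter.1 hp).1).1)
  linarith

/-- A semi-closed leaf would violate its own cut constraint. -/
theorem MatchedFamily.semiClosed_notMem_leaves (h : MatchedFamily l x C M)
    (hN : IsMatching (leaves C) (LeafInc l) N) {S : Finset V} (hS : S ∈ C)
    (hsc : SemiClosed l (leaves C) (LeafInc l) N S) : S ∉ leaves C := by
  intro hL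
  by_cases ht : Touched (LeafInc l) N S
  · obtain ⟨e, he, hc⟩ := ht
    obtain ⟨p, hp, q, hq, hpq, hpe, hqe⟩ := hN.two e he
    have h1 := (mem_leaves.1 hL).2 p (leaves_subset hp) (hsc.1 e he S hL p hp hc hpe subset_rfl)
    have h2 := (mem_leaves.1 hL).2 q (leaves_subset hq) (hsc.1 e he S hL q hq hc hqe subset_rfl)
    exact hpq (h1.trans h2.symm)
  · obtain ⟨e, he⟩ := exists_crosses_of_one_le (h.cut S hS)
    exact hsc.2 S hL subset_rfl ht e he he

/-- A semi-closed set with exactly three leaves: the two ends `b`, `b'` of a link of `M` and an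
unmatched leaf `u`, and with too small a surplus to be contracted. -/
structure Deficient (l : E → V × V) (x : E → ℝ) (C : Finset (Finset V)) (M N : Finset E)
    (S u b b' : Finset V) : Prop where
  mem : S ∈ C
  semiClosed : SemiClosed l (leaves C) (LeafInc l) N S
  leavesIn_eq : leavesIn C S = {u, b, b'}
  ne₁ : u ≠ b
  ne₂ : u ≠ b'
  ne₃ : b ≠ b'
  not_touched : ¬Touched (LeafInc l) N u
  joined : ∃ g ∈ M, Crosses l g b ∧ Crosses l g b'
  surplus_lt : cutWeight l x b - 1 + (cutWeight l x b' - 1) + vol l x (inner C S) < 1 / 2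

/-- A minimal semi-closed set is contractible or deficient. -/
theorem MatchedFamily.contractible_or_deficient (h : MatchedFamily l x C M) (hMN : M ⊆ N)
    (hN : IsMatching (leaves C) (LeafInc l) N)
    (hmax : ∀ e, ∀ p ∈ leaves C, ∀ q ∈ leaves C, p ≠ q → Crosses l e p → Crosses l e q →
      Touched (LeafInc l) N p ∨ Touched (LeafInc l) N q)
    {S : Finset V} (hS : S ∈ C) (hsc : SemiClosed l (leaves C) (LeafInc l) N S)
    (hmin : ∀ D ∈ C, D ⊂ S → ¬SemiClosed l (leaves C) (LeafInc l) N D) :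
    (∃ J, Contractible l x C M S J) ∨ ∃ u b b', Deficient l x C M N S u b b' := by
  have hC := h.laminar
  set X := leavesIn C S with hX
  have hXL : X ⊆ leaves C := fun p hp => (mem_leavesIn.1 hp).1
  have hcl : ∀ e ∈ N, ∀ p ∈ X, ∀ q ∈ leaves C, LeafInc l p e → LeafInc l q e → q ∈ X :=
    fun e he p hp q hq hpe hqe =>
      mem_leavesIn.2 ⟨hq, hsc.1 e he p (hXL hp) q hq hpe hqe (mem_leavesIn.1 hp).2⟩
  obtain ⟨J, hJ, -, hcard⟩ := exists_basic_cover (𝓓 := C.filter (· ⊂ S)) hC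
    (fun p hp => hC.nonempty p (leaves_subset hp)) (fun p _ e he => he)
    (fun p hp => exists_crosses_of_one_le (h.cut p (leaves_subset hp))) hN hXL hcl
    (Finset.filter_subset _ _)
    (fun p hp D hD => hC.leaf_subset_or_disjoint hp (Finset.mem_filter.1 hD).1)
    (fun p hp D hD hpD => mem_leavesIn.2 ⟨hp, hpD.trans (Finset.mem_filter.1 hD).2.subset⟩)
    (fun D hD => hmin D (Finset.mem_filter.1 hD).1 (Finset.mem_filter.1 hD).2)
  set n := (linksAt (LeafInc l) N X).card with hn
  set m := (linksAt (LeafInc l) M X).card with hm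
  have hsub : linksAt (LeafInc l) M X ⊆ linksAt (LeafInc l) N X := fun e he =>
    mem_linksAt.2 ⟨hMN (mem_linksAt.1 he).1, (mem_linksAt.1 he).2⟩
  have hmn : m ≤ n := Finset.card_le_card hsub
  have hsur := h.surplus_nonneg S
  -- the basic cover saves `n` links against the number of leaves; `S` is contractible if this pays
  -- for the missing credits of the `m` links of `M` and the one credit to be kept
  have good : 1 ≤ (n : ℝ) - 3 / 10 * m + 3 / 5 * surplus l x C M S →
      ∃ J, Contractible l x C M S J := by
    intro hle
    refine ⟨J, hS, h.semiClosed_notMem_leaves hN hS hsc,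
      fun e he p hp q hq => hsc.1 e (hMN he) p hp q hq,
      fun D hD hDS => hJ D (Finset.mem_filter.2 ⟨hD, hDS⟩), ?_⟩
    have : (J.card : ℝ) + n ≤ X.card := by exact_mod_cast hcard
    linarith
  have hmn' : (m : ℝ) ≤ n := by exact_mod_cast hmn
  have htouch : ∀ p ∈ X, Touched (LeafInc l) N p → ∃ e ∈ linksAt (LeafInc l) N X, Crosses l e p :=
    fun p hp ⟨e, he, hc⟩ => ⟨e, mem_linksAt.2 ⟨he, p, hp, hc⟩, hc⟩
  -- the unmatched leaves in `S` are demands that only matched leaves and inner nodes can serve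
  set Q := X.filter fun p => ¬Touched (LeafInc l) N p with hQ
  have hQX : Q ⊆ X := Finset.filter_subset _ _
  have hdem := card_add_one_le hC h.nonneg h.cut hS (Finset.Subset.refl Q) hQX
    (by
      intro a ha q hq hne e hca hcq
      rcases hmax e a (hXL (hQX ha)) q (hXL (hQX hq)) hne hca hcq with ht | ht
      · exact (Finset.mem_filter.1 ha).2 ht
      · exact (Finset.mem_filter.1 hq).2 ht)
    (fun q hq e hc => hsc.2 q (hXL (hQX hq)) (mem_leavesIn.1 (hQX hq)).2
      (Finset.mem_filter.1 hq).2 e hc)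
  -- `2 - 3 / 10 * 2 ≥ 1` settles `n ≥ 2`; for `n = 0` the demands force a surplus of at least `2`
  rcases Nat.lt_or_ge n 2 with hn2 | hn2
  swap
  · left
    apply good
    have : (2 : ℝ) ≤ n := by exact_mod_cast hn2
    linarith
  obtain hn0 | hn1 : n = 0 ∨ n = 1 := by omega
  · left
    apply good
    have hQX' : Q = X := by
      refine Finset.filter_true_of_mem fun p hp ht => ?_
      obtain ⟨e, he, -⟩ := htouch p hp ht
      rw [Finset.card_eq_zero.1 hn0] at he
      simp at he
    rw [hQX', ← hX, Finset.sdiff_self, Finset.sum_empty] at hdem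
    have h1 : 1 ≤ X.card := by
      obtain ⟨p, hp, hpS⟩ := exists_leaf_subset hS
      exact Finset.card_pos.2 ⟨p, mem_leavesIn.2 ⟨hp, hpS⟩⟩
    have h1' : (1 : ℝ) ≤ X.card := by exact_mod_cast h1
    have h2 := h.vol_add_le_surplus (D := S) (Finset.empty_subset _) (by simp)
    rw [Finset.sum_empty] at h2
    have h3 : (m : ℝ) = 0 := by
      have : m = 0 := by omega
      exact_mod_cast this
    rw [h3, hn0]
    push_cast
    linarith
  -- a matched link outside `M` has not spent any credit
  obtain hm0 | hm1 : m = 0 ∨ m = 1 := by omega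
  · left
    apply good
    rw [hn1, hm0]
    push_cast
    linarith
  -- the remaining case: one link `g` of `M`, which needs a surplus of `1 / 2`
  have heq : linksAt (LeafInc l) M X = linksAt (LeafInc l) N X :=
    Finset.eq_of_subset_of_card_le hsub (by omega)
  obtain ⟨g, hg⟩ := Finset.card_eq_one.1 hn1
  have hgN : g ∈ linksAt (LeafInc l) N X := by simp [hg]
  have hgM : g ∈ M := by rw [← heq] at hgN; exact (mem_linksAt.1 hgN).1
  obtain ⟨-, r, hr, hrg⟩ := mem_linksAt.1 hgN
  obtain ⟨b, hb, b', hb', hbb, hgb, hgb'⟩ := h.matching.two g hgM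
  have hbX := hcl g (hMN hgM) r hr b hb hrg hgb
  have hb'X := hcl g (hMN hgM) r hr b' hb' hrg hgb'
  have hXQ : X \ Q = {b, b'} := by
    ext p
    simp only [Finset.mem_sdiff, Finset.mem_insert, Finset.mem_singleton, hQ, Finset.mem_filter,
      not_and, not_not]
    constructor
    · rintro ⟨hp, hpt⟩
      obtain ⟨e, he, hc⟩ := htouch p hp (hpt hp)
      rw [hg, Finset.mem_singleton] at he
      subst he
      exact Crosses.eq_or_eq hC.leaf_pairwise hb hb' (hXL hp) hbb hgb hgb' hc
    · rintro (rfl | rfl)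
      · exact ⟨hbX, fun _ => ⟨g, hMN hgM, hgb⟩⟩
      · exact ⟨hb'X, fun _ => ⟨g, hMN hgM, hgb'⟩⟩
  rw [← hX, hXQ, Finset.sum_pair hbb] at hdem
  have hs2 := h.vol_add_le_surplus (D := S) (Q := {b, b'})
    (by intro p hp; simp only [Finset.mem_insert, Finset.mem_singleton] at hp
        rcases hp with rfl | rfl <;> assumption)
    (by intro p hp; simp only [Finset.mem_insert, Finset.mem_singleton] at hp
        rcases hp with rfl | rfl
        · exact ⟨g, hgM, hgb⟩
        · exact ⟨g, hgM, hgb'⟩)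
  rw [Finset.sum_pair hbb] at hs2
  by_cases hlt : cutWeight l x b - 1 + (cutWeight l x b' - 1) + vol l x (inner C S) < 1 / 2
  swap
  · left
    apply good
    rw [hn1, hm1]
    push_cast
    linarith
  right
  -- with less surplus, demand counting leaves at most one unmatched leaf, and twin-freeness exactly
  -- one
  have hQ2 : Q.card < 2 := by
    by_contra! hge
    have : (2 : ℝ) ≤ Q.card := by exact_mod_cast hge
    linarith
  have hXeq : X = Q ∪ {b, b'} := by rw [← hXQ, Finset.union_sdiff_of_subset hQX]
  obtain hQ0 | hQ1 : Q.card = 0 ∨ Q.card = 1 := by omega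
  · rw [Finset.card_eq_zero.1 hQ0, Finset.empty_union] at hXeq
    exact absurd hXeq (h.twinFree g hgM b b' hbb hgb hgb' S hS)
  · obtain ⟨u, hu⟩ := Finset.card_eq_one.1 hQ1
    have huQ : u ∈ Q := by simp [hu]
    have hut := (Finset.mem_filter.1 huQ).2
    refine ⟨u, b, b', hS, hsc, ?_, ?_, ?_, hbb, hut, ⟨g, hgM, hgb, hgb'⟩, hlt⟩
    · rw [← hX, hXeq, hu]; rfl
    · rintro rfl; exact hut ⟨g, hMN hgM, hgb⟩
    · rintro rfl; exact hut ⟨g, hMN hgM, hgb'⟩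

end

section

open Finset

variable {V : Type*} {E : Type*}

/-! ### Contracting the deficient sets -/

/-- A deficient set `T` with leaves `u`, `c`, `c'`, where `c`, `c'` are joined by a link of `M`, in
which that link may be exchanged for one joining `u` and `c'`: then `c` becomes unmatched and has a
link leaving `T`. Moreover `c` has a link leaving every larger set with the same leaves and little
surplus. -/
structure Exchangeable [Fintype E] (l : E → V × V) (x : E → ℝ) (C : Finset (Finset V))
    (M N : Finset E) (T u c c' : Finset V) : Prop where
  mem : T ∈ C
  semiClosed : SemiClosed l (leaves C) (LeafInc l) N T
  leavesIn_eq : leavesIn C T = {u, c, c'}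
  ne₁ : u ≠ c
  ne₂ : u ≠ c'
  ne₃ : c ≠ c'
  not_touched : ¬Touched (LeafInc l) N u
  joined : ∃ g ∈ M, Crosses l g c ∧ Crosses l g c'
  link : ∃ e, Crosses l e u ∧ Crosses l e c'
  leaving : ∃ e, Crosses l e c ∧ Crosses l e T
  separated : ∀ D ∈ C, u ⊆ D → c' ⊆ D → c ⊆ D
  reach : ∀ D ∈ C, T ⊆ D → leavesIn C D = {u, c, c'} →
    cutWeight l x c - 1 + (cutWeight l x c' - 1) + vol l x (inner C D) < 1 / 2 →
    ∃ e, Crosses l e c ∧ Crosses l e D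

/-- The leaves that lie in no member of `𝓣`. -/
noncomputable def outerLeaves (C 𝓣 : Finset (Finset V)) : Finset (Finset V) :=
  (leaves C).filter fun p => ∀ T ∈ 𝓣, ¬p ⊆ T

/-- The leaves after contracting each member of `𝓣` to a single leaf. -/
noncomputable def superLeaves (C 𝓣 : Finset (Finset V)) : Finset (Finset V) :=
  𝓣 ∪ outerLeaves C 𝓣

/-- Incidence of links with contracted leaves: for a contracted set `T ∈ 𝓣` only the links that
leave `T` from its leaf `c T` count. -/
def SuperInc (l : E → V × V) (𝓣 : Finset (Finset V)) (c : Finset V → Finset V) (p : Finset V)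
    (e : E) : Prop :=
  Crosses l e p ∧ (p ∈ 𝓣 → Crosses l e (c p))

/-- The members of `C` that are not strictly inside a member of `𝓣`. -/
noncomputable def superFamily (C 𝓣 : Finset (Finset V)) : Finset (Finset V) :=
  C.filter fun D => ∀ T ∈ 𝓣, ¬D ⊂ T

variable {l : E → V × V} {x : E → ℝ} {C 𝓣 : Finset (Finset V)} {M N : Finset E}
  {u c c' : Finset V → Finset V}

theorem mem_outerLeaves {p : Finset V} :
    p ∈ outerLeaves C 𝓣 ↔ p ∈ leaves C ∧ ∀ T ∈ 𝓣, ¬p ⊆ T := by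
  simp [outerLeaves]

theorem mem_superLeaves {p : Finset V} : p ∈ superLeaves C 𝓣 ↔ p ∈ 𝓣 ∨ p ∈ outerLeaves C 𝓣 := by
  simp [superLeaves]

theorem mem_superFamily {D : Finset V} : D ∈ superFamily C 𝓣 ↔ D ∈ C ∧ ∀ T ∈ 𝓣, ¬D ⊂ T := by
  simp [superFamily]

theorem superInc_of_outer {p : Finset V} {e : E} (hp : p ∈ outerLeaves C 𝓣) :
    SuperInc l 𝓣 c p e ↔ Crosses l e p :=
  ⟨fun h => h.1, fun h => ⟨h, fun hT => absurd subset_rfl ((mem_outerLeaves.1 hp).2 p hT)⟩⟩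

theorem leaf_cases {p : Finset V} (hp : p ∈ leaves C) :
    p ∈ outerLeaves C 𝓣 ∨ ∃ T ∈ 𝓣, p ⊆ T := by
  by_cases h : ∃ T ∈ 𝓣, p ⊆ T
  · exact Or.inr h
  · push Not at h
    exact Or.inl (mem_outerLeaves.2 ⟨hp, h⟩)

variable [Fintype E]

/-- `𝓣` consists of pairwise disjoint exchangeable sets, with leaves labelled by `u`, `c`, `c'`, and
every semi-closed set contains one of them. -/
structure Blocked (l : E → V × V) (x : E → ℝ) (C : Finset (Finset V)) (M N : Finset E)
    (𝓣 : Finset (Finset V)) (u c c' : Finset V → Finset V) : Prop where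
  exchangeable : ∀ T ∈ 𝓣, Exchangeable l x C M N T (u T) (c T) (c' T)
  disjoint : (𝓣 : Set (Finset V)).Pairwise Disjoint
  exists_subset : ∀ S ∈ C, SemiClosed l (leaves C) (LeafInc l) N S → ∃ T ∈ 𝓣, T ⊆ S

/-- The three-leaf analysis labels the ends of the matched link of a deficient set. -/
theorem Deficient.exists_exchangeable (h : MatchedFamily l x C M) {T u b b' : Finset V}
    (hd : Deficient l x C M N T u b b') : ∃ c c', Exchangeable l x C M N T u c c' := by
  have hC := h.laminar
  have hmem : ∀ p, p ∈ leavesIn C T ↔ p = u ∨ p = b ∨ p = b' := by simp [hd.leavesIn_eq]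
  have hLu := mem_leavesIn.1 ((hmem u).2 (by simp))
  have hLb := mem_leavesIn.1 ((hmem b).2 (by simp))
  have hLb' := mem_leavesIn.1 ((hmem b').2 (by simp))
  have hu : ∀ D, T ⊆ D → ∀ e, Crosses l e u → ¬Crosses l e D := fun D hTD e hc hc' =>
    hd.semiClosed.2 u hLu.1 hLu.2 hd.not_touched e hc (hc.of_nested hc' hLu.2 hTD)
  -- the labellings that are valid for `T`; each of them also serves larger sets
  set s : Finset (Finset V × Finset V) := ({(b, b'), (b', b)} : Finset _).filter fun i =>
    (∃ e, Crosses l e u ∧ Crosses l e i.2) ∧ (∃ e, Crosses l e i.1 ∧ Crosses l e T) ∧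
      ∀ D ∈ C, u ⊆ D → i.2 ⊆ D → i.1 ⊆ D with hs
  have hsT : ∀ i ∈ s, i.1 ⊆ T := by
    intro i hi
    have := (Finset.mem_filter.1 hi).1
    simp only [Finset.mem_insert, Finset.mem_singleton] at this
    rcases this with rfl | rfl
    · exact hLb.2
    · exact hLb'.2
  have hkey : ∀ D ∈ C, T ⊆ D → leavesIn C D = {u, b, b'} →
      cutWeight l x b - 1 + (cutWeight l x b' - 1) + vol l x (inner C D) < 1 / 2 →
      ∃ i ∈ s, ∃ e, Crosses l e i.1 ∧ Crosses l e D := by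
    intro D hD hTD hleaf hlt
    obtain ⟨a, a', haa, h1, h2, h3⟩ := exists_dangerous_labelling hC h.nonneg h.cut hD hleaf hd.ne₁
      hd.ne₂ hd.ne₃ (hu D hTD) hlt
    have haT : a ⊆ T := by rcases haa with ⟨rfl, rfl⟩ | ⟨rfl, rfl⟩; exacts [hLb.2, hLb'.2]
    refine ⟨(a, a'), Finset.mem_filter.2 ⟨?_, h1, ?_, h3⟩, h2⟩
    · rcases haa with ⟨rfl, rfl⟩ | ⟨rfl, rfl⟩ <;> simp
    · obtain ⟨e, he1, he2⟩ := h2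
      exact ⟨e, he1, he1.of_nested he2 haT hTD⟩
  have hsne : s.Nonempty := by
    obtain ⟨i, hi, -⟩ := hkey T hd.mem subset_rfl hd.leavesIn_eq hd.surplus_lt
    exact ⟨i, hi⟩
  -- among the valid labellings, take the one whose unmatched leaf has the farthest reaching links
  obtain ⟨i, hi, hmax⟩ := exists_weakest_on_chain hsne (K := C.filter fun D => T ⊆ D)
    (P := fun i D => ∃ e, Crosses l e i.1 ∧ Crosses l e D)
    (by
      intro D hD D' hD'
      simp only [Finset.mem_filter] at hD hD'
      exact hC.nested_of_common hD.1 hD'.1 (hC.nonempty T hd.mem) hD.2 hD'.2)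
    (by
      rintro j hj D hD D' hD' hDD ⟨e, h1, h2⟩
      exact ⟨e, h1, h1.of_nested h2 ((hsT j hj).trans (Finset.mem_filter.1 hD).2) hDD⟩)
  obtain ⟨c, c'⟩ := i
  obtain ⟨hi1, hi2, hi3, hi4⟩ := Finset.mem_filter.1 hi
  have hcc : (c = b ∧ c' = b') ∨ (c = b' ∧ c' = b) := by
    simpa [Prod.ext_iff] using hi1
  have hset : ({u, c, c'} : Finset (Finset V)) = {u, b, b'} := by
    rcases hcc with ⟨rfl, rfl⟩ | ⟨rfl, rfl⟩
    · rfl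
    · rw [Finset.pair_comm]
  refine ⟨c, c', hd.mem, hd.semiClosed, by rw [hset, hd.leavesIn_eq], ?_, ?_, ?_, hd.not_touched,
    ?_, hi2, hi3, hi4, fun D hD hTD hleaf hlt => ?_⟩
  · rcases hcc with ⟨rfl, rfl⟩ | ⟨rfl, rfl⟩; exacts [hd.ne₁, hd.ne₂]
  · rcases hcc with ⟨rfl, rfl⟩ | ⟨rfl, rfl⟩; exacts [hd.ne₂, hd.ne₁]
  · rcases hcc with ⟨rfl, rfl⟩ | ⟨rfl, rfl⟩; exacts [hd.ne₃, hd.ne₃.symm]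
  · obtain ⟨g, hg, h1, h2⟩ := hd.joined
    rcases hcc with ⟨rfl, rfl⟩ | ⟨rfl, rfl⟩; exacts [⟨g, hg, h1, h2⟩, ⟨g, hg, h2, h1⟩]
  · obtain ⟨j, hj, hP⟩ := hkey D hD hTD (hleaf.trans hset)
      (by rcases hcc with ⟨rfl, rfl⟩ | ⟨rfl, rfl⟩ <;> linarith)
    exact hmax j hj D (Finset.mem_filter.2 ⟨hD, hTD⟩) hP

/-- If nothing is contractible, the minimal semi-closed sets are all exchangeable. -/
theorem MatchedFamily.exists_blocked (h : MatchedFamily l x C M) (hMN : M ⊆ N)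
    (hN : IsMatching (leaves C) (LeafInc l) N)
    (hmax : ∀ e, ∀ p ∈ leaves C, ∀ q ∈ leaves C, p ≠ q → Crosses l e p → Crosses l e q →
      Touched (LeafInc l) N p ∨ Touched (LeafInc l) N q)
    (hno : ∀ S J, ¬Contractible l x C M S J) : ∃ 𝓣 u c c', Blocked l x C M N 𝓣 u c c' := by
  set 𝓣 := C.filter fun S => SemiClosed l (leaves C) (LeafInc l) N S ∧
    ∀ D ∈ C, D ⊂ S → ¬SemiClosed l (leaves C) (LeafInc l) N D with h𝓣
  have hex : ∀ T ∈ 𝓣, ∃ u c c', Exchangeable l x C M N T u c c' := by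
    intro T hT
    obtain ⟨hTC, hsc, hmin⟩ := Finset.mem_filter.1 hT
    rcases h.contractible_or_deficient hMN hN hmax hTC hsc hmin with ⟨J, hJ⟩ | ⟨u, b, b', hd⟩
    · exact absurd hJ (hno T J)
    · exact ⟨u, hd.exists_exchangeable h⟩
  choose! u c c' hl using hex
  refine ⟨𝓣, u, c, c', hl, fun T hT T' hT' hne => ?_, fun S hS hsc => ?_⟩
  · obtain ⟨hTC, hsc, hmin⟩ := Finset.mem_filter.1 hT
    obtain ⟨hTC', hsc', hmin'⟩ := Finset.mem_filter.1 hT'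
    rcases h.laminar.nested T hTC T' hTC' with h1 | h1 | h1
    · exact absurd hsc (hmin' T hTC (h1.ssubset_of_ne hne))
    · exact absurd hsc' (hmin T' hTC' (h1.ssubset_of_ne hne.symm))
    · exact h1
  · obtain ⟨T, hTS, ⟨hTC, hsc'⟩, hmin⟩ := exists_minimal_subset
      (P := fun S => S ∈ C ∧ SemiClosed l (leaves C) (LeafInc l) N S) ⟨hS, hsc⟩
    exact ⟨T, Finset.mem_filter.2 ⟨hTC, hsc', fun D hD hDT hd => hmin D hDT ⟨hD, hd⟩⟩, hTS⟩

theorem Blocked.superLeaf_nested (hB : Blocked l x C M N 𝓣 u c c') (hC : Laminar C)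
    {p D : Finset V} (hp : p ∈ superLeaves C 𝓣) (hD : D ∈ superFamily C 𝓣) :
    p ⊆ D ∨ Disjoint p D := by
  obtain ⟨hDC, hDT⟩ := mem_superFamily.1 hD
  rcases mem_superLeaves.1 hp with hT | ho
  · rcases hC.nested p (hB.exchangeable p hT).mem D hDC with h | h | h
    · exact Or.inl h
    · by_cases heq : D = p
      · exact Or.inl heq.ge
      · exact absurd (h.ssubset_of_ne heq) (hDT p hT)
    · exact Or.inr h
  · exact hC.leaf_subset_or_disjoint (mem_outerLeaves.1 ho).1 hDC

theorem Blocked.superLeaves_pairwise (hB : Blocked l x C M N 𝓣 u c c') (hC : Laminar C) :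
    (superLeaves C 𝓣 : Set (Finset V)).Pairwise Disjoint := by
  have key : ∀ T ∈ 𝓣, ∀ p ∈ outerLeaves C 𝓣, Disjoint p T := fun T hT p hp =>
    (hC.leaf_subset_or_disjoint (mem_outerLeaves.1 hp).1 (hB.exchangeable T hT).mem).resolve_left
      ((mem_outerLeaves.1 hp).2 T hT)
  intro p hp q hq hne
  rcases mem_superLeaves.1 hp with h1 | h1 <;> rcases mem_superLeaves.1 hq with h2 | h2
  · exact hB.disjoint h1 h2 hne
  · exact (key p h1 q h2).symm
  · exact key q h2 p h1
  · exact hC.leaf_disjoint (mem_outerLeaves.1 h1).1 (mem_outerLeaves.1 h2).1 hne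

/-- A link of `N` at a leaf outside `𝓣` has both its leaves outside `𝓣`. -/
theorem Blocked.outer_of_outer (hB : Blocked l x C M N 𝓣 u c c') {e : E} (he : e ∈ N)
    {p q : Finset V} (hp : p ∈ outerLeaves C 𝓣) (hq : q ∈ leaves C) (hpe : Crosses l e p)
    (hqe : Crosses l e q) : q ∈ outerLeaves C 𝓣 :=
  mem_outerLeaves.2 ⟨hq, fun T hT hqT => (mem_outerLeaves.1 hp).2 T hT
    ((hB.exchangeable T hT).semiClosed.1 e he q hq p (mem_outerLeaves.1 hp).1 hqe hpe hqT)⟩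

/-- The links of `N` outside `𝓣` form a matching on the contracted leaves. -/
theorem Blocked.isMatching_outer (hB : Blocked l x C M N 𝓣 u c c') (hC : Laminar C)
    (hN : IsMatching (leaves C) (LeafInc l) N) :
    IsMatching (superLeaves C 𝓣) (SuperInc l 𝓣 c)
      (linksAt (LeafInc l) N (outerLeaves C 𝓣)) := by
  have htwo : ∀ e ∈ linksAt (LeafInc l) N (outerLeaves C 𝓣), ∃ p ∈ outerLeaves C 𝓣,
      ∃ q ∈ outerLeaves C 𝓣, p ≠ q ∧ Crosses l e p ∧ Crosses l e q := by
    intro e he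
    obtain ⟨heN, r, hr, hre⟩ := mem_linksAt.1 he
    obtain ⟨p, hp, q, hq, hpq, hpe, hqe⟩ := hN.two e heN
    exact ⟨p, hB.outer_of_outer heN hr hp hre hpe, q, hB.outer_of_outer heN hr hq hre hqe, hpq,
      hpe, hqe⟩
  refine ⟨fun e he => ?_, fun r hr e he e' he' hre hre' => ?_⟩
  · obtain ⟨p, hp, q, hq, hpq, hpe, hqe⟩ := htwo e he
    exact ⟨p, mem_superLeaves.2 (Or.inr hp), q, mem_superLeaves.2 (Or.inr hq), hpq,
      (superInc_of_outer hp).2 hpe, (superInc_of_outer hq).2 hqe⟩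
  · obtain ⟨p, hp, q, hq, hpq, hpe, hqe⟩ := htwo e he
    have hro : r ∈ outerLeaves C 𝓣 := by
      rcases Crosses.eq_or_eq (hB.superLeaves_pairwise hC) (mem_superLeaves.2 (Or.inr hp))
        (mem_superLeaves.2 (Or.inr hq)) hr hpq hpe hqe hre.1 with rfl | rfl
      · exact hp
      · exact hq
    exact hN.unique r (mem_outerLeaves.1 hro).1 e (mem_linksAt.1 he).1 e' (mem_linksAt.1 he').1
      hre.1 hre'.1

end

section

open Finset

variable {V : Type*} {E : Type*}

variable [Fintype E] {l : E → V × V} {x : E → ℝ} {C 𝓣 : Finset (Finset V)} {M N N₂ : Finset E}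
  {u c c' : Finset V → Finset V}

/-- The basic cover after contraction, lifted back: each contracted set `T` in the region `S` is
paid for by one more link, the one joining `u T` to `c' T`. Together with a link at `c T` that
leaves `T` it covers everything strictly inside `T`. -/
theorem Blocked.exists_cover (hB : Blocked l x C M N 𝓣 u c c') (h : MatchedFamily l x C M)
    (hMN : M ⊆ N)
    (hN₂ : IsMatching (superLeaves C 𝓣) (SuperInc l 𝓣 c) N₂)
    (hsub : linksAt (LeafInc l) N (outerLeaves C 𝓣) ⊆ N₂) {S : Finset V}
    (hS𝓣 : ∀ T ∈ 𝓣, T ⊆ S ∨ Disjoint T S)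
    (hcl : ∀ e ∈ N₂, ∀ p ∈ superLeaves C 𝓣, ∀ q ∈ superLeaves C 𝓣, SuperInc l 𝓣 c p e →
      SuperInc l 𝓣 c q e → p ⊆ S → q ⊆ S)
    {𝓓 : Finset (Finset V)} (h𝓓 : 𝓓 ⊆ superFamily C 𝓣) (h𝓓S : ∀ D ∈ 𝓓, D ⊆ S)
    (hsc : ∀ D ∈ 𝓓, ¬SemiClosed l (superLeaves C 𝓣) (SuperInc l 𝓣 c) N₂ D) :
    ∃ J : Finset E, (∀ D ∈ 𝓓, ∃ e ∈ J, Crosses l e D) ∧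
      (∀ T ∈ 𝓣, T ⊆ S → ∀ D ∈ C, D ⊂ T → ∃ e ∈ J, Crosses l e D) ∧
      J.card + (𝓣.filter (· ⊆ S)).card +
        (linksAt (SuperInc l 𝓣 c) N₂ ((superLeaves C 𝓣).filter (· ⊆ S))).card ≤
          (leavesIn C S).card ∧
      (linksAt (LeafInc l) M (leavesIn C S)).card ≤ (𝓣.filter (· ⊆ S)).card +
        (linksAt (SuperInc l 𝓣 c) N₂ ((superLeaves C 𝓣).filter (· ⊆ S))).card := by
  have hC := h.laminar
  have hexS : ∀ p ∈ superLeaves C 𝓣, ∃ e, SuperInc l 𝓣 c p e := by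
    intro p hp
    rcases mem_superLeaves.1 hp with hT | ho
    · obtain ⟨e, h1, h2⟩ := (hB.exchangeable p hT).leaving
      exact ⟨e, h2, fun _ => h1⟩
    · obtain ⟨e, he⟩ := exists_crosses_of_one_le (h.cut p (leaves_subset (mem_outerLeaves.1 ho).1))
      exact ⟨e, (superInc_of_outer ho).2 he⟩
  have hne : ∀ p ∈ superLeaves C 𝓣, p.Nonempty := by
    intro p hp
    rcases mem_superLeaves.1 hp with hT | ho
    · exact hC.nonempty p (hB.exchangeable p hT).mem
    · exact hC.nonempty p (leaves_subset (mem_outerLeaves.1 ho).1)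
  obtain ⟨J₂, hJ₂, hJX, hcard⟩ := exists_basic_cover (𝓓 := 𝓓)
    (X := (superLeaves C 𝓣).filter (· ⊆ S)) hC hne
    (fun p _ e he => he.1) hexS hN₂ (Finset.filter_subset _ _)
    (fun e he p hp q hq hpe hqe => Finset.mem_filter.2
      ⟨hq, hcl e he p (Finset.mem_filter.1 hp).1 q hq hpe hqe (Finset.mem_filter.1 hp).2⟩)
    (h𝓓.trans (Finset.filter_subset _ _))
    (fun p hp D hD => hB.superLeaf_nested hC hp (h𝓓 hD))
    (fun p hp D hD hpD => Finset.mem_filter.2 ⟨hp, hpD.trans (h𝓓S D hD)⟩) hsc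
  set 𝓣S := 𝓣.filter (· ⊆ S) with h𝓣S
  have hlink : ∀ T ∈ 𝓣S, ∃ e, Crosses l e (u T) ∧ Crosses l e (c' T) :=
    fun T hT => (hB.exchangeable T (Finset.mem_filter.1 hT).1).link
  have hjoin : ∀ T ∈ 𝓣S, ∃ g ∈ M, Crosses l g (c T) ∧ Crosses l g (c' T) :=
    fun T hT => (hB.exchangeable T (Finset.mem_filter.1 hT).1).joined
  -- `k T` joins `u T` to `c' T`; `g T` is the link of `M` inside `T`
  choose k hk using hlink
  choose g hgM hg using hjoin
  set K := 𝓣S.attach.image fun T => k T.1 T.2 with hK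
  have hKcard : K.card ≤ 𝓣S.card := Finset.card_image_le.trans Finset.card_attach.le
  set A := (outerLeaves C 𝓣).filter (· ⊆ S) with hA
  set X := (superLeaves C 𝓣).filter (· ⊆ S) with hX
  have hXcard : X.card ≤ 𝓣S.card + A.card := by
    have : X = 𝓣S ∪ A := by rw [hX, superLeaves, Finset.filter_union]
    rw [this]
    exact Finset.card_union_le _ _
  have hLmem : ∀ T ∈ 𝓣, ∀ p, p ∈ leavesIn C T ↔ p = u T ∨ p = c T ∨ p = c' T := by
    intro T hT p
    simp [(hB.exchangeable T hT).leavesIn_eq]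
  -- three leaves of each contracted set are replaced by one, and one more link is spent on it
  have hLcard : A.card + 3 * 𝓣S.card ≤ (leavesIn C S).card := by
    have h1 : A ∪ 𝓣S.biUnion (leavesIn C) ⊆ leavesIn C S := by
      intro p hp
      rcases Finset.mem_union.1 hp with hp | hp
      · obtain ⟨hp1, hp2⟩ := Finset.mem_filter.1 hp
        exact mem_leavesIn.2 ⟨(mem_outerLeaves.1 hp1).1, hp2⟩
      · obtain ⟨T, hT, hpT⟩ := Finset.mem_biUnion.1 hp
        obtain ⟨h1, h2⟩ := mem_leavesIn.1 hpT
        exact mem_leavesIn.2 ⟨h1, h2.trans (Finset.mem_filter.1 hT).2⟩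
    have h2 : Disjoint A (𝓣S.biUnion (leavesIn C)) := by
      refine Finset.disjoint_left.2 fun p hp hp' => ?_
      obtain ⟨T, hT, hpT⟩ := Finset.mem_biUnion.1 hp'
      exact (mem_outerLeaves.1 (Finset.mem_filter.1 hp).1).2 T (Finset.mem_filter.1 hT).1
        (mem_leavesIn.1 hpT).2
    have h3 : (𝓣S.biUnion (leavesIn C)).card = 𝓣S.card * 3 := by
      rw [Finset.card_biUnion]
      · refine Finset.sum_const_nat fun T hT => ?_
        have hx := hB.exchangeable T (Finset.mem_filter.1 hT).1
        rw [hx.leavesIn_eq, Finset.card_insert_of_notMem (by simp [hx.ne₁, hx.ne₂]),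
          Finset.card_pair hx.ne₃]
      · intro T hT T' hT' hne
        refine Finset.disjoint_left.2 fun p hp hp' => ?_
        obtain ⟨v, hv⟩ := hC.nonempty p (leaves_subset (mem_leavesIn.1 hp).1)
        exact Finset.disjoint_left.1 (hB.disjoint (Finset.mem_filter.1 hT).1
          (Finset.mem_filter.1 hT').1 hne) ((mem_leavesIn.1 hp).2 hv) ((mem_leavesIn.1 hp').2 hv)
    have h4 := Finset.card_le_card h1
    rw [Finset.card_union_of_disjoint h2, h3] at h4
    omega
  refine ⟨J₂ ∪ K, fun D hD => ?_, fun T hT hTS D hD hDT => ?_, ?_, ?_⟩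
  · obtain ⟨e, he, hc⟩ := hJ₂ D hD
    exact ⟨e, Finset.mem_union_left _ he, hc⟩
  · have hTX : T ∈ X := Finset.mem_filter.2 ⟨mem_superLeaves.2 (Or.inl hT), hTS⟩
    have hT𝓣S : T ∈ 𝓣S := Finset.mem_filter.2 ⟨hT, hTS⟩
    have hex := hB.exchangeable T hT
    have hLc := mem_leavesIn.1 ((hLmem T hT (c T)).2 (by simp))
    have hLc' := mem_leavesIn.1 ((hLmem T hT (c' T)).2 (by simp))
    have hLu := mem_leavesIn.1 ((hLmem T hT (u T)).2 (by simp))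
    obtain ⟨e, heJ, he1, he2⟩ := hJX T hTX
    -- either `D` is crossed by the link that leaves `T` from `c T`, or it contains exactly one of
    -- `u T`, `c' T`
    by_cases hcD : c T ⊆ D
    · exact ⟨e, Finset.mem_union_left _ heJ, (he2 hT).of_nested he1 hcD hDT.subset⟩
    · refine ⟨k T hT𝓣S, Finset.mem_union_right _
        (Finset.mem_image.2 ⟨⟨T, hT𝓣S⟩, Finset.mem_attach _ _, rfl⟩), ?_⟩
      obtain ⟨hk1, hk2⟩ := hk T hT𝓣S
      obtain ⟨p, hp, hpD⟩ := exists_leaf_subset hD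
      rcases (hLmem T hT p).1 (mem_leavesIn.2 ⟨hp, hpD.trans hDT.subset⟩) with rfl | rfl | rfl
      · refine hk1.of_disjoint hk2 hpD ((hC.leaf_subset_or_disjoint hLc'.1 hD).resolve_left ?_)
        exact fun h' => hcD (hex.separated D hD hpD h')
      · exact absurd hpD hcD
      · refine hk2.of_disjoint hk1 hpD ((hC.leaf_subset_or_disjoint hLu.1 hD).resolve_left ?_)
        exact fun h' => hcD (hex.separated D hD h' hpD)
  · have := Finset.card_union_le J₂ K
    omega
  -- a link of `M` is the matched link of a contracted set or survives in `N₂`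
  · have hsubm : linksAt (LeafInc l) M (leavesIn C S) ⊆
        𝓣S.attach.image (fun T => g T.1 T.2) ∪ linksAt (SuperInc l 𝓣 c) N₂ X := by
      intro e he
      obtain ⟨heM, p, hp, hpe⟩ := mem_linksAt.1 he
      obtain ⟨hpL, hpS⟩ := mem_leavesIn.1 hp
      rcases leaf_cases (𝓣 := 𝓣) hpL with ho | ⟨T, hT, hpT⟩
      · refine Finset.mem_union_right _ (mem_linksAt.2 ⟨hsub (mem_linksAt.2
          ⟨hMN heM, p, ho, hpe⟩), p,
          Finset.mem_filter.2 ⟨mem_superLeaves.2 (Or.inr ho), hpS⟩, (superInc_of_outer ho).2 hpe⟩)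
      · have hTS : T ⊆ S := by
          refine (hS𝓣 T hT).resolve_right fun hd => ?_
          obtain ⟨v, hv⟩ := hC.nonempty p (leaves_subset hpL)
          exact Finset.disjoint_left.1 hd (hpT hv) (hpS hv)
        have hT𝓣S : T ∈ 𝓣S := Finset.mem_filter.2 ⟨hT, hTS⟩
        refine Finset.mem_union_left _ (Finset.mem_image.2 ⟨⟨T, hT𝓣S⟩, Finset.mem_attach _ _, ?_⟩)
        rcases (hLmem T hT p).1 (mem_leavesIn.2 ⟨hpL, hpT⟩) with rfl | rfl | rfl
        · exact absurd ⟨e, hMN heM, hpe⟩ (hB.exchangeable T hT).not_touched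
        · exact h.matching.unique _ hpL _ (hgM T hT𝓣S) e heM (hg T hT𝓣S).1 hpe
        · exact h.matching.unique _ hpL _ (hgM T hT𝓣S) e heM (hg T hT𝓣S).2 hpe
    have h1 := Finset.card_le_card hsubm
    have h2 := Finset.card_union_le (𝓣S.attach.image fun T => g T.1 T.2)
      (linksAt (SuperInc l 𝓣 c) N₂ X)
    have h3 : (𝓣S.attach.image fun T => g T.1 T.2).card ≤ 𝓣S.card :=
      Finset.card_image_le.trans Finset.card_attach.le
    omega

/-- A set that is semi-closed after contraction contains a contracted set: otherwise it would
already have been semi-closed before. -/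
theorem Blocked.exists_contracted_subset (hB : Blocked l x C M N 𝓣 u c c') (hC : Laminar C)
    (hmax : ∀ e, ∀ p ∈ leaves C, ∀ q ∈ leaves C, p ≠ q → Crosses l e p → Crosses l e q →
      Touched (LeafInc l) N p ∨ Touched (LeafInc l) N q)
    (hN₂ : IsMatching (superLeaves C 𝓣) (SuperInc l 𝓣 c) N₂)
    (hsub : linksAt (LeafInc l) N (outerLeaves C 𝓣) ⊆ N₂) {S : Finset V}
    (hS : S ∈ superFamily C 𝓣)
    (hsc : SemiClosed l (superLeaves C 𝓣) (SuperInc l 𝓣 c) N₂ S) : ∃ T ∈ 𝓣, T ⊆ S := by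
  have hSC := (mem_superFamily.1 hS).1
  by_contra! hno
  have hdis : ∀ T ∈ 𝓣, Disjoint T S := fun T hT =>
    (hB.superLeaf_nested hC (mem_superLeaves.2 (Or.inl hT)) hS).resolve_left (hno T hT)
  have hout : ∀ p ∈ leaves C, p ⊆ S → p ∈ outerLeaves C 𝓣 := by
    intro p hp hpS
    refine mem_outerLeaves.2 ⟨hp, fun T hT hpT => ?_⟩
    obtain ⟨v, hv⟩ := hC.nonempty p (leaves_subset hp)
    exact Finset.disjoint_left.1 (hdis T hT) (hpT hv) (hpS hv)
  obtain ⟨T, hT, hTS⟩ := hB.exists_subset S hSC (by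
    refine ⟨fun e he p hp q hq hpe hqe hpS => ?_, fun p hp hpS hnt e hpe => ?_⟩
    · have ho := hout p hp hpS
      have hoq := hB.outer_of_outer he ho hq hpe hqe
      exact hsc.1 e (hsub (mem_linksAt.2 ⟨he, p, ho, hpe⟩)) p (mem_superLeaves.2 (Or.inr ho)) q
        (mem_superLeaves.2 (Or.inr hoq)) ((superInc_of_outer ho).2 hpe)
        ((superInc_of_outer hoq).2 hqe) hpS
    · have ho := hout p hp hpS
      by_cases ht : Touched (SuperInc l 𝓣 c) N₂ p
      · -- a link of `N₂` at `p` would join two leaves unmatched by the maximal matching `N`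
        exfalso
        obtain ⟨e', he', hpe'⟩ := ht
        obtain ⟨q, hq, hqp, hqe'⟩ : ∃ q ∈ superLeaves C 𝓣, q ≠ p ∧ SuperInc l 𝓣 c q e' := by
          obtain ⟨q, hq, r, hr, hqr, hqe, hre⟩ := hN₂.two e' he'
          by_cases hqp : q = p
          · exact ⟨r, hr, fun hrp => hqr (hqp.trans hrp.symm), hre⟩
          · exact ⟨q, hq, hqp, hqe⟩
        have hqS := hsc.1 e' he' p (mem_superLeaves.2 (Or.inr ho)) q hq hpe' hqe' hpS
        have hqo : q ∈ outerLeaves C 𝓣 :=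
          (mem_superLeaves.1 hq).resolve_left fun hT => hno q hT hqS
        rcases hmax e' p hp q (mem_outerLeaves.1 hqo).1 hqp.symm hpe'.1 hqe'.1 with h1 | h1
        · exact hnt h1
        · obtain ⟨f, hf, hqf⟩ := h1
          have hfe := hN₂.unique q hq f (hsub (mem_linksAt.2 ⟨hf, q, hqo, hqf⟩)) e' he'
            ((superInc_of_outer hqo).2 hqf) hqe'
          exact hnt ⟨f, hf, by rw [hfe]; exact hpe'.1⟩
      · exact hsc.2 p (mem_superLeaves.2 (Or.inr ho)) hpS ht e ((superInc_of_outer ho).2 hpe))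
  exact hno T hT hTS

/-- A minimal semi-closed set after contraction is contractible. -/
theorem Blocked.contractible (hB : Blocked l x C M N 𝓣 u c c') (h : MatchedFamily l x C M)
    (hMN : M ⊆ N)
    (hmax : ∀ e, ∀ p ∈ leaves C, ∀ q ∈ leaves C, p ≠ q → Crosses l e p → Crosses l e q →
      Touched (LeafInc l) N p ∨ Touched (LeafInc l) N q)
    (hN₂ : IsMatching (superLeaves C 𝓣) (SuperInc l 𝓣 c) N₂)
    (hsub : linksAt (LeafInc l) N (outerLeaves C 𝓣) ⊆ N₂)
    (hmax₂ : ∀ e, ∀ p ∈ superLeaves C 𝓣, ∀ q ∈ superLeaves C 𝓣, p ≠ q → SuperInc l 𝓣 c p e →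
      SuperInc l 𝓣 c q e → Touched (SuperInc l 𝓣 c) N₂ p ∨ Touched (SuperInc l 𝓣 c) N₂ q)
    {S : Finset V} (hS : S ∈ superFamily C 𝓣)
    (hsc : SemiClosed l (superLeaves C 𝓣) (SuperInc l 𝓣 c) N₂ S)
    (hmin : ∀ D ∈ superFamily C 𝓣, D ⊂ S →
      ¬SemiClosed l (superLeaves C 𝓣) (SuperInc l 𝓣 c) N₂ D) : ∃ J, Contractible l x C M S J := by
  have hC := h.laminar
  have hSC := (mem_superFamily.1 hS).1
  have hS𝓣 : ∀ T ∈ 𝓣, T ⊆ S ∨ Disjoint T S := fun T hT =>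
    hB.superLeaf_nested hC (mem_superLeaves.2 (Or.inl hT)) hS
  have hsubS : ∀ T ∈ 𝓣, ∀ D ∈ C, D ⊆ T → D ⊆ S → T ⊆ S := by
    intro T hT D hD hDT hDS
    refine (hS𝓣 T hT).resolve_right fun hd => ?_
    obtain ⟨v, hv⟩ := hC.nonempty D hD
    exact Finset.disjoint_left.1 hd (hDT hv) (hDS hv)
  obtain ⟨J, hJ1, hJ2, hJ3, hJ4⟩ := hB.exists_cover h hMN hN₂ hsub hS𝓣 hsc.1
    (𝓓 := (superFamily C 𝓣).filter (· ⊂ S)) (Finset.filter_subset _ _)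
    (fun D hD => (Finset.mem_filter.1 hD).2.subset)
    (fun D hD => hmin D (Finset.mem_filter.1 hD).1 (Finset.mem_filter.1 hD).2)
  obtain ⟨T, hT, hTS⟩ := hB.exists_contracted_subset hC hmax hN₂ hsub hS hsc
  have hex := hB.exchangeable T hT
  have hLmem : ∀ p, p ∈ leavesIn C T ↔ p = u T ∨ p = c T ∨ p = c' T := by
    simp [hex.leavesIn_eq]
  have hLu := mem_leavesIn.1 ((hLmem (u T)).2 (by simp))
  have hLc := mem_leavesIn.1 ((hLmem (c T)).2 (by simp))
  have hLc' := mem_leavesIn.1 ((hLmem (c' T)).2 (by simp))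
  set X := (superLeaves C 𝓣).filter (· ⊆ S) with hX
  set k := (𝓣.filter (· ⊆ S)).card with hk
  set n := (linksAt (SuperInc l 𝓣 c) N₂ X).card with hn
  set m := (linksAt (LeafInc l) M (leavesIn C S)).card with hm
  refine ⟨J, hSC, fun hL => ?_, fun e he p hp q hq hpe hqe hpS => ?_, fun D hD hDS => ?_, ?_⟩
  · have h1 := (mem_leaves.1 hL).2 (u T) (leaves_subset hLu.1) (hLu.2.trans hTS)
    have h2 := (mem_leaves.1 hL).2 (c T) (leaves_subset hLc.1) (hLc.2.trans hTS)
    exact hex.ne₁ (h1.trans h2.symm)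
  · rcases leaf_cases (𝓣 := 𝓣) hp with ho | ⟨T', hT', hpT⟩
    · have hoq := hB.outer_of_outer (hMN he) ho hq hpe hqe
      exact hsc.1 e (hsub (mem_linksAt.2 ⟨hMN he, p, ho, hpe⟩)) p (mem_superLeaves.2 (Or.inr ho)) q
        (mem_superLeaves.2 (Or.inr hoq)) ((superInc_of_outer ho).2 hpe)
        ((superInc_of_outer hoq).2 hqe) hpS
    · have hTS' := hsubS T' hT' p (leaves_subset hp) hpT hpS
      exact ((hB.exchangeable T' hT').semiClosed.1 e (hMN he) p hp q hq hpe hqe hpT).trans hTS'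
  · by_cases hDF : D ∈ superFamily C 𝓣
    · exact hJ1 D (Finset.mem_filter.2 ⟨hDF, hDS⟩)
    · rw [mem_superFamily] at hDF
      push Not at hDF
      obtain ⟨T', hT', hDT⟩ := hDF hD
      exact hJ2 T' hT' (hsubS T' hT' D hD hDT.subset hDS.subset) D hD hDT
  · have hJ3' : (J.card : ℝ) + k + n ≤ (leavesIn C S).card := by exact_mod_cast hJ3
    have hJ4' : (m : ℝ) ≤ k + n := by exact_mod_cast hJ4
    have hsur := h.surplus_nonneg S
    have hk1 : 1 ≤ k := Finset.card_pos.2 ⟨T, Finset.mem_filter.2 ⟨hT, hTS⟩⟩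
    -- `J` saves `k + n` links, and `m ≤ k + n`, so that `k + n ≥ 2` suffices
    rcases Nat.lt_or_ge (k + n) 2 with hlt | hge
    swap
    · have : (2 : ℝ) ≤ k + n := by exact_mod_cast hge
      linarith
    have hkeq : k = 1 := by omega
    have hneq : n = 0 := by omega
    suffices 1 / 2 ≤ surplus l x C M S by
      rw [hkeq, hneq] at hJ3' hJ4'
      push_cast at hJ3' hJ4'
      linarith
    -- only one contracted set and no matched link: the surplus comes from demand counting
    have hTuniq : ∀ T' ∈ 𝓣, T' ⊆ S → T' = T := by
      obtain ⟨T₀, hT₀⟩ := Finset.card_eq_one.1 hkeq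
      have key : ∀ T' ∈ 𝓣, T' ⊆ S → T' = T₀ := fun T' hT' hTS' => by
        have : T' ∈ 𝓣.filter (· ⊆ S) := Finset.mem_filter.2 ⟨hT', hTS'⟩
        rwa [hT₀, Finset.mem_singleton] at this
      exact fun T' hT' hTS' => (key T' hT' hTS').trans (key T hT hTS).symm
    have hnt : ∀ p ∈ superLeaves C 𝓣, p ⊆ S → ¬Touched (SuperInc l 𝓣 c) N₂ p := by
      rintro p hp hpS ⟨e, he, hpe⟩
      have : e ∈ linksAt (SuperInc l 𝓣 c) N₂ X :=
        mem_linksAt.2 ⟨he, p, Finset.mem_filter.2 ⟨hp, hpS⟩, hpe⟩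
      rw [Finset.card_eq_zero.1 hneq] at this
      simp at this
    have hTL : T ∈ superLeaves C 𝓣 := mem_superLeaves.2 (Or.inl hT)
    set A := (outerLeaves C 𝓣).filter (· ⊆ S) with hA
    have hAmem : ∀ a ∈ A, a ∈ outerLeaves C 𝓣 ∧ a ⊆ S ∧ a ∈ leaves C ∧ a ∈ superLeaves C 𝓣 :=
      fun a ha => ⟨(Finset.mem_filter.1 ha).1, (Finset.mem_filter.1 ha).2,
        (mem_outerLeaves.1 (Finset.mem_filter.1 ha).1).1,
        mem_superLeaves.2 (Or.inr (Finset.mem_filter.1 ha).1)⟩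
    have hLS : ∀ p, p ∈ leavesIn C S ↔ p ∈ A ∨ p = u T ∨ p = c T ∨ p = c' T := by
      intro p
      constructor
      · intro hp
        obtain ⟨hpL, hpS⟩ := mem_leavesIn.1 hp
        rcases leaf_cases (𝓣 := 𝓣) hpL with ho | ⟨T', hT', hpT⟩
        · exact Or.inl (Finset.mem_filter.2 ⟨ho, hpS⟩)
        · have := hTuniq T' hT' (hsubS T' hT' p (leaves_subset hpL) hpT hpS)
          subst this
          exact Or.inr ((hLmem p).1 (mem_leavesIn.2 ⟨hpL, hpT⟩))
      · rintro (ha | hp)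
        · exact mem_leavesIn.2 ⟨(hAmem p ha).2.2.1, (hAmem p ha).2.1⟩
        · obtain ⟨h1, h2⟩ := mem_leavesIn.1 ((hLmem p).2 hp)
          exact mem_leavesIn.2 ⟨h1, h2.trans hTS⟩
    -- `T` is an unmatched contracted leaf of the semi-closed set `S`
    have hcS : ∀ e, Crosses l e (c T) → ¬Crosses l e S := by
      intro e hc hcS
      have hcT : Crosses l e T := hc.of_nested hcS hLc.2 hTS
      exact hsc.2 T hTL hTS (hnt T hTL hTS) e ⟨hcT, fun _ => hc⟩ hcS
    have huS : ∀ e, Crosses l e (u T) → ¬Crosses l e S := by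
      intro e hc hcS
      exact hex.semiClosed.2 (u T) hLu.1 hLu.2 hex.not_touched e hc (hc.of_nested hcS hLu.2 hTS)
    have hAT : ∀ a ∈ A, Disjoint a T := fun a ha =>
      (hC.leaf_subset_or_disjoint (hAmem a ha).2.2.1 hex.mem).resolve_left
        ((mem_outerLeaves.1 (hAmem a ha).1).2 T hT)
    have hAN : ∀ a ∈ A, ¬Touched (LeafInc l) N a := by
      rintro a ha ⟨e, he, hc⟩
      exact hnt a (hAmem a ha).2.2.2 (hAmem a ha).2.1 ⟨e, hsub (mem_linksAt.2 ⟨he, a,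
          (hAmem a ha).1,
        hc⟩), (superInc_of_outer (hAmem a ha).1).2 hc⟩
    set Q := A ∪ {u T, c T} with hQ
    have hQmem : ∀ q, q ∈ Q ↔ q ∈ A ∨ q = u T ∨ q = c T := by
      intro q
      simp only [hQ, Finset.mem_union, Finset.mem_insert, Finset.mem_singleton]
    have hQX : Q ⊆ leavesIn C S := by
      intro q hq
      rw [hLS]
      rcases (hQmem q).1 hq with h1 | h1 | h1 <;> tauto
    -- only `c' T` and the inner nodes can serve the demands of `A` and `S`
    have hdem := card_add_one_le hC h.nonneg h.cut hSC Finset.subset_union_left hQX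
      (by
        intro a ha q hq hne e hca hcq
        have hia := (superInc_of_outer (l := l) (c := c) (hAmem a ha).1).2 hca
        rcases (hQmem q).1 hq with h1 | rfl | rfl
        · rcases hmax₂ e a (hAmem a ha).2.2.2 q (hAmem q h1).2.2.2 hne hia
            ((superInc_of_outer (hAmem q h1).1).2 hcq) with ht | ht
          · exact hnt a (hAmem a ha).2.2.2 (hAmem a ha).2.1 ht
          · exact hnt q (hAmem q h1).2.2.2 (hAmem q h1).2.1 ht
        · rcases hmax e a (hAmem a ha).2.2.1 _ hLu.1 hne hca hcq with ht | ht
          · exact hAN a ha ht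
          · exact hex.not_touched ht
        · have hcT : Crosses l e T := hcq.of_disjoint hca hLc.2 (hAT a ha)
          have haT : a ≠ T := by
            rintro rfl
            exact (mem_outerLeaves.1 (hAmem _ ha).1).2 _ hT subset_rfl
          rcases hmax₂ e a (hAmem a ha).2.2.2 T hTL haT hia ⟨hcT, fun _ => hcq⟩ with ht | ht
          · exact hnt a (hAmem a ha).2.2.2 (hAmem a ha).2.1 ht
          · exact hnt T hTL hTS ht)
      (by
        intro q hq e hc
        rcases (hQmem q).1 hq with h1 | rfl | rfl
        · exact hsc.2 q (hAmem q h1).2.2.2 (hAmem q h1).2.1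
            (hnt q (hAmem q h1).2.2.2 (hAmem q h1).2.1) e ((superInc_of_outer (hAmem q h1).1).2 hc)
        · exact huS e hc
        · exact hcS e hc)
    have hd' := h.cut (c' T) (leaves_subset hLc'.1)
    have hsum : ∑ b ∈ leavesIn C S \ Q, cutWeight l x b ≤ cutWeight l x (c' T) := by
      rw [← Finset.sum_singleton (fun b => cutWeight l x b) (c' T)]
      refine Finset.sum_le_sum_of_subset_of_nonneg (fun p hp => ?_) fun p hp _ => ?_
      · obtain ⟨h1, h2⟩ := Finset.mem_sdiff.1 hp
        rw [hQmem] at h2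
        rw [Finset.mem_singleton]
        rcases (hLS p).1 h1 with h3 | h3 | h3 | h3 <;> tauto
      · rw [Finset.mem_singleton.1 hp]
        linarith
    obtain ⟨g, hgM, hg1, hg2⟩ := hex.joined
    have hs2 := h.vol_add_le_surplus (D := S) (Q := {c T, c' T})
      (by
        intro p hp
        rw [hLS]
        simp only [Finset.mem_insert, Finset.mem_singleton] at hp
        tauto)
      (by
        intro p hp
        simp only [Finset.mem_insert, Finset.mem_singleton] at hp
        rcases hp with rfl | rfl
        · exact ⟨g, hgM, hg1⟩
        · exact ⟨g, hgM, hg2⟩)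
    rw [Finset.sum_pair hex.ne₃] at hs2
    have hdc := h.cut (c T) (leaves_subset hLc.1)
    by_contra! hlt2
    -- with a surplus below `1 / 2` the set `S` has the same leaves as `T`, so a link at `c T`
    -- reaches beyond `S`
    have hA0 : A.card = 0 := by
      by_contra hne
      have : (1 : ℝ) ≤ A.card := by exact_mod_cast Nat.one_le_iff_ne_zero.2 hne
      linarith
    have hleaf : leavesIn C S = {u T, c T, c' T} := by
      ext p
      rw [hLS, Finset.card_eq_zero.1 hA0]
      simp
    obtain ⟨e, he1, he2⟩ := hex.reach S hSC hTS hleaf (by linarith)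
    exact hcS e he1 he2

end

section

open Finset

variable {V : Type*} {E : Type*}

variable [Fintype E] {l : E → V × V} {x : E → ℝ} {C : Finset (Finset V)} {M : Finset E}

/-! ### Induction by contraction -/

/-- Either some set can be contracted or there is a cover cheap enough to end the induction. -/
theorem MatchedFamily.cover_or_contractible [Fintype V] (h : MatchedFamily l x C M) :
    (∃ J : Finset E, (∀ D ∈ C, ∃ e ∈ J, Crosses l e D) ∧ J.card + M.card ≤ (leaves C).card) ∨
      ∃ S J, Contractible l x C M S J := by
  have hC := h.laminar
  by_contra! hcon
  obtain ⟨hno1, hno⟩ := hcon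
  obtain ⟨N, hMN, hN, hmax⟩ := IsMatching.exists_maximal hC.leaf_pairwise (fun _ _ _ he => he)
    h.matching
  obtain ⟨𝓣, u, c, c', hB⟩ := h.exists_blocked hMN hN hmax hno
  -- everything deficient: contract the minimal semi-closed sets and repeat the argument once
  obtain ⟨N₂, hsub, hN₂, hmax₂⟩ := IsMatching.exists_maximal (hB.superLeaves_pairwise hC)
    (fun _ _ _ he => he.1) (hB.isMatching_outer hC hN)
  by_cases hsc : ∃ S ∈ superFamily C 𝓣, SemiClosed l (superLeaves C 𝓣) (SuperInc l 𝓣 c) N₂ S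
  · obtain ⟨S, hS, hsc⟩ := hsc
    obtain ⟨S', -, ⟨hS', hsc'⟩, hmin⟩ := exists_minimal_subset
      (P := fun S => S ∈ superFamily C 𝓣 ∧
        SemiClosed l (superLeaves C 𝓣) (SuperInc l 𝓣 c) N₂ S) ⟨hS, hsc⟩
    obtain ⟨J, hJ⟩ := hB.contractible h hMN hmax hN₂ hsub hmax₂ hS' hsc'
      (fun D hD hDS hd => hmin D hDS ⟨hD, hd⟩)
    exact hno S' J hJ
  · push Not at hsc
    obtain ⟨J, h1, h2, h3, h4⟩ := hB.exists_cover h hMN hN₂ hsub (S := Finset.univ)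
      (fun T _ => Or.inl (Finset.subset_univ T)) (fun _ _ _ _ q _ _ _ _ => Finset.subset_univ q)
      (Finset.Subset.refl _) (fun D _ => Finset.subset_univ D) hsc
    have hL : leavesIn C Finset.univ = leaves C := by ext p; simp [mem_leavesIn]
    have hM : linksAt (LeafInc l) M (leaves C) = M := by
      refine Finset.filter_true_of_mem fun e he => ?_
      obtain ⟨p, hp, -, -, -, hpe, -⟩ := h.matching.two e he
      exact ⟨p, hp, hpe⟩
    rw [hL, hM] at h4
    rw [hL] at h3
    refine absurd (hno1 J fun D hD => ?_) (by omega)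
    by_cases hDF : D ∈ superFamily C 𝓣
    · exact h1 D hDF
    · rw [mem_superFamily] at hDF
      push Not at hDF
      obtain ⟨T, hT, hDT⟩ := hDF hD
      exact h2 T hT (Finset.subset_univ T) D hD hDT

/-- The family after contracting `S` to a leaf. -/
noncomputable def contract (C : Finset (Finset V)) (S : Finset V) : Finset (Finset V) :=
  C.filter fun D => ¬D ⊂ S

theorem contract_subset {S : Finset V} : contract C S ⊆ C := Finset.filter_subset _ _

theorem mem_leaves_contract (hC : Laminar C) {S p : Finset V} (hS : S ∈ C) :
    p ∈ leaves (contract C S) ↔ (p ∈ leaves C ∧ ¬p ⊆ S) ∨ p = S := by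
  have hmem : ∀ D, D ∈ contract C S ↔ D ∈ C ∧ ¬D ⊂ S := by simp [contract]
  constructor
  · intro hp
    obtain ⟨hp1, hp2⟩ := mem_leaves.1 hp
    obtain ⟨hpC, hpS⟩ := (hmem p).1 hp1
    by_cases heq : p = S
    · exact Or.inr heq
    refine Or.inl ⟨mem_leaves.2 ⟨hpC, fun D hD hDp => ?_⟩, fun hs => hpS (hs.ssubset_of_ne heq)⟩
    by_cases hDS : D ⊂ S
    · rcases hC.nested_of_common hpC hS (hC.nonempty D hD) hDp hDS.subset with h1 | h1
      · exact absurd (h1.ssubset_of_ne heq) hpS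
      · exact absurd (hp2 S ((hmem S).2 ⟨hS, fun h => h.ne rfl⟩) h1).symm heq
    · exact hp2 D ((hmem D).2 ⟨hD, hDS⟩) hDp
  · rintro (⟨hp, hpS⟩ | rfl)
    · obtain ⟨hp1, hp2⟩ := mem_leaves.1 hp
      exact mem_leaves.2 ⟨(hmem p).2 ⟨hp1, fun h => hpS h.subset⟩, fun D hD hDp =>
        hp2 D ((hmem D).1 hD).1 hDp⟩
    · refine mem_leaves.2 ⟨(hmem p).2 ⟨hS, fun h => h.ne rfl⟩, fun D hD hDp => ?_⟩
      by_contra hne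
      exact ((hmem D).1 hD).2 (hDp.ssubset_of_ne hne)

theorem vol_add_vol_le (hx : ∀ e, 0 ≤ x e) {A B D : Finset V} (hAB : Disjoint A B) (hA : A ⊆ D)
    (hB : B ⊆ D) : vol l x A + vol l x B ≤ vol l x D := by
  unfold vol
  rw [← Finset.sum_add_distrib]
  refine Finset.sum_le_sum fun e _ => ?_
  rw [← mul_add]
  refine mul_le_mul_of_nonneg_left ?_ (hx e)
  have key : ∀ v, ((if v ∈ A then 1 else 0 : ℝ) + if v ∈ B then 1 else 0) ≤
      if v ∈ D then 1 else 0 := by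
    intro v
    have h1 : v ∈ A → v ∉ B := fun h => Finset.disjoint_left.1 hAB h
    have h2 : v ∈ A → v ∈ D := fun h => hA h
    have h3 : v ∈ B → v ∈ D := fun h => hB h
    by_cases a : v ∈ A
    · simp [a, h1 a, h2 a]
    · by_cases b : v ∈ B
      · simp [a, b, h3 b]
      · simp only [a, b, if_false]
        split_ifs <;> norm_num
  have k1 := key (l e).1
  have k2 := key (l e).2
  unfold endCount
  linarith

/-- Every matched family has a cover paid for by its credits. -/
theorem MatchedFamily.exists_cover [Fintype V] (h : MatchedFamily l x C M) :
    ∃ J : Finset E, (∀ D ∈ C, ∃ e ∈ J, Crosses l e D) ∧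
      (J.card : ℝ) ≤ (leaves C).card - 3 / 10 * M.card + 3 / 5 * surplus l x C M Finset.univ := by
  induction hn : C.card using Nat.strong_induction_on generalizing C M with
  | _ n ih =>
  have hC := h.laminar
  rcases h.cover_or_contractible with ⟨J, hJ, hcard⟩ | ⟨S, J, hSJ⟩
  · refine ⟨J, hJ, ?_⟩
    have h1 : (J.card : ℝ) + M.card ≤ (leaves C).card := by exact_mod_cast hcard
    have h2 := h.surplus_nonneg Finset.univ
    have h3 : (0 : ℝ) ≤ M.card := Nat.cast_nonneg _
    linarith
  have hS := hSJ.mem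
  have hL' := fun p => mem_leaves_contract (p := p) hC hS
  set C' := contract C S with hC'def
  have hC'mem : ∀ D, D ∈ C' ↔ D ∈ C ∧ ¬D ⊂ S := by simp [hC'def, contract]
  have hC' : Laminar C' := hC.mono contract_subset
  have hlt : C'.card < C.card := by
    obtain ⟨p, hp, hpS⟩ := exists_leaf_subset hS
    have hne : p ≠ S := fun h => hSJ.notMem_leaves (h ▸ hp)
    refine Finset.card_lt_card ((Finset.ssubset_iff_of_subset contract_subset).2
      ⟨p, leaves_subset hp, fun h => ((hC'mem p).1 h).2 (hpS.ssubset_of_ne hne)⟩)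
  set X := leavesIn C S with hX
  -- `S` becomes an unmatched leaf, since no link of `M` leaves it
  set M' := M \ linksAt (LeafInc l) M X with hM'def
  have hM'M : M' ⊆ M := Finset.sdiff_subset
  have htwo : ∀ e ∈ M', ∃ p, ∃ q, p ≠ q ∧ (p ∈ leaves C ∧ ¬p ⊆ S) ∧ (q ∈ leaves C ∧ ¬q ⊆ S) ∧
      Crosses l e p ∧ Crosses l e q := by
    intro e he
    obtain ⟨heM, hen⟩ := Finset.mem_sdiff.1 he
    obtain ⟨p, hp, q, hq, hpq, hpe, hqe⟩ := h.matching.two e heM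
    refine ⟨p, q, hpq, ⟨hp, fun hs => hen ?_⟩, ⟨hq, fun hs => hen ?_⟩, hpe, hqe⟩
    · exact mem_linksAt.2 ⟨heM, p, mem_leavesIn.2 ⟨hp, hs⟩, hpe⟩
    · exact mem_linksAt.2 ⟨heM, q, mem_leavesIn.2 ⟨hq, hs⟩, hqe⟩
  have hold : ∀ e ∈ M', ∀ r ∈ leaves C', Crosses l e r → r ∈ leaves C ∧ ¬r ⊆ S := by
    intro e he r hr hre
    obtain ⟨p, q, hpq, hp, hq, hpe, hqe⟩ := htwo e he
    rcases Crosses.eq_or_eq hC'.leaf_pairwise ((hL' p).2 (Or.inl hp)) ((hL' q).2 (Or.inl hq)) hr hpq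
      hpe hqe hre with rfl | rfl
    · exact hp
    · exact hq
  have h' : MatchedFamily l x C' M' := by
    refine ⟨hC', h.nonneg, fun D hD => h.cut D (contract_subset hD), ⟨fun e he => ?_,
      fun r hr e he e' he' hre hre' => ?_⟩, fun e he p q hpq hpe hqe D hD heq => ?_⟩
    · obtain ⟨p, q, hpq, hp, hq, hpe, hqe⟩ := htwo e he
      exact ⟨p, (hL' p).2 (Or.inl hp), q, (hL' q).2 (Or.inl hq), hpq, hpe, hqe⟩
    · exact h.matching.unique r (hold e he r hr hre).1 e (hM'M he) e' (hM'M he') hre hre'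
    · have hpD : p ∈ leavesIn C' D := by rw [heq]; simp
      have hqD : q ∈ leavesIn C' D := by rw [heq]; simp
      have hp' := hold e he p (mem_leavesIn.1 hpD).1 hpe
      have hq' := hold e he q (mem_leavesIn.1 hqD).1 hqe
      -- a two-leaf set of the new family around `e` does not contain `S`, so it has the same leaves
      -- as before
      have hSD : ¬S ⊆ D := by
        intro hs
        have : S ∈ leavesIn C' D := mem_leavesIn.2 ⟨(hL' S).2 (Or.inr rfl), hs⟩
        rw [heq, Finset.mem_insert, Finset.mem_singleton] at this
        rcases this with rfl | rfl
        · exact hp'.2 subset_rfl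
        · exact hq'.2 subset_rfl
      obtain ⟨hDC, hDS⟩ := (hC'mem D).1 hD
      refine h.twinFree e (hM'M he) p q hpq hpe hqe D hDC (Finset.Subset.antisymm ?_ ?_)
      · intro r hr
        obtain ⟨hr1, hr2⟩ := mem_leavesIn.1 hr
        rw [← heq]
        refine mem_leavesIn.2 ⟨(hL' r).2 (Or.inl ⟨hr1, fun hrS => ?_⟩), hr2⟩
        rcases hC.nested_of_common hDC hS (hC.nonempty r (leaves_subset hr1)) hr2 hrS with h1 | h1
        · by_cases hne : D = S
          · exact hSD hne.ge
          · exact hDS (h1.ssubset_of_ne hne)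
        · exact hSD h1
      · intro r hr
        rw [Finset.mem_insert, Finset.mem_singleton] at hr
        rcases hr with rfl | rfl
        · exact mem_leavesIn.2 ⟨hp'.1, (mem_leavesIn.1 hpD).2⟩
        · exact mem_leavesIn.2 ⟨hq'.1, (mem_leavesIn.1 hqD).2⟩
  obtain ⟨J', hJ', hcard'⟩ := ih C'.card (hn ▸ hlt) h' rfl
  refine ⟨J' ∪ J, fun D hD => ?_, ?_⟩
  · by_cases hDS : D ⊂ S
    · obtain ⟨e, he, hc⟩ := hSJ.cover D hD hDS
      exact ⟨e, Finset.mem_union_right _ he, hc⟩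
    · obtain ⟨e, he, hc⟩ := hJ' D ((hC'mem D).2 ⟨hD, hDS⟩)
      exact ⟨e, Finset.mem_union_left _ he, hc⟩
  · have hXL : X ⊆ leaves C := fun p hp => (mem_leavesIn.1 hp).1
    have c1 : (leaves C').card + X.card ≤ (leaves C).card + 1 := by
      have hsub : leaves C' ⊆ insert S (leaves C \ X) := by
        intro p hp
        rcases (hL' p).1 hp with ⟨h1, h2⟩ | rfl
        · exact Finset.mem_insert_of_mem (Finset.mem_sdiff.2 ⟨h1, fun h3 =>
            h2 (mem_leavesIn.1 h3).2⟩)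
        · exact Finset.mem_insert_self _ _
      have h1 := (Finset.card_le_card hsub).trans (Finset.card_insert_le _ _)
      have h2 := Finset.card_sdiff_add_card_eq_card hXL
      omega
    have c2 : M'.card + (linksAt (LeafInc l) M X).card = M.card :=
      Finset.card_sdiff_add_card_eq_card (Finset.filter_subset _ _)
    -- the nodes of `S` are no longer inner nodes, and its leaves are gone: the surplus splits
    have c3 : surplus l x C' M' Finset.univ + surplus l x C M S ≤ surplus l x C M Finset.univ := by
      have v1 : vol l x (inner C' Finset.univ) + vol l x (inner C S) ≤
          vol l x (inner C Finset.univ) := by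
        refine vol_add_vol_le h.nonneg (Finset.disjoint_left.2 fun v hv hv' => ?_) (fun v hv => ?_)
          fun v hv => ?_
        · exact (mem_inner.1 hv).2 S ((hL' S).2 (Or.inr rfl)) (mem_inner.1 hv').1
        · refine mem_inner.2 ⟨Finset.mem_univ v, fun p hp hvp => ?_⟩
          by_cases hpS : p ⊆ S
          · exact (mem_inner.1 hv).2 S ((hL' S).2 (Or.inr rfl)) (hpS hvp)
          · exact (mem_inner.1 hv).2 p ((hL' p).2 (Or.inl ⟨hp, hpS⟩)) hvp
        · exact mem_inner.2 ⟨Finset.mem_univ v, (mem_inner.1 hv).2⟩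
      have v2 : ∑ p ∈ (leavesIn C' Finset.univ).filter (Touched (LeafInc l) M'),
            (cutWeight l x p - 1) +
          ∑ p ∈ X.filter (Touched (LeafInc l) M), (cutWeight l x p - 1) ≤
          ∑ p ∈ (leavesIn C Finset.univ).filter (Touched (LeafInc l) M), (cutWeight l x p - 1) := by
        have hA : ∀ p ∈ (leavesIn C' Finset.univ).filter (Touched (LeafInc l) M'),
            (p ∈ leaves C ∧ ¬p ⊆ S) ∧ Touched (LeafInc l) M p := by
          intro p hp
          obtain ⟨h1, e, he, hc⟩ := Finset.mem_filter.1 hp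
          exact ⟨hold e he p (mem_leavesIn.1 h1).1 hc, e, hM'M he, hc⟩
        rw [← Finset.sum_union]
        · refine Finset.sum_le_sum_of_subset_of_nonneg (fun p hp => ?_) fun p hp _ => ?_
          · rcases Finset.mem_union.1 hp with hp | hp
            · obtain ⟨h1, h2⟩ := hA p hp
              exact Finset.mem_filter.2 ⟨mem_leavesIn.2 ⟨h1.1, Finset.subset_univ _⟩, h2⟩
            · obtain ⟨h1, h2⟩ := Finset.mem_filter.1 hp
              exact Finset.mem_filter.2 ⟨mem_leavesIn.2 ⟨hXL h1, Finset.subset_univ _⟩, h2⟩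
          · have := h.cut p (leaves_subset (mem_leavesIn.1 (Finset.mem_filter.1 hp).1).1)
            linarith
        · refine Finset.disjoint_left.2 fun p hp hp' => ?_
          exact (hA p hp).1.2 (mem_leavesIn.1 (Finset.mem_filter.1 hp').1).2
      unfold surplus
      linarith
    have c0 := hSJ.card_add_one_le
    have c4 : ((J' ∪ J).card : ℝ) ≤ J'.card + J.card := by exact_mod_cast Finset.card_union_le J' J
    have c1' : ((leaves C').card : ℝ) + X.card ≤ (leaves C).card + 1 := by exact_mod_cast c1
    have c2' : (M'.card : ℝ) + (linksAt (LeafInc l) M X).card = M.card := by exact_mod_cast c2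
    linarith

end

section

open Finset

variable {V : Type*} {E : Type*} {l : E → V × V} {M : Finset E}

/-! ### Maximum matchings and half-integral vertex covers -/

/-- In a maximum matching of `P`-links there is no augmenting path of length three. -/
theorem no_augmenting_path {L : Finset (Finset V)} (hL : (L : Set (Finset V)).Pairwise Disjoint)
    {P : E → Prop} (hM : IsMatching L (LeafInc l) M) (hMP : ∀ e ∈ M, P e)
    (hmax : ∀ M', IsMatching L (LeafInc l) M' → (∀ e ∈ M', P e) → M'.card ≤ M.card)
    {g e₁ e₂ : E} (hg : g ∈ M) (h₁ : P e₁) (h₂ : P e₂) {p q r s : Finset V} (hp : p ∈ L)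
    (hq : q ∈ L)
    (hr : r ∈ L) (hs : s ∈ L) (hpq : p ≠ q) (hgp : Crosses l g p) (hgq : Crosses l g q)
    (hrt : ¬Touched (LeafInc l) M r) (hst : ¬Touched (LeafInc l) M s) (hpe : Crosses l e₁ p)
    (hre : Crosses l e₁ r) (hqe : Crosses l e₂ q) (hse : Crosses l e₂ s) : r = s := by
  by_contra hrs
  have hpr : p ≠ r := by rintro rfl; exact hrt ⟨g, hg, hgp⟩
  have hps : p ≠ s := by rintro rfl; exact hst ⟨g, hg, hgp⟩
  have hqr : q ≠ r := by rintro rfl; exact hrt ⟨g, hg, hgq⟩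
  have hqs : q ≠ s := by rintro rfl; exact hst ⟨g, hg, hgq⟩
  have at1 : ∀ a ∈ L, Crosses l e₁ a → a = p ∨ a = r := fun a ha hc =>
    Crosses.eq_or_eq hL hp hr ha hpr hpe hre hc
  have at2 : ∀ a ∈ L, Crosses l e₂ a → a = q ∨ a = s := fun a ha hc =>
    Crosses.eq_or_eq hL hq hs ha hqs hqe hse hc
  have hne : e₁ ≠ e₂ := by
    rintro rfl
    rcases at1 q hq hqe with h | h
    · exact hpq h.symm
    · exact hqr h
  have hn1 : e₁ ∉ M := fun h => hrt ⟨e₁, h, hre⟩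
  have hn2 : e₂ ∉ M := fun h => hst ⟨e₂, h, hse⟩
  have k1 : ∀ a ∈ L, Crosses l e₁ a → ∀ b ∈ M.erase g, ¬Crosses l b a := by
    intro a ha hc b hb hb'
    obtain ⟨hbg, hbM⟩ := Finset.mem_erase.1 hb
    rcases at1 a ha hc with rfl | rfl
    · exact hbg (hM.unique _ ha b hbM g hg hb' hgp)
    · exact hrt ⟨b, hbM, hb'⟩
  have k2 : ∀ a ∈ L, Crosses l e₂ a → ∀ b ∈ M.erase g, ¬Crosses l b a := by
    intro a ha hc b hb hb'
    obtain ⟨hbg, hbM⟩ := Finset.mem_erase.1 hb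
    rcases at2 a ha hc with rfl | rfl
    · exact hbg (hM.unique _ ha b hbM g hg hb' hgq)
    · exact hst ⟨b, hbM, hb'⟩
  have k3 : ∀ a ∈ L, Crosses l e₁ a → ¬Crosses l e₂ a := by
    intro a ha hc hc'
    rcases at1 a ha hc with rfl | rfl <;> rcases at2 _ ha hc' with h | h
    · exact hpq h
    · exact hps h
    · exact hqr h.symm
    · exact hrs h
  have hM' : IsMatching L (LeafInc l) (insert e₁ (insert e₂ (M.erase g))) := by
    refine ⟨fun e he => ?_, fun a ha e he e' he' hc hc' => ?_⟩
    · rw [Finset.mem_insert, Finset.mem_insert] at he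
      rcases he with rfl | rfl | he
      · exact ⟨p, hp, r, hr, hpr, hpe, hre⟩
      · exact ⟨q, hq, s, hs, hqs, hqe, hse⟩
      · exact hM.two e (Finset.mem_of_mem_erase he)
    · rw [Finset.mem_insert, Finset.mem_insert] at he he'
      rcases he with rfl | rfl | he <;> rcases he' with rfl | rfl | he'
      · rfl
      · exact absurd hc' (k3 a ha hc)
      · exact absurd hc' (k1 a ha hc e' he')
      · exact absurd hc (k3 a ha hc')
      · rfl
      · exact absurd hc' (k2 a ha hc e' he')
      · exact absurd hc (k1 a ha hc' e he)
      · exact absurd hc (k2 a ha hc' e he)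
      · exact hM.unique a ha e (Finset.mem_of_mem_erase he) e' (Finset.mem_of_mem_erase he') hc hc'
  have h := hmax _ hM' (by
    intro e he
    rw [Finset.mem_insert, Finset.mem_insert] at he
    rcases he with rfl | rfl | he
    exacts [h₁, h₂, hMP e (Finset.mem_of_mem_erase he)])
  rw [Finset.card_insert_of_notMem, Finset.card_insert_of_notMem, Finset.card_erase_of_mem hg] at h
  · have := Finset.card_pos.2 ⟨g, hg⟩
    omega
  · exact fun h => hn2 (Finset.mem_of_mem_erase h)
  · rw [Finset.mem_insert]
    rintro (h | h)
    · exact hne h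
    · exact hn1 (Finset.mem_of_mem_erase h)

/-- A maximum matching `M` of `P`-links admits a fractional vertex cover of the `P`-links with total
weight at most `3/2` times the size of `M`. Each link of `M` contributes at least `1/2` at each of
its ends, and at most one further `1/2`: at the only end with unmatched neighbours, or at the only
unmatched leaf that neighbours both ends. -/
theorem exists_fractional_vertex_cover {L : Finset (Finset V)}
    (hL : (L : Set (Finset V)).Pairwise Disjoint) {P : E → Prop}
    (hP : ∀ e, P e → ∃ p ∈ L, ∃ q ∈ L, p ≠ q ∧ Crosses l e p ∧ Crosses l e q)
    (hM : IsMatching L (LeafInc l) M) (hMP : ∀ e ∈ M, P e)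
    (hmax : ∀ M', IsMatching L (LeafInc l) M' → (∀ e ∈ M', P e) → M'.card ≤ M.card) :
    ∃ y : Finset V → ℝ, (∀ p, 0 ≤ y p ∧ y p ≤ 1) ∧ ∑ p ∈ L, y p ≤ 3 / 2 * M.card ∧
      ∀ e, P e → 1 ≤ ∑ p ∈ L, y p * crossInd l e p := by
  have hmaximal : ∀ e, P e → ∀ p ∈ L, ∀ q ∈ L, p ≠ q → Crosses l e p → Crosses l e q →
      Touched (LeafInc l) M p ∨ Touched (LeafInc l) M q := by
    intro e he p hp q hq hpq hpe hqe
    by_contra! hu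
    have heM : e ∉ M := fun h => hu.1 ⟨e, h, hpe⟩
    have h := hmax (insert e M) (hM.insert hL (fun _ _ _ h => h) hp hq hpq hpe hqe hu.1 hu.2) (by
      intro e' he'
      rcases Finset.mem_insert.1 he' with rfl | he'
      exacts [he, hMP e' he'])
    rw [Finset.card_insert_of_notMem heM] at h
    omega
  -- the contribution of one link `g` of `M`, with total weight `3 / 2`
  have hloc : ∀ g ∈ M, ∃ f : Finset V → ℝ, (∀ p, 0 ≤ f p) ∧ ∑ p ∈ L, f p ≤ 3 / 2 ∧
      (∀ p ∈ L, Crosses l g p → 1 / 2 ≤ f p) ∧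
      ∀ e, P e → ∀ p ∈ L, ∀ q ∈ L, Crosses l g p → ¬Touched (LeafInc l) M q → Crosses l e p →
        Crosses l e q → 1 ≤ f p + f q := by
    intro g hg
    obtain ⟨p, hp, q, hq, hpq, hgp, hgq⟩ := hM.two g hg
    have atg : ∀ a ∈ L, Crosses l g a → a = p ∨ a = q := fun a ha hc =>
      Crosses.eq_or_eq hL hp hq ha hpq hgp hgq hc
    -- `FreeNbr r w`: a link joins the matched leaf `r` to the unmatched leaf `w`
    let FreeNbr : Finset V → Finset V → Prop := fun r w => w ∈ L ∧ ¬Touched (LeafInc l) M w ∧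
      ∃ e, P e ∧ Crosses l e r ∧ Crosses l e w
    have haug : ∀ w w', FreeNbr p w → FreeNbr q w' → w = w' := by
      rintro w w' ⟨hw, hwt, e₁, hP₁, h1, h2⟩ ⟨hw', hwt', e₂, hP₂, h3, h4⟩
      exact no_augmenting_path hL hM hMP hmax hg hP₁ hP₂ hp hq hw hw' hpq hgp hgq hwt hwt' h1 h2 h3
          h4
    have hsum : ∀ a b : ℝ, ∑ r ∈ L, ((if r = p then a else 0) +
        (if r = q then b else 0)) = a + b := by
      intro a b
      rw [Finset.sum_add_distrib, Finset.sum_ite_eq', Finset.sum_ite_eq', if_pos hp, if_pos hq]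
    -- contributions supported on the ends of `g`; they suffice unless both ends have unmatched
    -- neighbours
    have hone : ∀ a b : ℝ, 0 ≤ a → 0 ≤ b → 1 / 2 ≤ a → 1 / 2 ≤ b → a + b ≤ 3 / 2 →
        ((∃ w, FreeNbr p w) → 1 ≤ a) → ((∃ w, FreeNbr q w) → 1 ≤ b) →
        ∃ f : Finset V → ℝ, (∀ p, 0 ≤ f p) ∧ ∑ p ∈ L, f p ≤ 3 / 2 ∧
          (∀ p ∈ L, Crosses l g p → 1 / 2 ≤ f p) ∧
          ∀ e, P e → ∀ p ∈ L, ∀ q ∈ L, Crosses l g p → ¬Touched (LeafInc l) M q → Crosses l e p →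
            Crosses l e q → 1 ≤ f p + f q := by
      intro a b ha hb ha2 hb2 hab hpa hqb
      have hf0 : ∀ r, (0 : ℝ) ≤ (if r = p then a else 0) + (if r = q then b else 0) := by
        intro r; split_ifs <;> linarith
      refine ⟨fun r => (if r = p then a else 0) + (if r = q then b else 0), hf0,
        by rw [hsum]; exact hab, fun r hr hc => ?_, fun e he r hr w hw hc hwt her hew => ?_⟩
      · rcases atg r hr hc with rfl | rfl
        · simp only [if_true]; split_ifs <;> linarith
        · simp only [if_true]; split_ifs <;> linarith
      · have h1 := hf0 w
        have h2 : 1 ≤ (if r = p then a else 0) + (if r = q then b else 0) := by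
          rcases atg r hr hc with rfl | rfl
          · have := hpa ⟨w, hw, hwt, e, he, her, hew⟩
            simp only [if_true]; split_ifs <;> linarith
          · have := hqb ⟨w, hw, hwt, e, he, her, hew⟩
            simp only [if_true]; split_ifs <;> linarith
        simp only
        linarith
    by_cases hpn : ∃ w, FreeNbr p w
    · by_cases hqn : ∃ w, FreeNbr q w
      -- both ends have unmatched neighbours: all of these are a single leaf `w`
      · obtain ⟨w, hw⟩ := hpn
        have hqw : ∀ w', FreeNbr q w' → w' = w := fun w' h => (haug w w' hw h).symm
        have hpw : ∀ w', FreeNbr p w' → w' = w := by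
          obtain ⟨w₂, hw₂⟩ := hqn
          exact fun w' h => (haug w' w₂ h hw₂).trans (hqw w₂ hw₂)
        refine ⟨fun r => (if r = p then 1 / 2 else 0) + (if r = q then 1 / 2 else 0) +
          (if r = w then 1 / 2 else 0), fun r => ?_, ?_, fun r hr hc => ?_,
          fun e he r hr w' hw' hc hwt her hew => ?_⟩
        · dsimp only
          split_ifs <;> norm_num
        · rw [Finset.sum_add_distrib, hsum, Finset.sum_ite_eq', if_pos hw.1]
          norm_num
        · rcases atg r hr hc with rfl | rfl
          · simp only [if_true]; split_ifs <;> norm_num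
          · simp only [if_true]; split_ifs <;> norm_num
        · have hww : w' = w := by
            rcases atg r hr hc with rfl | rfl
            · exact hpw w' ⟨hw', hwt, e, he, her, hew⟩
            · exact hqw w' ⟨hw', hwt, e, he, her, hew⟩
          subst hww
          have h1 : (1 / 2 : ℝ) ≤ (if r = p then 1 / 2 else 0) + (if r = q then 1 / 2 else 0) +
              (if r = w' then 1 / 2 else 0) := by
            rcases atg r hr hc with rfl | rfl
            · simp only [if_true]; split_ifs <;> norm_num
            · simp only [if_true]; split_ifs <;> norm_num
          have h2 : (1 / 2 : ℝ) ≤ (if w' = p then 1 / 2 else 0) + (if w' = q then 1 / 2 else 0) +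
              (if w' = w' then 1 / 2 else 0) := by
            simp only [if_true]; split_ifs <;> norm_num
          simp only
          linarith
      · exact hone 1 (1 / 2) (by norm_num) (by norm_num) (by norm_num) (by norm_num) (by norm_num)
          (fun _ => le_rfl) fun h => absurd h hqn
    · by_cases hqn : ∃ w, FreeNbr q w
      · exact hone (1 / 2) 1 (by norm_num) (by norm_num) (by norm_num) (by norm_num) (by norm_num)
          (fun h => absurd h hpn) fun _ => le_rfl
      · exact hone (1 / 2) (1 / 2) (by norm_num) (by norm_num) (by norm_num) (by norm_num)
          (by norm_num) (fun h => absurd h hpn) fun h => absurd h hqn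
  choose! f hf0 hfs hfg hfe using hloc
  have hF0 : ∀ p, 0 ≤ ∑ g ∈ M, f g p := fun p => Finset.sum_nonneg fun g hg => hf0 g hg p
  have hFle : ∀ g ∈ M, ∀ p, f g p ≤ ∑ g ∈ M, f g p := fun g hg p =>
    Finset.single_le_sum (f := fun g => f g p) (fun g hg => hf0 g hg p) hg
  refine ⟨fun p => min 1 (∑ g ∈ M, f g p), fun p => ⟨le_min zero_le_one (hF0 p), min_le_left _ _⟩,
    ?_, fun e he => ?_⟩
  · calc ∑ p ∈ L, min 1 (∑ g ∈ M, f g p) ≤ ∑ p ∈ L, ∑ g ∈ M, f g p :=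
          Finset.sum_le_sum fun p _ => min_le_right _ _
      _ = ∑ g ∈ M, ∑ p ∈ L, f g p := Finset.sum_comm
      _ ≤ ∑ _g ∈ M, (3 / 2 : ℝ) := Finset.sum_le_sum fun g hg => hfs g hg
      _ = 3 / 2 * M.card := by rw [Finset.sum_const, nsmul_eq_mul, mul_comm]
  · obtain ⟨p, hp, q, hq, hpq, hpe, hqe⟩ := hP e he
    have hy0 : ∀ p, 0 ≤ min 1 (∑ g ∈ M, f g p) := fun p => le_min zero_le_one (hF0 p)
    have h1 : min 1 (∑ g ∈ M, f g p) + min 1 (∑ g ∈ M, f g q) ≤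
        ∑ p ∈ L, min 1 (∑ g ∈ M, f g p) * crossInd l e p := by
      have hsub : ({p, q} : Finset (Finset V)) ⊆ L := by
        intro r hr
        rw [Finset.mem_insert, Finset.mem_singleton] at hr
        rcases hr with rfl | rfl <;> assumption
      have := Finset.sum_le_sum_of_subset_of_nonneg
        (f := fun p => min 1 (∑ g ∈ M, f g p) * crossInd l e p) hsub
        fun r _ _ => mul_nonneg (hy0 r) (crossInd_nonneg r)
      rw [Finset.sum_pair hpq, crossInd_of_crosses hpe, crossInd_of_crosses hqe, mul_one, mul_one]
        at this
      exact this
    refine le_trans ?_ h1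
    -- `a` is matched
    have main : ∀ a ∈ L, ∀ b ∈ L, Crosses l e a → Crosses l e b → Touched (LeafInc l) M a →
        1 ≤ min 1 (∑ g ∈ M, f g a) + min 1 (∑ g ∈ M, f g b) := by
      rintro a ha b hb hae hbe ⟨g, hg, hga⟩
      have i1 := hFle g hg a
      have i2 := hfg g hg a ha hga
      by_cases hbt : Touched (LeafInc l) M b
      · obtain ⟨g', hg', hgb⟩ := hbt
        have i3 := hFle g' hg' b
        have i4 := hfg g' hg' b hb hgb
        have i5 : (1 / 2 : ℝ) ≤ min 1 (∑ g ∈ M, f g a) := le_min (by norm_num) (by linarith)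
        have i6 : (1 / 2 : ℝ) ≤ min 1 (∑ g ∈ M, f g b) := le_min (by norm_num) (by linarith)
        linarith
      · have i3 := hFle g hg b
        have i4 := hfe g hg e he a ha b hb hga hbt hae hbe
        have i5 := hy0 a
        have i6 := hy0 b
        rcases min_choice 1 (∑ g ∈ M, f g a) with h | h
        · linarith
        · rcases min_choice 1 (∑ g ∈ M, f g b) with h' | h'
          · linarith
          · rw [h, h']; linarith
    rcases hmaximal e he p hp q hq hpq hpe hqe with ht | ht
    · exact main p hp q hq hpe hqe ht
    · rw [add_comm]
      exact main q hq p hp hqe hpe ht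

end

section

open Finset

variable {V : Type*} {E : Type*} {l : E → V × V} {x : E → ℝ} {C : Finset (Finset V)}
  {e : E}

/-! ### Twin links and the size of a twin-free matching -/

/-- The link `e` joins two leaves. -/
def JoinsLeaves (l : E → V × V) (C : Finset (Finset V)) (e : E) : Prop :=
  ∃ p ∈ leaves C, ∃ q ∈ leaves C, p ≠ q ∧ Crosses l e p ∧ Crosses l e q

/-- `D` has exactly two leaves. -/
def IsStem (C : Finset (Finset V)) (D : Finset V) : Prop :=
  D ∈ C ∧ ∃ p q, p ≠ q ∧ leavesIn C D = {p, q}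

/-- The link `e` joins the two leaves of a two-leaf member of the family. -/
def IsTwin (l : E → V × V) (C : Finset (Finset V)) (e : E) : Prop :=
  ∃ D, IsStem C D ∧ ∀ p ∈ leavesIn C D, Crosses l e p

/-- The weight of the links at `p` that satisfy `Q`. -/
noncomputable def partWeight [Fintype E] (l : E → V × V) (x : E → ℝ) (Q : E → Prop)
    (p : Finset V) : ℝ :=
  ∑ e, x e * if Q e then crossInd l e p else 0

/-- The weight of the links that satisfy `Q`. -/
noncomputable def totalWeight [Fintype E] (x : E → ℝ) (Q : E → Prop) : ℝ :=
  ∑ e, x e * if Q e then 1 else 0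

theorem partWeight_nonneg [Fintype E] (hx : ∀ e, 0 ≤ x e) (Q : E → Prop) (p : Finset V) :
    0 ≤ partWeight l x Q p :=
  Finset.sum_nonneg fun e _ => mul_nonneg (hx e)
    (by split_ifs; exacts [crossInd_nonneg p, le_rfl])

theorem not_crosses_of_subset {p q D : Finset V} (hpq : Disjoint p q) (hp : Crosses l e p)
    (hq : Crosses l e q) (hpD : p ⊆ D) (hqD : q ⊆ D) : ¬Crosses l e D := by
  intro h
  have h1 : (l e).1 ∈ p → (l e).1 ∉ q := fun h => Finset.disjoint_left.1 hpq h
  have h2 : (l e).2 ∈ p → (l e).2 ∉ q := fun h => Finset.disjoint_left.1 hpq h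
  have h3 := @hpD (l e).1
  have h4 := @hpD (l e).2
  have h5 := @hqD (l e).1
  have h6 := @hqD (l e).2
  rcases hp.cases with a | a <;> rcases hq.cases with b | b <;> rcases h.cases with c | c <;> tauto

theorem IsTwin.joinsLeaves (h : IsTwin l C e) : JoinsLeaves l C e := by
  obtain ⟨D, ⟨-, p, q, hpq, heq⟩, hc⟩ := h
  have hp : p ∈ leavesIn C D := by simp [heq]
  have hq : q ∈ leavesIn C D := by simp [heq]
  exact ⟨p, (mem_leavesIn.1 hp).1, q, (mem_leavesIn.1 hq).1, hpq, hc p hp, hc q hq⟩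

/-- Two-leaf members that share a leaf have the same leaves. -/
theorem IsStem.leavesIn_eq (hC : Laminar C) {D D' p : Finset V} (hD : IsStem C D)
    (hD' : IsStem C D') (hp : p ∈ leavesIn C D) (hp' : p ∈ leavesIn C D') :
    leavesIn C D = leavesIn C D' := by
  have hcard : ∀ D, IsStem C D → (leavesIn C D).card = 2 := by
    rintro D ⟨-, p, q, hpq, heq⟩
    rw [heq, Finset.card_pair hpq]
  obtain ⟨hpL, hpD⟩ := mem_leavesIn.1 hp
  obtain ⟨-, hpD'⟩ := mem_leavesIn.1 hp'
  rcases hC.nested_of_common hD.1 hD'.1 (hC.nonempty p (leaves_subset hpL)) hpD hpD' with h | h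
  · exact Finset.eq_of_subset_of_card_le (fun q hq =>
      mem_leavesIn.2 ⟨(mem_leavesIn.1 hq).1, (mem_leavesIn.1 hq).2.trans h⟩)
      (by rw [hcard D hD, hcard D' hD'])
  · exact (Finset.eq_of_subset_of_card_le (fun q hq =>
      mem_leavesIn.2 ⟨(mem_leavesIn.1 hq).1, (mem_leavesIn.1 hq).2.trans h⟩)
      (by rw [hcard D hD, hcard D' hD'])).symm

/-- A twin link at one leaf of a two-leaf member is also at the other leaf. -/
theorem IsTwin.crosses (hC : Laminar C) (h : IsTwin l C e) {D p : Finset V} (hD : IsStem C D)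
    (hp : p ∈ leavesIn C D) (hc : Crosses l e p) : ∀ q ∈ leavesIn C D, Crosses l e q := by
  obtain ⟨D', hD', hall⟩ := h
  obtain ⟨-, p', q', hpq, heq⟩ := id hD'
  have hp' : p' ∈ leavesIn C D' := by simp [heq]
  have hq' : q' ∈ leavesIn C D' := by simp [heq]
  have hpD' : p ∈ leavesIn C D' := by
    rcases Crosses.eq_or_eq hC.leaf_pairwise (mem_leavesIn.1 hp').1 (mem_leavesIn.1 hq').1
      (mem_leavesIn.1 hp).1 hpq (hall p' hp') (hall q' hq') hc with rfl | rfl <;> assumption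
  rw [hD.leavesIn_eq hC hD' hp hpD']
  exact hall

theorem JoinsLeaves.sum_crossInd (hC : Laminar C) (h : JoinsLeaves l C e) :
    ∑ p ∈ leaves C, crossInd l e p = 2 := by
  obtain ⟨p, hp, q, hq, hpq, hpe, hqe⟩ := h
  have hsub : ({p, q} : Finset (Finset V)) ⊆ leaves C := by
    intro r hr
    rw [Finset.mem_insert, Finset.mem_singleton] at hr
    rcases hr with rfl | rfl <;> assumption
  rw [← Finset.sum_subset hsub, Finset.sum_pair hpq, crossInd_of_crosses hpe,
    crossInd_of_crosses hqe]
  · norm_num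
  · intro r hr hr'
    refine crossInd_of_not fun hc => hr' ?_
    rw [Finset.mem_insert, Finset.mem_singleton]
    exact Crosses.eq_or_eq hC.leaf_pairwise hp hq hr hpq hpe hqe hc

theorem sum_partWeight [Fintype E] (hC : Laminar C) {Q : E → Prop}
    (hQ : ∀ e, Q e → JoinsLeaves l C e) :
    ∑ p ∈ leaves C, partWeight l x Q p = 2 * totalWeight x Q := by
  unfold partWeight totalWeight
  rw [Finset.sum_comm, Finset.mul_sum]
  refine Finset.sum_congr rfl fun e _ => ?_
  rw [← Finset.mul_sum]
  by_cases h : Q e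
  · simp only [h, if_true, (hQ e h).sum_crossInd hC]
    ring
  · simp [h]

theorem sum_leaf_indicator_add_inner [Fintype V] (hC : Laminar C) (v : V) :
    (∑ p ∈ leaves C, if v ∈ p then 1 else 0 : ℝ) +
      (if v ∈ inner C Finset.univ then 1 else 0) = 1 := by
  by_cases h : ∃ p ∈ leaves C, v ∈ p
  · obtain ⟨p, hp, hv⟩ := h
    rw [Finset.sum_eq_single_of_mem p hp, if_pos hv, if_neg, add_zero]
    · exact fun h => (mem_inner.1 h).2 p hp hv
    · intro q hq hqp
      exact if_neg fun h => Finset.disjoint_left.1 (hC.leaf_disjoint hq hp hqp) h hv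
  · push Not at h
    rw [Finset.sum_eq_zero fun p hp => if_neg (h p hp),
      if_pos (mem_inner.2 ⟨Finset.mem_univ v, h⟩), zero_add]

theorem crossInd_le (p : Finset V) :
    crossInd l e p ≤ (if (l e).1 ∈ p then 1 else 0) + (if (l e).2 ∈ p then 1 else 0) := by
  unfold crossInd Crosses
  by_cases h1 : (l e).1 ∈ p <;> by_cases h2 : (l e).2 ∈ p <;> simp [h1, h2]

/-- Every link has only two ends. -/
theorem sum_cutWeight_add_vol_le [Fintype E] [Fintype V] (hC : Laminar C) (hx : ∀ e, 0 ≤ x e) :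
    ∑ p ∈ leaves C, cutWeight l x p + vol l x (inner C Finset.univ) ≤ 2 * ∑ e, x e := by
  rw [sum_cutWeight, vol, ← Finset.sum_add_distrib, Finset.mul_sum]
  refine Finset.sum_le_sum fun e _ => ?_
  rw [← mul_add, mul_comm 2]
  refine mul_le_mul_of_nonneg_left ?_ (hx e)
  have h1 : ∑ p ∈ leaves C, crossInd l e p ≤
      ∑ p ∈ leaves C, (if (l e).1 ∈ p then 1 else 0 : ℝ) +
        ∑ p ∈ leaves C, (if (l e).2 ∈ p then 1 else 0 : ℝ) := by
    rw [← Finset.sum_add_distrib]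
    exact Finset.sum_le_sum fun p _ => crossInd_le p
  have h2 := sum_leaf_indicator_add_inner hC (l e).1
  have h3 := sum_leaf_indicator_add_inner hC (l e).2
  unfold endCount
  linarith

/-- A link that crosses a leaf but does not join two leaves has an end at an inner node. -/
theorem sum_partWeight_not_joinsLeaves_le [Fintype E] [Fintype V] (hC : Laminar C)
    (hx : ∀ e, 0 ≤ x e) :
    ∑ p ∈ leaves C, partWeight l x (fun e => ¬JoinsLeaves l C e) p ≤
      vol l x (inner C Finset.univ) := by
  unfold partWeight vol
  rw [Finset.sum_comm]
  refine Finset.sum_le_sum fun e _ => ?_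
  rw [← Finset.mul_sum]
  refine mul_le_mul_of_nonneg_left ?_ (hx e)
  by_cases hj : JoinsLeaves l C e
  · simp only [hj, not_true, if_false, Finset.sum_const_zero]
    exact endCount_nonneg _
  simp only [hj, not_false_iff, if_true]
  by_cases h : ∃ p ∈ leaves C, Crosses l e p
  · obtain ⟨p, hp, hc⟩ := h
    have honly : ∀ q ∈ leaves C, q ≠ p → ¬Crosses l e q := fun q hq hqp hcq =>
      hj ⟨q, hq, p, hp, hqp, hcq, hc⟩
    rw [Finset.sum_eq_single_of_mem p hp fun q hq hqp => crossInd_of_not (honly q hq hqp),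
      crossInd_of_crosses hc]
    have hdis : ∀ q ∈ leaves C, q ≠ p → ∀ v, v ∈ p → v ∉ q := fun q hq hqp v hv =>
      Finset.disjoint_left.1 (hC.leaf_disjoint hp hq hqp.symm) hv
    rcases hc.cases with ⟨h1, h2⟩ | ⟨h1, h2⟩
    · refine one_le_endCount_of_snd (mem_inner.2 ⟨Finset.mem_univ _, fun q hq hv => ?_⟩)
      have hqp : q ≠ p := by rintro rfl; exact h2 hv
      refine honly q hq hqp ?_
      have := hdis q hq hqp _ h1
      unfold Crosses
      tauto
    · refine one_le_endCount_of_fst (mem_inner.2 ⟨Finset.mem_univ _, fun q hq hv => ?_⟩)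
      have hqp : q ≠ p := by rintro rfl; exact h2 hv
      refine honly q hq hqp ?_
      have := hdis q hq hqp _ h1
      unfold Crosses
      tauto
  · push Not at h
    rw [Finset.sum_eq_zero fun p hp => crossInd_of_not (h p hp)]
    exact endCount_nonneg _

theorem sum_vol_le [Fintype E] [Fintype V] (hx : ∀ e, 0 ≤ x e) {𝓢 : Finset (Finset V)}
    (h𝓢 : (𝓢 : Set (Finset V)).Pairwise Disjoint) :
    ∑ D ∈ 𝓢, vol l x (inner C D) ≤ vol l x (inner C Finset.univ) := by
  unfold vol
  rw [Finset.sum_comm]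
  refine Finset.sum_le_sum fun e _ => ?_
  rw [← Finset.mul_sum]
  refine mul_le_mul_of_nonneg_left ?_ (hx e)
  have key : ∀ v, (∑ D ∈ 𝓢, if v ∈ inner C D then 1 else 0 : ℝ) ≤
      if v ∈ inner C Finset.univ then 1 else 0 := by
    intro v
    by_cases h : ∃ D ∈ 𝓢, v ∈ inner C D
    · obtain ⟨D, hD, hv⟩ := h
      rw [Finset.sum_eq_single_of_mem D hD, if_pos hv,
        if_pos (mem_inner.2 ⟨Finset.mem_univ v, (mem_inner.1 hv).2⟩)]
      intro D' hD' hne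
      exact if_neg fun h => Finset.disjoint_left.1 (h𝓢 hD' hD hne) (mem_inner.1 h).1
        (mem_inner.1 hv).1
    · push Not at h
      rw [Finset.sum_eq_zero fun D hD => if_neg (h D hD)]
      split_ifs <;> norm_num
  unfold endCount
  rw [Finset.sum_add_distrib]
  exact add_le_add (key _) (key _)

/-- The cut weight of a leaf splits into twin links, other links joining leaves, and links that do
not join leaves. -/
theorem cutWeight_eq_add_add [Fintype E] (p : Finset V) :
    cutWeight l x p = partWeight l x (IsTwin l C) p +
      partWeight l x (fun e => JoinsLeaves l C e ∧ ¬IsTwin l C e) p +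
      partWeight l x (fun e => ¬JoinsLeaves l C e) p := by
  unfold cutWeight partWeight
  rw [← Finset.sum_add_distrib, ← Finset.sum_add_distrib]
  refine Finset.sum_congr rfl fun e _ => ?_
  rw [← mul_add, ← mul_add]
  congr 1
  by_cases h1 : IsTwin l C e
  · simp [h1, h1.joinsLeaves]
  · by_cases h2 : JoinsLeaves l C e <;> simp [h1, h2]

/-- Twin links are light: at a two-leaf member `D`, the weight of the twin links is bounded by that
of the other links needed to satisfy the cut constraint of `D`. -/
theorem twin_weight_le [Fintype E] (hC : Laminar C) (hx : ∀ e, 0 ≤ x e)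
    (hcut : ∀ D ∈ C, 1 ≤ cutWeight l x D)
    {D : Finset V} (hD : IsStem C D) :
    ∑ p ∈ leavesIn C D, partWeight l x (IsTwin l C) p ≤
      ∑ p ∈ leavesIn C D, (2 * (min (partWeight l x (IsTwin l C) p) (1 / 2) *
        partWeight l x (fun e => JoinsLeaves l C e ∧ ¬IsTwin l C e) p) +
        partWeight l x (fun e => ¬JoinsLeaves l C e) p + (cutWeight l x p - 1)) +
      2 * vol l x (inner C D) := by
  obtain ⟨hDC, p, q, hpq, heq⟩ := id hD
  have hpD : p ∈ leavesIn C D := by simp [heq]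
  have hqD : q ∈ leavesIn C D := by simp [heq]
  obtain ⟨hp, hpS⟩ := mem_leavesIn.1 hpD
  obtain ⟨hq, hqS⟩ := mem_leavesIn.1 hqD
  have ht : partWeight l x (IsTwin l C) p = partWeight l x (IsTwin l C) q := by
    unfold partWeight
    refine Finset.sum_congr rfl fun e _ => ?_
    by_cases h : IsTwin l C e
    · have h1 : Crosses l e p ↔ Crosses l e q :=
        ⟨fun hc => h.crosses hC hD hpD hc q hqD, fun hc => h.crosses hC hD hqD hc p hpD⟩
      simp [h, crossInd, h1]
    · simp [h]
  have hcutD : cutWeight l x D ≤ partWeight l x (fun e => JoinsLeaves l C e ∧ ¬IsTwin l C e) p +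
      partWeight l x (fun e => ¬JoinsLeaves l C e) p +
      partWeight l x (fun e => JoinsLeaves l C e ∧ ¬IsTwin l C e) q +
      partWeight l x (fun e => ¬JoinsLeaves l C e) q + vol l x (inner C D) := by
    unfold cutWeight partWeight vol
    simp only [← Finset.sum_add_distrib]
    refine Finset.sum_le_sum fun e _ => ?_
    simp only [← mul_add]
    refine mul_le_mul_of_nonneg_left ?_ (hx e)
    have n1 := crossInd_nonneg (l := l) (e := e) p
    have n2 := crossInd_nonneg (l := l) (e := e) q
    have n3 := endCount_nonneg (l := l) (e := e) (inner C D)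
    by_cases hc : Crosses l e D
    · rw [crossInd_of_crosses hc]
      rcases hc.leaf_or_inner hC hDC with ⟨r, hr, hcr⟩ | hin
      · have hnt : ¬IsTwin l C e := fun h =>
          have hall := h.crosses hC hD hr hcr
          not_crosses_of_subset (hC.leaf_disjoint hp hq hpq) (hall p hpD) (hall q hqD) hpS hqS hc
        have h1 : 1 ≤ crossInd l e p + crossInd l e q := by
          rw [heq, Finset.mem_insert, Finset.mem_singleton] at hr
          rcases hr with rfl | rfl <;> rw [crossInd_of_crosses hcr] <;> linarith
        by_cases hj : JoinsLeaves l C e <;> simp only [hj, hnt, not_true, not_false_iff, and_self,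
          and_true, if_true, if_false] <;> linarith
      · by_cases hj : JoinsLeaves l C e <;> by_cases hnt : IsTwin l C e <;> simp only [hj, hnt,
          not_true, not_false_iff, and_self, and_true, and_false, if_true,
          if_false] <;> linarith
    · rw [crossInd_of_not hc]
      by_cases hj : JoinsLeaves l C e <;> by_cases hnt : IsTwin l C e <;> simp only [hj, hnt,
          not_true,
        not_false_iff, and_self, and_true, and_false, if_true, if_false] <;>
        linarith
  have h1 := hcut D hDC
  have h2 := cutWeight_eq_add_add (l := l) (x := x) (C := C) p
  have h3 := cutWeight_eq_add_add (l := l) (x := x) (C := C) q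
  have h4 := partWeight_nonneg (l := l) hx (fun e => JoinsLeaves l C e ∧ ¬IsTwin l C e) p
  have h5 := partWeight_nonneg (l := l) hx (fun e => JoinsLeaves l C e ∧ ¬IsTwin l C e) q
  have h6 := partWeight_nonneg (l := l) hx (fun e => ¬JoinsLeaves l C e) p
  have h7 := partWeight_nonneg (l := l) hx (fun e => ¬JoinsLeaves l C e) q
  have h8 := partWeight_nonneg (l := l) hx (IsTwin l C) q
  have h9 : 0 ≤ vol l x (inner C D) := vol_nonneg hx _
  rw [heq, Finset.sum_pair hpq, Finset.sum_pair hpq]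
  rw [ht] at h2 ⊢
  have h10 := hcut p (leaves_subset hp)
  have h11 := hcut q (leaves_subset hq)
  -- if the twin weight `t` is at most `1 / 2`, the cut constraint of `D` is multiplied by `2 * t`;
  -- otherwise it is combined with the cut weights of the two leaves, which determine `t`
  rcases le_total (partWeight l x (IsTwin l C) q) (1 / 2) with h | h
  · rw [min_eq_left h]
    nlinarith
  · rw [min_eq_right h]
    linarith

/-- The minimal two-leaf members carry all the twin links, so twin links are light in total. -/
theorem sum_twin_weight_le [Fintype E] [Fintype V] (hC : Laminar C) (hx : ∀ e, 0 ≤ x e)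
    (hcut : ∀ D ∈ C, 1 ≤ cutWeight l x D) :
    ∑ p ∈ leaves C, partWeight l x (IsTwin l C) p ≤
      ∑ p ∈ leaves C, (2 * (min (partWeight l x (IsTwin l C) p) (1 / 2) *
        partWeight l x (fun e => JoinsLeaves l C e ∧ ¬IsTwin l C e) p) +
        partWeight l x (fun e => ¬JoinsLeaves l C e) p + (cutWeight l x p - 1)) +
      2 * vol l x (inner C Finset.univ) := by
  set 𝓢 := C.filter fun D => IsStem C D ∧ ∀ D' ⊂ D, ¬IsStem C D' with h𝓢
  have hmem : ∀ D ∈ 𝓢, IsStem C D ∧ ∀ D' ⊂ D, ¬IsStem C D' := fun D hD =>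
    (Finset.mem_filter.1 hD).2
  have hdis : (𝓢 : Set (Finset V)).Pairwise Disjoint := by
    intro D hD D' hD' hne
    rcases hC.nested D (hmem D hD).1.1 D' (hmem D' hD').1.1 with h | h | h
    · exact absurd (hmem D hD).1 ((hmem D' hD').2 D (h.ssubset_of_ne hne))
    · exact absurd (hmem D' hD').1 ((hmem D hD).2 D' (h.ssubset_of_ne hne.symm))
    · exact h
  have hdis' : (𝓢 : Set (Finset V)).PairwiseDisjoint (leavesIn C) := by
    intro D hD D' hD' hne
    refine Finset.disjoint_left.2 fun p hp hp' => ?_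
    obtain ⟨v, hv⟩ := hC.nonempty p (leaves_subset (mem_leavesIn.1 hp).1)
    exact Finset.disjoint_left.1 (hdis hD hD' hne) ((mem_leavesIn.1 hp).2 hv)
      ((mem_leavesIn.1 hp').2 hv)
  have hsub : 𝓢.biUnion (leavesIn C) ⊆ leaves C := by
    intro p hp
    obtain ⟨D, -, hp⟩ := Finset.mem_biUnion.1 hp
    exact (mem_leavesIn.1 hp).1
  have hzero : ∀ p ∈ leaves C, p ∉ 𝓢.biUnion (leavesIn C) → partWeight l x (IsTwin l C) p = 0 := by
    intro p hp hn
    refine Finset.sum_eq_zero fun e _ => ?_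
    by_cases ht : IsTwin l C e
    · rw [if_pos ht, crossInd_of_not, mul_zero]
      intro hc
      obtain ⟨D, hD, hall⟩ := ht
      obtain ⟨S, hSD, hS, hmin⟩ := exists_minimal_subset (P := IsStem C) hD
      obtain ⟨-, a, b, hab, heq⟩ := id hS
      have ha : a ∈ leavesIn C S := by simp [heq]
      have hb : b ∈ leavesIn C S := by simp [heq]
      have hup : ∀ q ∈ leavesIn C S, q ∈ leavesIn C D := fun q hq =>
        mem_leavesIn.2 ⟨(mem_leavesIn.1 hq).1, (mem_leavesIn.1 hq).2.trans hSD⟩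
      refine hn (Finset.mem_biUnion.2 ⟨S, Finset.mem_filter.2 ⟨hS.1, hS, hmin⟩, ?_⟩)
      rcases Crosses.eq_or_eq hC.leaf_pairwise (mem_leavesIn.1 ha).1 (mem_leavesIn.1 hb).1 hp hab
        (hall a (hup a ha)) (hall b (hup b hb)) hc with rfl | rfl <;> assumption
    · rw [if_neg ht, mul_zero]
  rw [← Finset.sum_subset hsub hzero]
  have h1 := Finset.sum_le_sum fun D hD => twin_weight_le hC hx hcut (hmem D hD).1
  rw [Finset.sum_add_distrib, ← Finset.mul_sum, ← Finset.sum_biUnion hdis',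
    ← Finset.sum_biUnion hdis'] at h1
  have h2 := sum_vol_le (l := l) (C := C) hx hdis
  refine h1.trans (add_le_add (Finset.sum_le_sum_of_subset_of_nonneg hsub fun p hp _ => ?_)
    (mul_le_mul_of_nonneg_left h2 zero_le_two))
  have h3 := partWeight_nonneg (l := l) hx (fun e => JoinsLeaves l C e ∧ ¬IsTwin l C e) p
  have h4 := partWeight_nonneg (l := l) hx (fun e => ¬JoinsLeaves l C e) p
  have h5 := partWeight_nonneg (l := l) hx (IsTwin l C) p
  have h6 := hcut p (leaves_subset hp)
  have h7 : 0 ≤ min (partWeight l x (IsTwin l C) p) (1 / 2) := le_min h5 (by norm_num)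
  nlinarith [mul_nonneg h7 h3]

/-- The links that join two leaves and are not twins are few compared with a maximum matching of
them: a fractional vertex cover `y` of these links is tested against the weights. -/
theorem totalWeight_add_sum_le [Fintype E] (hC : Laminar C) (hx : ∀ e, 0 ≤ x e)
    (hcut : ∀ D ∈ C, 1 ≤ cutWeight l x D) {m : ℝ} {y : Finset V → ℝ}
    (hy : ∀ p, 0 ≤ y p ∧ y p ≤ 1) (hm : ∑ p ∈ leaves C, y p ≤ m)
    (hcov : ∀ e, JoinsLeaves l C e ∧ ¬IsTwin l C e → 1 ≤ ∑ p ∈ leaves C, y p * crossInd l e p) :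
    totalWeight x (fun e => JoinsLeaves l C e ∧ ¬IsTwin l C e) +
      ∑ p ∈ leaves C, min (partWeight l x (IsTwin l C) p) (1 / 2) *
        partWeight l x (fun e => JoinsLeaves l C e ∧ ¬IsTwin l C e) p ≤
      3 / 2 * m + 2 * ∑ p ∈ leaves C, (cutWeight l x p - 1) := by
  set P : E → Prop := fun e => JoinsLeaves l C e ∧ ¬IsTwin l C e with hP
  have hPJ : ∀ e, P e → JoinsLeaves l C e := fun e h => h.1
  have hPcov : ∀ e, P e → 1 ≤ ∑ p ∈ leaves C, y p * crossInd l e p := hcov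
  clear_value P
  set τ : Finset V → ℝ := fun p => min (partWeight l x (IsTwin l C) p) (1 / 2) with hτ
  have hτ0 : ∀ p, 0 ≤ τ p := fun p => le_min (partWeight_nonneg hx _ p) (by norm_num)
  have hτ1 : ∀ p, τ p ≤ 1 / 2 := fun p => min_le_right _ _
  -- each link of `P` is counted at its two leaves
  have hlink : ∀ e, ∀ p ∈ leaves C, P e →
      crossInd l e p * (1 + ∑ q ∈ leaves C, τ q * crossInd l e q) ≤
        crossInd l e p * (3 / 2 + τ p) := by
    intro e p hp hPe
    by_cases hc : Crosses l e p
    · rw [crossInd_of_crosses hc, one_mul, one_mul]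
      have h1 := (hPJ e hPe).sum_crossInd hC
      rw [← Finset.add_sum_erase _ _ hp, crossInd_of_crosses hc] at h1 ⊢
      have h2 : ∑ q ∈ (leaves C).erase p, τ q * crossInd l e q ≤
          ∑ q ∈ (leaves C).erase p, 1 / 2 * crossInd l e q :=
        Finset.sum_le_sum fun q _ => mul_le_mul_of_nonneg_right (hτ1 q) (crossInd_nonneg q)
      rw [← Finset.mul_sum] at h2
      linarith
    · rw [crossInd_of_not hc, zero_mul, zero_mul]
  -- each link of `P` is weighted by `1` plus the values `τ` at its leaves, then charged to the
  -- cover `y`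
  have hstep1 : totalWeight x P + ∑ p ∈ leaves C, τ p * partWeight l x P p =
      ∑ e, x e * if P e then 1 + ∑ p ∈ leaves C, τ p * crossInd l e p else 0 := by
    unfold totalWeight partWeight
    simp only [Finset.mul_sum]
    rw [Finset.sum_comm, ← Finset.sum_add_distrib]
    refine Finset.sum_congr rfl fun e _ => ?_
    by_cases h : P e
    · simp only [h, if_true, mul_add, Finset.mul_sum]
      congr 1
      exact Finset.sum_congr rfl fun p _ => by ring
    · simp [h]
  have hstep2 : ∀ e, (x e * if P e then 1 + ∑ p ∈ leaves C, τ p * crossInd l e p else 0) ≤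
      ∑ p ∈ leaves C, y p * (3 / 2 + τ p) * (x e * if P e then crossInd l e p else 0) := by
    intro e
    by_cases h : P e
    · simp only [h, if_true]
      have hpos : 0 ≤ 1 + ∑ p ∈ leaves C, τ p * crossInd l e p :=
        add_nonneg zero_le_one (Finset.sum_nonneg fun p _ => mul_nonneg (hτ0 p) (crossInd_nonneg p))
      calc x e * (1 + ∑ p ∈ leaves C, τ p * crossInd l e p)
          ≤ x e * ((∑ p ∈ leaves C, y p * crossInd l e p) *
            (1 + ∑ p ∈ leaves C, τ p * crossInd l e p)) :=
            mul_le_mul_of_nonneg_left (le_mul_of_one_le_left hpos (hPcov e h)) (hx e)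
        _ = ∑ p ∈ leaves C, x e * (y p * (crossInd l e p *
            (1 + ∑ q ∈ leaves C, τ q * crossInd l e q))) := by
            rw [Finset.sum_mul, Finset.mul_sum]
            exact Finset.sum_congr rfl fun p _ => by ring
        _ ≤ ∑ p ∈ leaves C, x e * (y p * (crossInd l e p * (3 / 2 + τ p))) :=
            Finset.sum_le_sum fun p hp => mul_le_mul_of_nonneg_left
              (mul_le_mul_of_nonneg_left (hlink e p hp h) (hy p).1) (hx e)
        _ = _ := Finset.sum_congr rfl fun p _ => by ring
    · simp [h]
  have hstep3 : ∀ p ∈ leaves C, y p * (3 / 2 + τ p) * partWeight l x P p ≤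
      3 / 2 * y p + 2 * (cutWeight l x p - 1) := by
    intro p hp
    have h1 := hcut p (leaves_subset hp)
    have h2 := cutWeight_eq_add_add (l := l) (x := x) (C := C) p
    have h3 := partWeight_nonneg (l := l) hx (fun e => ¬JoinsLeaves l C e) p
    have h4 : τ p ≤ partWeight l x (IsTwin l C) p := min_le_left _ _
    have h5 : partWeight l x P p ≤ 1 + (cutWeight l x p - 1) - τ p := by
      rw [hP]; linarith
    have h6 := hτ0 p
    have h7 := hτ1 p
    have h8 : (3 / 2 + τ p) * partWeight l x P p ≤ 3 / 2 + 2 * (cutWeight l x p - 1) := by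
      refine (mul_le_mul_of_nonneg_left h5 (by linarith)).trans ?_
      nlinarith
    obtain ⟨h9, h10⟩ := hy p
    rw [mul_assoc]
    refine (mul_le_mul_of_nonneg_left h8 h9).trans ?_
    nlinarith
  rw [hstep1]
  refine (Finset.sum_le_sum fun e _ => hstep2 e).trans ?_
  rw [Finset.sum_comm]
  simp only [← Finset.mul_sum]
  change ∑ p ∈ leaves C, y p * (3 / 2 + τ p) * partWeight l x P p ≤ _
  refine (Finset.sum_le_sum hstep3).trans ?_
  rw [Finset.sum_add_distrib, ← Finset.mul_sum, ← Finset.mul_sum]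
  linarith

/-- A maximum matching among the non-twin links joining leaves is large or the weights are. -/
theorem exists_matchedFamily [Fintype E] [Fintype V] (hC : Laminar C) (hx : ∀ e, 0 ≤ x e)
    (hcut : ∀ D ∈ C, 1 ≤ cutWeight l x D) :
    ∃ M, MatchedFamily l x C M ∧ (12 * (leaves C).card : ℝ) ≤ 20 * ∑ e, x e + 9 * M.card := by
  set P : E → Prop := fun e => JoinsLeaves l C e ∧ ¬IsTwin l C e with hP
  obtain ⟨M, hM, hmax⟩ := Finset.exists_max_image
    ((Finset.univ : Finset (Finset E)).filter fun M =>
      IsMatching (leaves C) (LeafInc l) M ∧ ∀ e ∈ M, P e) Finset.card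
    ⟨∅, Finset.mem_filter.2 ⟨Finset.mem_univ _, ⟨by simp, by simp⟩, by simp⟩⟩
  obtain ⟨-, hmat, hMP⟩ := Finset.mem_filter.1 hM
  obtain ⟨y, hy, hysum, hycov⟩ := exists_fractional_vertex_cover hC.leaf_pairwise
    (fun e (he : P e) => he.1) hmat hMP fun M' h h' =>
      hmax M' (Finset.mem_filter.2 ⟨Finset.mem_univ _, h, h'⟩)
  refine ⟨M, ⟨hC, hx, hcut, hmat, ?_⟩, ?_⟩
  · intro e he p q hpq hpe hqe D hD heq
    refine (hMP e he).2 ⟨D, ⟨hD, p, q, hpq, heq⟩, fun r hr => ?_⟩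
    rw [heq, Finset.mem_insert, Finset.mem_singleton] at hr
    rcases hr with rfl | rfl <;> assumption
  have h1 := totalWeight_add_sum_le hC hx hcut hy hysum hycov
  have h2 := sum_twin_weight_le hC hx hcut
  have h3 := sum_partWeight (x := x) hC fun e (h : IsTwin l C e) => h.joinsLeaves
  have h4 := sum_partWeight (x := x) hC fun e (h : P e) => h.1
  have h5 := sum_partWeight_not_joinsLeaves_le (l := l) hC hx
  have h6 := sum_cutWeight_add_vol_le (l := l) hC hx
  have h7 : ∑ p ∈ leaves C, cutWeight l x p = _ :=
    Finset.sum_congr rfl fun p _ => cutWeight_eq_add_add (l := l) (x := x) (C := C) p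
  rw [Finset.sum_add_distrib, Finset.sum_add_distrib] at h7
  rw [Finset.sum_add_distrib, Finset.sum_add_distrib, ← Finset.mul_sum] at h2
  simp only [Finset.sum_sub_distrib, Finset.sum_const, nsmul_eq_mul, mul_one] at h1 h2
  have h8 : 0 ≤ vol l x (inner C Finset.univ) := vol_nonneg hx _
  have h9 : ∑ p ∈ leaves C, (1 : ℝ) ≤ ∑ p ∈ leaves C, cutWeight l x p :=
    Finset.sum_le_sum fun p hp => hcut p (leaves_subset hp)
  rw [Finset.sum_const, nsmul_eq_mul, mul_one] at h9
  simp only [hP] at h1 h4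
  linarith

/-- A laminar family can be covered by at most `28 / 15` times the weight of a fractional cover. -/
theorem Laminar.exists_cover [Fintype E] [Fintype V] (hC : Laminar C) (hx : ∀ e, 0 ≤ x e)
    (hcut : ∀ D ∈ C, 1 ≤ cutWeight l x D) :
    ∃ J : Finset E, (∀ D ∈ C, ∃ e ∈ J, Crosses l e D) ∧ (J.card : ℝ) ≤ 28 / 15 * ∑ e, x e := by
  obtain ⟨M, hM, hbound⟩ := exists_matchedFamily hC hx hcut
  obtain ⟨J, hJ, hcard⟩ := hM.exists_cover
  refine ⟨J, hJ, ?_⟩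
  have h1 := sum_cutWeight_add_vol_le (l := l) hC hx
  have h2 : surplus l x C M Finset.univ ≤ 2 * ∑ e, x e - (leaves C).card := by
    have h3 : leavesIn C Finset.univ = leaves C := by
      ext p; simp [mem_leavesIn]
    have h4 : ∑ p ∈ (leaves C).filter (Touched (LeafInc l) M), (cutWeight l x p - 1) ≤
        ∑ p ∈ leaves C, (cutWeight l x p - 1) :=
      Finset.sum_le_sum_of_subset_of_nonneg (Finset.filter_subset _ _) fun p hp _ =>
        sub_nonneg.2 (hcut p (leaves_subset hp))
    rw [Finset.sum_sub_distrib (s := leaves C), Finset.sum_const, nsmul_eq_mul, mul_one] at h4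
    unfold surplus
    rw [h3]
    linarith
  linarith

end

/-! ### The cuts of a tree -/

section TreeCuts

variable {V : Type*} {T : SimpleGraph V} {f g : Sym2 V} {u v c r : V}

/-- A walk of `T - f` that starts away from an end of `g` avoids `g`. -/
theorem reachable_deleteEdges_of_not_reachable (h : (T.deleteEdges {f}).Reachable u v) (hc : c ∈ g)
    (hn : ¬(T.deleteEdges {f}).Reachable u c) : (T.deleteEdges {g}).Reachable u v := by
  obtain ⟨p⟩ := h
  induction p with
  | nil => exact SimpleGraph.Reachable.refl _
  | @cons a b d hab p ih =>
    have hb : ¬(T.deleteEdges {f}).Reachable b c := fun h => hn (hab.reachable.trans h)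
    refine SimpleGraph.Reachable.trans (SimpleGraph.Adj.reachable ?_) (ih hb)
    rw [SimpleGraph.deleteEdges_adj] at hab ⊢
    refine ⟨hab.1, fun hg => ?_⟩
    rw [Set.mem_singleton_iff] at hg
    rw [← hg, Sym2.mem_iff] at hc
    rcases hc with rfl | rfl
    · exact hn (SimpleGraph.Reachable.refl _)
    · exact hb (SimpleGraph.Reachable.refl _)

/-- After the deletion of an edge, every node of a connected graph reaches one of its ends. -/
theorem reachable_deleteEdges_or {a b : V} (h : T.Reachable v a) :
    (T.deleteEdges {s(a, b)}).Reachable v a ∨ (T.deleteEdges {s(a, b)}).Reachable v b := by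
  obtain ⟨p⟩ := h
  induction p with
  | nil => exact Or.inl (SimpleGraph.Reachable.refl _)
  | @cons w w' a hab p ih =>
    by_cases hf : s(w, w') = s(a, b)
    · rcases Sym2.eq_iff.1 hf with ⟨rfl, rfl⟩ | ⟨rfl, rfl⟩
      · exact Or.inl (SimpleGraph.Reachable.refl _)
      · exact Or.inr (SimpleGraph.Reachable.refl _)
    · have h1 : (T.deleteEdges {s(a, b)}).Reachable w w' :=
        SimpleGraph.Adj.reachable (SimpleGraph.deleteEdges_adj.2 ⟨hab, hf⟩)
      exact ih.imp h1.trans h1.trans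

theorem not_reachable_deleteEdges (hT : T.IsTree) {a b : V} (hf : T.Adj a b) :
    ¬(T.deleteEdges {s(a, b)}).Reachable a b :=
  SimpleGraph.isBridge_iff.1 (SimpleGraph.isAcyclic_iff_forall_adj_isBridge.1 hT.isAcyclic hf)

/-- `T - f` has at most two components. -/
theorem reachable_deleteEdges_of_not (hT : T.IsTree) (hu : ¬(T.deleteEdges {f}).Reachable r u)
    (hv : ¬(T.deleteEdges {f}).Reachable r v) : (T.deleteEdges {f}).Reachable u v := by
  induction f using Sym2.ind with
  | _ a b =>
    have key : ∀ w, (T.deleteEdges {s(a, b)}).Reachable w a ∨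
        (T.deleteEdges {s(a, b)}).Reachable w b := fun w =>
      reachable_deleteEdges_or (hT.connected.preconnected w a)
    rcases key r with h | h <;> rcases key u with h1 | h1 <;> rcases key v with h2 | h2
    all_goals first
      | exact h1.trans h2.symm
      | exact absurd (h.trans h1.symm) hu
      | exact absurd (h.trans h2.symm) hv

variable [Fintype V]

/-- The nodes separated from the root `r` by the edge `f`. -/
noncomputable def treeCut (T : SimpleGraph V) (r : V) (f : Sym2 V) : Finset V :=
  Finset.univ.filter fun v => ¬(T.deleteEdges {f}).Reachable r v

theorem mem_treeCut : v ∈ treeCut T r f ↔ ¬(T.deleteEdges {f}).Reachable r v := by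
  simp [treeCut]

theorem exists_end_mem_treeCut (hT : T.IsTree) (hf : f ∈ T.edgeSet) :
    ∃ b ∈ f, b ∈ treeCut T r f := by
  induction f using Sym2.ind with
  | _ a b =>
    by_cases h : (T.deleteEdges {s(a, b)}).Reachable r a
    · exact ⟨b, Sym2.mem_mk_right a b,
        mem_treeCut.2 fun hb => not_reachable_deleteEdges hT hf (h.symm.trans hb)⟩
    · exact ⟨a, Sym2.mem_mk_left a b, mem_treeCut.2 h⟩

theorem treeCut_nested (hT : T.IsTree) (hf : f ∈ T.edgeSet) :
    treeCut T r f ⊆ treeCut T r g ∨ treeCut T r g ⊆ treeCut T r f ∨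
      Disjoint (treeCut T r f) (treeCut T r g) := by
  -- if an end of `h` lies in the cut of `k`, then the cut of `h` is contained in that of `k`
  have sub : ∀ h k : Sym2 V, (∃ c ∈ h, c ∈ treeCut T r k) → treeCut T r h ⊆ treeCut T r k := by
    rintro h k ⟨c, hch, hck⟩ v hv
    rw [mem_treeCut] at hv hck ⊢
    exact fun hn => hv (reachable_deleteEdges_of_not_reachable hn hch hck)
  by_cases h1 : ∃ c ∈ f, c ∈ treeCut T r g
  · exact Or.inl (sub f g h1)
  by_cases h2 : ∃ c ∈ g, c ∈ treeCut T r f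
  · exact Or.inr (Or.inl (sub g f h2))
  push Not at h1 h2
  refine Or.inr (Or.inr (Finset.disjoint_left.2 fun v hvf hvg => ?_))
  obtain ⟨b, hbf, hb⟩ := exists_end_mem_treeCut (r := r) hT hf
  have hbg := h1 b hbf
  obtain ⟨c, hcg⟩ : ∃ c, c ∈ g := ⟨_, Sym2.out_fst_mem g⟩
  have hcf := h2 c hcg
  rw [mem_treeCut] at hvf hvg hb hbg hcf
  rw [not_not] at hbg hcf
  have h3 := reachable_deleteEdges_of_not hT hb hvf
  exact hvg (hbg.trans (reachable_deleteEdges_of_not_reachable h3 hcg fun h =>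
    hb (hcf.trans h.symm)))

/-- The cuts of the edges of a tree, away from the root. -/
noncomputable def treeCuts (T : SimpleGraph V) (r : V) : Finset (Finset V) :=
  (Finset.univ.filter (· ∈ T.edgeSet)).image (treeCut T r)

theorem mem_treeCuts {D : Finset V} : D ∈ treeCuts T r ↔ ∃ f ∈ T.edgeSet, treeCut T r f = D := by
  simp [treeCuts]

theorem laminar_treeCuts (hT : T.IsTree) (r : V) : Laminar (treeCuts T r) := by
  constructor
  · intro D hD
    obtain ⟨f, hf, rfl⟩ := mem_treeCuts.1 hD
    obtain ⟨b, -, hb⟩ := exists_end_mem_treeCut (r := r) hT hf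
    exact ⟨b, hb⟩
  · intro D hD D' hD'
    obtain ⟨f, hf, rfl⟩ := mem_treeCuts.1 hD
    obtain ⟨g, -, rfl⟩ := mem_treeCuts.1 hD'
    exact treeCut_nested hT hf

end TreeCuts

/-! ### Tree Augmentation -/

section Augmentation

variable {V : Type*} {E : Type*} {T : SimpleGraph V} {ends : E → Sym2 V}

theorem mk_out (e : E) : s((Quot.out (ends e)).1, (Quot.out (ends e)).2) = ends e :=
  Quot.out_eq (ends e)

variable [Fintype V]

/-- A link covers a tree edge only if it crosses the cut of that edge. -/
theorem Covers.crosses (hT : T.IsTree) (r : V) {e : E} {f : T.edgeSet} (h : Covers T ends e f) :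
    Crosses (fun e => Quot.out (ends e)) e (treeCut T r f) := by
  obtain ⟨a, b, p, hab, hp, hf⟩ := h
  have hnot : ¬(T.deleteEdges {(f : Sym2 V)}).Reachable a b := by
    intro h
    obtain ⟨q, hq⟩ := h.exists_isPath
    have hle : T.deleteEdges {(f : Sym2 V)} ≤ T := SimpleGraph.deleteEdges_le _
    have hpq : p = q.mapLe hle := congrArg Subtype.val
      ((hT.isAcyclic.subsingleton_path a b).elim ⟨p, hp⟩
        ⟨q.mapLe hle, (SimpleGraph.Walk.isPath_mapLe hle).2 hq⟩)
    rw [hpq, SimpleGraph.Walk.edges_mapLe_eq_edges] at hf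
    have := q.edges_subset_edgeSet hf
    simp at this
  have hcr : ¬(a ∈ treeCut T r f ↔ b ∈ treeCut T r f) := by
    rw [mem_treeCut, mem_treeCut]
    intro h
    by_cases ha : (T.deleteEdges {(f : Sym2 V)}).Reachable r a
    · exact hnot (ha.symm.trans (not_not.1 fun hb => h.2 hb ha))
    · exact hnot (reachable_deleteEdges_of_not hT ha (h.1 ha))
  rw [← mk_out (ends := ends) e] at hab
  unfold Crosses
  rcases Sym2.eq_iff.1 hab with ⟨h1, h2⟩ | ⟨h1, h2⟩ <;> rw [h1, h2]
  · exact hcr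
  · exact fun h => hcr h.symm

/-- Links that cross the cuts of all edges form a solution: after the deletion of a tree edge, some
link reconnects the two components, and otherwise the tree itself is still there. -/
theorem isSolution_of_crosses (hT : T.IsTree) (r : V) {J : Finset E}
    (hJ : ∀ f ∈ T.edgeSet, ∃ e ∈ J, Crosses (fun e => Quot.out (ends e)) e (treeCut T r f)) :
    IsSolution T ends J := by
  intro D hD
  have hsub : D.Subsingleton := by
    rw [← Set.encard_le_one_iff_subsingleton]
    exact Order.le_of_lt_add_one (by simpa [one_add_one_eq_two] using hD)
  have : Nonempty V := ⟨r⟩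
  by_cases h : ∃ f, Sum.inl f ∈ D
  · obtain ⟨f, hf⟩ := h
    have hle : T.deleteEdges {(f : Sym2 V)} ≤
        SimpleGraph.fromEdgeSet (unionEnds T ends J '' Dᶜ) := by
      intro u v huv
      rw [SimpleGraph.deleteEdges_adj] at huv
      refine (SimpleGraph.fromEdgeSet_adj _).2 ⟨⟨Sum.inl ⟨s(u, v), huv.1⟩, fun hn => ?_, rfl⟩,
          huv.1.ne⟩
      have := hsub hn hf
      rw [Sum.inl.injEq] at this
      exact huv.2 (by rw [← this]; rfl)
    obtain ⟨e, heJ, hc⟩ := hJ f f.2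
    have hne : (Quot.out (ends e)).1 ≠ (Quot.out (ends e)).2 := fun h => hc (by simp only [h])
    have hadj : (SimpleGraph.fromEdgeSet (unionEnds T ends J '' Dᶜ)).Adj
        (Quot.out (ends e)).1 (Quot.out (ends e)).2 := by
      refine (SimpleGraph.fromEdgeSet_adj _).2 ⟨⟨Sum.inr ⟨e, heJ⟩, fun hn => ?_,
          (mk_out e).symm⟩, hne⟩
      exact absurd (hsub hn hf) (by simp)
    have hreach : ∀ w, (SimpleGraph.fromEdgeSet (unionEnds T ends J '' Dᶜ)).Reachable r w := by
      intro w
      by_cases hw : w ∈ treeCut T r f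
      · have hw' := mem_treeCut.1 hw
        rcases hc.cases with ⟨h1, h2⟩ | ⟨h1, h2⟩
        · rw [mem_treeCut] at h1 h2
          exact ((not_not.1 h2).mono hle).trans (hadj.symm.reachable.trans
            ((reachable_deleteEdges_of_not hT h1 hw').mono hle))
        · rw [mem_treeCut] at h1 h2
          exact ((not_not.1 h2).mono hle).trans (hadj.reachable.trans
            ((reachable_deleteEdges_of_not hT h1 hw').mono hle))
      · rw [mem_treeCut, not_not] at hw
        exact hw.mono hle
    exact ⟨fun u v => (hreach u).symm.trans (hreach v)⟩
  · push Not at h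
    refine hT.connected.mono fun u v huv => (SimpleGraph.fromEdgeSet_adj _).2
      ⟨⟨Sum.inl ⟨s(u, v), huv⟩, h _, rfl⟩, huv.ne⟩

/-- Every feasible point of the Cut-LP is worth at least `15 / 28` of a solution. -/
theorem exists_isSolution_card_le [Fintype E] (hT : T.IsTree) {x : E → ℝ}
    (hx : x ∈ cutPolyhedron T ends) :
    ∃ J, IsSolution T ends J ∧ (J.card : ℝ) ≤ 28 / 15 * ∑ e, x e := by
  obtain ⟨r⟩ := hT.connected.nonempty
  obtain ⟨hcut, hnonneg⟩ := hx
  have hcut' : ∀ D ∈ treeCuts T r, 1 ≤ cutWeight (fun e => Quot.out (ends e)) x D := by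
    intro D hD
    obtain ⟨f, hf, rfl⟩ := mem_treeCuts.1 hD
    refine (hcut ⟨f, hf⟩).trans ?_
    unfold psi cutWeight
    rw [Finset.sum_filter]
    refine Finset.sum_le_sum fun e _ => ?_
    split_ifs with h
    · rw [crossInd_of_crosses (h.crosses hT r), mul_one]
    · exact mul_nonneg (hnonneg e) (crossInd_nonneg _)
  obtain ⟨J, hJ, hcard⟩ := (laminar_treeCuts hT r).exists_cover hnonneg hcut'
  exact ⟨J, isSolution_of_crosses hT r fun f hf => hJ _ (mem_treeCuts.2 ⟨f, hf, rfl⟩), hcard⟩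

theorem integralOpt_div_cutLPOpt_le [Fintype E] (hT : T.IsTree) :
    integralOpt T ends / cutLPOpt T ends ≤ 28 / 15 := by
  have h0 : (28 / 15 : ENNReal) ≠ 0 := by simp
  have htop : (28 / 15 : ENNReal) ≠ ⊤ := by
    simp [ENNReal.div_eq_top]
  have hreal : ENNReal.ofReal (28 / 15) = 28 / 15 := by
    rw [ENNReal.ofReal_div_of_pos (by norm_num)]
    simp
  refine ENNReal.div_le_of_le_mul ?_
  rw [mul_comm]
  refine (ENNReal.div_le_iff h0 htop).1 ?_
  refine le_iInf₂ fun x hx => ?_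
  obtain ⟨J, hJ, hcard⟩ := exists_isSolution_card_le hT hx
  refine ENNReal.div_le_of_le_mul' ?_
  calc integralOpt T ends ≤ J.card := iInf₂_le J hJ
    _ = ENNReal.ofReal J.card := (ENNReal.ofReal_natCast _).symm
    _ ≤ ENNReal.ofReal (28 / 15 * ∑ e, x e) := ENNReal.ofReal_le_ofReal hcard
    _ = 28 / 15 * ENNReal.ofReal (∑ e, x e) := by
      rw [ENNReal.ofReal_mul (by norm_num), hreal]

end Augmentation

end TreeAugmentation

theorem theorem2 : TreeAugmentation.cutLPIntegralityGap ≤ 28 / 15 := by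
  unfold TreeAugmentation.cutLPIntegralityGap
  refine iSup_le fun V => iSup_le fun E => iSup_le fun _ => iSup_le fun _ => iSup_le fun T =>
    iSup_le fun ends => iSup_le fun hT => iSup_le fun _ => ?_
  exact TreeAugmentation.integralOpt_div_cutLPOpt_le hT
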